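/- **Graphs.** A half-edged colored tensor graph of rank 4 is a finite bipartite graph in which every vertex meets, for each color $i\in\{0,1,2,3,4\}$, exactly one edge or half-edge of color $i$. It is regarded as a stranded graph: each vertex has five pre-edges $h$, one of each color; the pre-edge of color $i$ has four points $(h,j)$, $j\neq i$; a chord of the vertex, with color pair $\{i,j\}$, joins the point $j$ of its pre-edge of color $i$ to the point $i$ of its pre-edge of color $j$; an edge between pre-edges $h,h'$ of color $i$ consists of the four strands joining $(h,j)$ to $(h',j)$, $j\ne i$. In a stranded graph the vertices are the classes of pre-edges connected through chords, together with finitely many trivial discs. *Cutting* an edge $e$ ($\mathcal G\vee e$) replaces it by two half-edges. *Contracting* $e$ ($\mathcal G/e$) removes its two pre-edges, joins directly the chords that end on the two ends of the same strand of $e$, and replaces by a disc each closed face consisting of one strand of $e$ and one chord joining its two ends (an inner face; $e$ is $p$-inner if it has $p$ of them); if the resulting chord diagram is disconnected, each of its components is a vertex. A rank 4 w-colored graph $\mathfrak G$ is the class, up to adding or removing discs, of a stranded graph obtained by successive edge contractions from a half-edged colored tensor graph. **Special edges.** An edge $e$ is a *loop* if both its pre-edges lie on the same vertex, a *bridge*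 if cutting it disconnects its two pre-edges, and *regular* if it is neither. A loop $e$ is *trivial* if, once its two pre-edges are taken away, pre-edges reached by chords from the ends of two different outer (non-inner) strands of $e$ are never in the same connected component of what remains of the graph (a void condition for 3- and 4-inner loops). **Invariant.** A spanning c-subgraph $A\Subset\mathcal G$ is obtained by cutting a subset of the edges of $\mathcal G$. Let $V,E,k,f$ be the numbers of vertices, edges, connected components (discs count as vertices and as components) and half-edges; $r=V-k$, $n=E-r$. A face is a connected chain of chords and edge strands; it is open if it passes through a half-edge, and $F_{\rm int}$ is the number of closed faces, each disc counting as one. $B^d$ is the number of $d$-bubbles: for each set $C$ of $d$ colors, the connected components of the graph formed by the pre-edges with color in $C$ and the strands with both colors in $C$ (discs do not count). The boundary graph has the half-edges as vertices and the open faces as edges; $C_\partial$ and $E_\partial$ are its numbers of connected components and edges, and $F_\partial$ is its number of faces, that is, of cycles, for some set $C$ of three colors, formed by boundary edges with both colors in $C$. For positive rationals $\alpha_3,\alpha_4$ put $$\gamma_{4;(\alpha_3,\alpha_4)}=6(V-E)+3F_{\rm int}-2(1+\alpha_3)B^3+(3\alpha_3-\alpha_4)B^4,$$ $$\mathfrak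 T_{\mathcal G;(\alpha_3,\alpha_4)}=\sum_{A\Subset\mathcal G}(x-1)^{r(\mathcal G)-r(A)}(y-1)^{n(A)}z^{9k(A)-\gamma_{4;(\alpha_3,\alpha_4)}(A)}s^{C_\partial(A)}w^{F_\partial(A)}q^{E_\partial(A)}t^{f(A)},$$ an element of $\mathbb Z[x,y,s,w,q,t][z^{a}:a\in\mathbb Q]$. **Theorem.** Let $\mathfrak G$ be a rank 4 w-colored graph, $\alpha_3,\alpha_4$ positive rational numbers, $\mathcal G$ any representative of $\mathfrak G$ and $e$ an edge of $\mathcal G$. Write $\mathfrak T$ for $\mathfrak T_{\,\cdot\,;(\alpha_3,\alpha_4)}$. 1. If $e$ is regular, then $\mathfrak T_{\mathcal G}=\mathfrak T_{\mathcal G\vee e}+\mathfrak T_{\mathcal G/e}$. 2. If $e$ is a bridge, then $\mathfrak T_{\mathcal G\vee e}=z^{15+4\alpha_4}\,s\,w^6q^4t^2\;\mathfrak T_{\mathcal G/e}$ and $\mathfrak T_{\mathcal G}=\big[(x-1)z^{15+4\alpha_4}\,s\,w^6q^4t^2+1\big]\mathfrak T_{\mathcal G/e}$. 3. If $e$ is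 a trivial $p$-inner loop with $p\in\{0,1,2,3\}$, then $\mathfrak T_{\mathcal G}=\mathfrak T_{\mathcal G\vee e}+(y-1)\,z^{-15+6p+3\alpha_3(4-p)+\alpha_4(3p-8)}\;\mathfrak T_{\mathcal G/e}$. -/

import Mathlib

/-!
Rank 4 stranded graphs with half-edges, coloured by the five colours `0, …, 4`.

Everything is recorded up to the moves that do not change a stranded graph (homeomorphisms of
chords and strands, changes of crossings, permutations of the points inside a pre-edge, moves of
the pre-edges on the frontier), so a stranded vertex is the combinatorial datum of its pre-edges
and of its chords.
-/

/-- The points of the vertex frontiers. A pre-edge `h` of colour `i` has the four points `(h, j)`,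
`j ≠ i`; the strand (of an edge, or chord of a vertex) through `(h, j)` has the pair of colours
`{i, j}`. -/
abbrev FrontierPoint {F : Type} (color : F → Fin 5) : Type :=
  {p : F × Fin 5 // p.2 ≠ color p.1}

/-- The pair of colours of the strand through a point. -/
def pairOfColors {F : Type} (color : F → Fin 5) (p : FrontierPoint color) : Sym2 (Fin 5) :=
  s(color p.1.1, p.1.2)

/-- A half-edged rank 4 stranded graph with coloured strands.

* `Flag` is the set of (non-empty) pre-edges; each carries exactly one end of an edge or exactly
  one half-edge;
* `chord` is the fixed point free pairing of the frontier points by the chords of the vertices;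
* `opp h` is the pre-edge at the other end of the edge at `h`; it is `h` itself if `h`
  carries a half-edge. The four strands of the edge at `h` join `(h, j)` to `(opp h, j)`;
* `discs` is the number of trivial disc vertices.

The non-trivial vertices are the classes of pre-edges that are connected through chords, since
the pre-edges of a stranded vertex form a connected collection. -/
structure StrandedGraph where
  Flag : Type
  finite_flag : Finite Flag
  color : Flag → Fin 5
  chord : FrontierPoint color → FrontierPoint color
  chord_chord : ∀ p, chord (chord p) = p
  chord_ne : ∀ p, chord p ≠ p
  chord_pair : ∀ p, pairOfColors color (chord p) = pairOfColors color p
  opp : Flag → Flag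
  opp_opp : ∀ h, opp (opp h) = h
  opp_color : ∀ h, color (opp h) = color h
  discs : ℕ

namespace StrandedGraph

attribute [instance] StrandedGraph.finite_flag

variable (G : StrandedGraph)

abbrev Point : Type := FrontierPoint G.color

/-- The other end of the strand of an edge (a point of a half-edge is sent to itself). -/
def strand (p : G.Point) : G.Point :=
  ⟨(G.opp p.1.1, p.1.2), by rw [G.opp_color]; exact p.2⟩

/-- An edge, given by one of its two pre-edges; the other one is `G.opp e`. -/
abbrev Edge : Type := {h : G.Flag // G.opp h ≠ h}

abbrev HalfEdge : Type := {h : G.Flag // G.opp h = h}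

/-- Two pre-edges joined by a chord of a vertex. -/
def ChordAdj (h h' : G.Flag) : Prop :=
  ∃ p : G.Point, p.1.1 = h ∧ (G.chord p).1.1 = h'

/-- Two pre-edges joined by a chord of a vertex or by an edge. -/
def Adj (h h' : G.Flag) : Prop :=
  G.ChordAdj h h' ∨ G.opp h = h'

/-! ### Cutting: c-subgraphs -/

/-- The edges, as unordered pairs of pre-edges. -/
noncomputable def edges : Finset (Sym2 G.Flag) :=
  (Set.toFinite {ε : Sym2 G.Flag | ∃ h, G.opp h ≠ h ∧ ε = s(h, G.opp h)}).toFinset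

open Classical in
/-- The spanning c-subgraph with set of edges `S`: all edges outside `S` are cut, that is,
replaced by two half-edges. -/
noncomputable def cSubgraph (S : Finset (Sym2 G.Flag)) : StrandedGraph where
  Flag := G.Flag
  finite_flag := G.finite_flag
  color := G.color
  chord := G.chord
  chord_chord := G.chord_chord
  chord_ne := G.chord_ne
  chord_pair := G.chord_pair
  opp h := if s(h, G.opp h) ∈ S then G.opp h else h
  opp_opp h := by
    by_cases hS : s(h, G.opp h) ∈ S
    · have : s(G.opp h, h) ∈ S := by
        rw [Sym2.eq_swap]; exact hS
      simp only [hS, if_true, this, G.opp_opp]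
    · simp only [hS, if_false]
  opp_color h := by
    split_ifs
    · exact G.opp_color h
    · rfl
  discs := G.discs

open Classical in
/-- The cut graph `G ∨ e`. -/
noncomputable def cut (e : G.Edge) : StrandedGraph :=
  G.cSubgraph (G.edges.erase s(e.1, G.opp e.1))

/-! ### Contraction -/

/-- The pre-edge `h` is one of the two pre-edges of the edge `e`. -/
def IsEnd (e : G.Edge) (h : G.Flag) : Prop := h = e.1 ∨ h = G.opp e.1

/-- The strand of `e` through its point `p` closes up inside `e` and its end vertices, i.e. a chord
joins the two end points of the strand. -/
def IsInnerStrand (p : G.Point) : Prop := G.chord p = G.strand p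

/-- The number `p` of inner faces of `e`; the edge is then called `p`-inner. -/
noncomputable def innerCount (e : G.Edge) : ℕ :=
  Nat.card {p : G.Point // p.1.1 = e.1 ∧ G.IsInnerStrand p}

open Classical in
/-- The end of the chord from `p` after the contraction of `e`: a chord that runs into a pre-edge
of `e` is continued along the strand of `e` and the chord at the other end of this strand. -/
noncomputable def throughChord (e : G.Edge) (p : G.Point) : G.Point :=
  if G.IsEnd e (G.chord p).1.1 then G.chord (G.strand (G.chord p)) else G.chord p

variable {G}

theorem IsEnd.opp {e : G.Edge} {h : G.Flag} (H : G.IsEnd e h) : G.IsEnd e (G.opp h) := by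
  rcases H with rfl | rfl
  · exact Or.inr rfl
  · exact Or.inl (G.opp_opp _)

theorem IsEnd.color_eq {e : G.Edge} {h : G.Flag} (H : G.IsEnd e h) :
    G.color h = G.color e.1 := by
  rcases H with rfl | rfl
  · rfl
  · exact G.opp_color _

theorem not_isEnd_opp {e : G.Edge} {h : G.Flag} (H : ¬ G.IsEnd e h) : ¬ G.IsEnd e (G.opp h) :=
  fun H' => H (by simpa [G.opp_opp] using H'.opp)

theorem strand_strand (p : G.Point) : G.strand (G.strand p) = p := by
  apply Subtype.ext
  exact Prod.ext (G.opp_opp _) rfl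

theorem pair_strand (p : G.Point) :
    pairOfColors G.color (G.strand p) = pairOfColors G.color p := by
  simp [pairOfColors, strand, G.opp_color]

theorem snd_eq_of_pair {p q : G.Point} (hc : G.color p.1.1 = G.color q.1.1)
    (h : pairOfColors G.color p = pairOfColors G.color q) : p.1.2 = q.1.2 := by
  unfold pairOfColors at h
  rw [hc] at h
  exact Sym2.congr_right.mp h

theorem eq_or_eq_opp {e : G.Edge} {h h' : G.Flag} (H : G.IsEnd e h) (H' : G.IsEnd e h') :
    h' = h ∨ h' = G.opp h := by
  rcases H with rfl | rfl <;> rcases H' with rfl | rfl <;> simp [G.opp_opp]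

theorem not_isEnd_chord_strand {e : G.Edge} {p : G.Point} (hp : ¬ G.IsEnd e p.1.1)
    (hq : G.IsEnd e (G.chord p).1.1) : ¬ G.IsEnd e (G.chord (G.strand (G.chord p))).1.1 := by
  intro hs
  have hr : G.IsEnd e (G.strand (G.chord p)).1.1 := hq.opp
  have h2 : (G.chord (G.strand (G.chord p))).1.2 = (G.strand (G.chord p)).1.2 :=
    snd_eq_of_pair (hs.color_eq.trans hr.color_eq.symm) (G.chord_pair _)
  rcases eq_or_eq_opp hr hs with h | h
  · exact G.chord_ne _ (Subtype.ext (Prod.ext h h2))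
  · have h3 : G.chord (G.strand (G.chord p)) = G.chord p := by
      apply Subtype.ext
      exact Prod.ext (h.trans (G.opp_opp _)) h2
    have h4 : G.strand (G.chord p) = p := by
      rw [← G.chord_chord (G.strand (G.chord p)), h3, G.chord_chord]
    rw [h4] at hr
    exact hp hr

theorem not_isEnd_throughChord {e : G.Edge} {p : G.Point} (hp : ¬ G.IsEnd e p.1.1) :
    ¬ G.IsEnd e (G.throughChord e p).1.1 := by
  unfold throughChord
  split_ifs with hq
  · exact not_isEnd_chord_strand hp hq
  · exact hq

theorem throughChord_throughChord {e : G.Edge} {p : G.Point} (hp : ¬ G.IsEnd e p.1.1) :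
    G.throughChord e (G.throughChord e p) = p := by
  by_cases hq : G.IsEnd e (G.chord p).1.1
  · have h1 : G.throughChord e p = G.chord (G.strand (G.chord p)) := if_pos hq
    have h2 : G.IsEnd e (G.chord (G.throughChord e p)).1.1 := by
      rw [h1, G.chord_chord]; exact hq.opp
    rw [throughChord, if_pos h2, h1, G.chord_chord, strand_strand, G.chord_chord]
  · have h1 : G.throughChord e p = G.chord p := if_neg hq
    have h2 : ¬ G.IsEnd e (G.chord (G.throughChord e p)).1.1 := by
      rw [h1, G.chord_chord]; exact hp
    rw [throughChord, if_neg h2, h1, G.chord_chord]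

theorem throughChord_ne {e : G.Edge} {p : G.Point} : G.throughChord e p ≠ p := by
  unfold throughChord
  split_ifs with hq
  · intro h
    have h1 : G.strand (G.chord p) = G.chord p := by
      rw [← G.chord_chord (G.strand (G.chord p)), h]
    have h2 : G.opp (G.chord p).1.1 = (G.chord p).1.1 := congrArg (fun r => r.1.1) h1
    rcases hq with hq | hq
    · rw [hq] at h2; exact e.2 h2
    · rw [hq, G.opp_opp] at h2; exact e.2 h2.symm
  · exact G.chord_ne p

theorem pair_throughChord {e : G.Edge} {p : G.Point} :
    pairOfColors G.color (G.throughChord e p) = pairOfColors G.color p := by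
  unfold throughChord
  split_ifs with hq
  · rw [G.chord_pair, pair_strand, G.chord_pair]
  · exact G.chord_pair p

variable (G)

/-- The contracted graph `G / e`: the two pre-edges of `e` are removed, every inner face of `e`
becomes a disc vertex, and the neighbours of the two pre-edges are connected directly via the
outer strands of `e`. If the chord diagram that is obtained so is disconnected, each of its
components is a vertex of `G / e`. -/
noncomputable def contract (e : G.Edge) : StrandedGraph where
  Flag := {h : G.Flag // ¬ G.IsEnd e h}
  finite_flag := inferInstance
  color h := G.color h.1
  chord p := ⟨(⟨(G.throughChord e ⟨(p.1.1.1, p.1.2), p.2⟩).1.1,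
      not_isEnd_throughChord (p := ⟨(p.1.1.1, p.1.2), p.2⟩) p.1.1.2⟩,
      (G.throughChord e ⟨(p.1.1.1, p.1.2), p.2⟩).1.2),
    (G.throughChord e ⟨(p.1.1.1, p.1.2), p.2⟩).2⟩
  chord_chord p := by
    have h := throughChord_throughChord (e := e) (p := ⟨(p.1.1.1, p.1.2), p.2⟩) p.1.1.2
    apply Subtype.ext
    refine Prod.ext (Subtype.ext ?_) ?_
    · exact congrArg (fun r => r.1.1) h
    · exact congrArg (fun r => r.1.2) h
  chord_ne p := by
    intro h
    apply throughChord_ne (e := e) (p := ⟨(p.1.1.1, p.1.2), p.2⟩)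
    apply Subtype.ext
    refine Prod.ext ?_ ?_
    · exact congrArg (fun r => r.1.1.1) h
    · exact congrArg (fun r => r.1.2) h
  chord_pair p := pair_throughChord (e := e) (p := ⟨(p.1.1.1, p.1.2), p.2⟩)
  opp h := ⟨G.opp h.1, not_isEnd_opp h.2⟩
  opp_opp h := Subtype.ext (G.opp_opp h.1)
  opp_color h := G.opp_color h.1
  discs := G.discs + G.innerCount e

/-! ### Special edges -/

/-- Both pre-edges of `e` lie on the same vertex. -/
def IsLoop (e : G.Edge) : Prop := Relation.EqvGen G.ChordAdj e.1 (G.opp e.1)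

/-- Cutting `e` disconnects its two pre-edges. -/
def IsBridge (e : G.Edge) : Prop := ¬ Relation.EqvGen (G.cut e).Adj e.1 (G.opp e.1)

/-- Neither a loop nor a bridge. -/
def IsRegular (e : G.Edge) : Prop := ¬ G.IsLoop e ∧ ¬ G.IsBridge e

/-- Adjacency (through a chord or an edge) in what remains of `G` once the two pre-edges of `e` are
taken away. -/
def AdjOutside (e : G.Edge) (h h' : G.Flag) : Prop :=
  ¬ G.IsEnd e h ∧ ¬ G.IsEnd e h' ∧ G.Adj h h'

/-- A trivial loop. The sectors of the loop `e` are the parts of the vertex hanging on its outer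
strands (an outer strand has two end points, and from each of them a chord leads to a pre-edge that
is not a pre-edge of `e`). The loop is trivial if the sectors of different outer strands
are separate and stay disconnected from each other in the rest of the graph. The condition is void
for 3-inner and 4-inner loops. -/
def IsTrivialLoop (e : G.Edge) : Prop :=
  G.IsLoop e ∧ ∀ p q : G.Point, G.IsEnd e p.1.1 → G.IsEnd e q.1.1 → p.1.2 ≠ q.1.2 →
    ¬ G.IsEnd e (G.chord p).1.1 → ¬ G.IsEnd e (G.chord q).1.1 →
      ¬ Relation.EqvGen (G.AdjOutside e) (G.chord p).1.1 (G.chord q).1.1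

/-! ### The numbers attached to a graph -/

/-- `V`, the number of vertices (disc vertices included). -/
noncomputable def numVertices : ℕ := Nat.card (Quot G.ChordAdj) + G.discs

/-- `E`, the number of edges. -/
noncomputable def numEdges : ℕ := G.edges.card

/-- `k`, the number of connected components (each disc is one). -/
noncomputable def numComponents : ℕ := Nat.card (Quot G.Adj) + G.discs

/-- The rank `r = V - k` (`k ≤ V` always holds). -/
noncomputable def rank : ℕ := G.numVertices - G.numComponents

/-- The nullity `n = E - r` (`r ≤ E` always holds). -/
noncomputable def nullity : ℕ := G.numEdges - G.rank

/-- `f`, the number of half-edges. -/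
noncomputable def numHalfEdges : ℕ := Nat.card G.HalfEdge

/-- One step along a face: a chord of a vertex or a strand of an edge. -/
def FaceStep (p q : G.Point) : Prop := G.chord p = q ∨ G.strand p = q

/-- The faces other than the discs. -/
abbrev Face : Type := Quot G.FaceStep

/-- A face is open if it passes through a half-edge. -/
def IsOpenFace (φ : G.Face) : Prop :=
  ∃ p : G.Point, Quot.mk _ p = φ ∧ G.opp p.1.1 = p.1.1

/-- `F_int`, the number of closed faces; a disc contributes one. -/
noncomputable def numInternalFaces : ℕ := Nat.card {φ : G.Face // ¬ G.IsOpenFace φ} + G.discs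

/-- `B^d`, the number of (open or closed) `d`-bubbles: for each set `C` of `d` colours, the
connected components of the graph made of the pre-edges with colour in `C` and of the strands
with both colours in `C`. -/
noncomputable def numBubbles (d : ℕ) : ℕ :=
  ∑ C ∈ Finset.powersetCard d (Finset.univ : Finset (Fin 5)),
    Nat.card (Quot fun h h' : {h : G.Flag // G.color h ∈ C} =>
      (∃ p : G.Point, p.1.2 ∈ C ∧ p.1.1 = h.1 ∧ (G.chord p).1.1 = h'.1) ∨ G.opp h.1 = h'.1)

/-! ### The boundary graph

Its vertices are the half-edges and its edges are the open faces. -/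

/-- `E_∂`, the number of edges of the boundary graph. -/
noncomputable def numBoundaryEdges : ℕ := Nat.card {φ : G.Face // G.IsOpenFace φ}

/-- `C_∂`, the number of connected components of the boundary graph. -/
noncomputable def numBoundaryComponents : ℕ :=
  Nat.card (Quot fun a b : G.HalfEdge =>
    ∃ p q : G.Point, p.1.1 = a.1 ∧ q.1.1 = b.1 ∧
      (Quot.mk _ p : G.Face) = Quot.mk _ q)

/-- `F_∂`, the number of faces of the boundary graph. Such a face is determined by a set `C` of
three colours: it is a cycle formed by boundary edges whose two colours belong to `C` (every
boundary vertex with colour in `C` lies on exactly two of them). -/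
noncomputable def numBoundaryFaces : ℕ :=
  ∑ C ∈ Finset.powersetCard 3 (Finset.univ : Finset (Fin 5)),
    Nat.card (Quot fun a b : {a : G.HalfEdge // G.color a.1 ∈ C} =>
      ∃ p q : G.Point, p.1.1 = a.1.1 ∧ q.1.1 = b.1.1 ∧ p.1.2 ∈ C ∧ q.1.2 ∈ C ∧
        (Quot.mk _ p : G.Face) = Quot.mk _ q)

/-- The generalized Euler characteristic `γ_{4;(α₃,α₄)}`. -/
noncomputable def gamma (α₃ α₄ : ℚ) : ℚ :=
  6 * ((G.numVertices : ℚ) - (G.numEdges : ℚ)) + 3 * (G.numInternalFaces : ℚ)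
    - 2 * (1 + α₃) * (G.numBubbles 3 : ℚ) + (3 * α₃ - α₄) * (G.numBubbles 4 : ℚ)

end StrandedGraph

/-! ### The ring of values of the invariant -/

/-- The variables that occur with natural exponents. -/
inductive InvVar where
  | x | y | s | w | q | t

/-- Polynomials over `ℤ` in `x, y, s, w, q, t` and in the powers `z ^ a`, `a ∈ ℚ`. -/
abbrev InvRing : Type := AddMonoidAlgebra (MvPolynomial InvVar ℤ) ℚ

namespace InvRing

/-- The variables `x, y, s, w, q, t`. -/
noncomputable def var (v : InvVar) : InvRing := AddMonoidAlgebra.single 0 (MvPolynomial.X v)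

/-- The power `z ^ a`. -/
noncomputable def zpow (a : ℚ) : InvRing := AddMonoidAlgebra.single a 1

end InvRing

namespace StrandedGraph

/-- The contribution of the spanning c-subgraph `A` of `G`. -/
noncomputable def invTerm (α₃ α₄ : ℚ) (G A : StrandedGraph) : InvRing :=
  (InvRing.var .x - 1) ^ (G.rank - A.rank) * (InvRing.var .y - 1) ^ A.nullity *
    InvRing.zpow (9 * (A.numComponents : ℚ) - A.gamma α₃ α₄) *
    InvRing.var .s ^ A.numBoundaryComponents * InvRing.var .w ^ A.numBoundaryFaces *
    InvRing.var .q ^ A.numBoundaryEdges * InvRing.var .t ^ A.numHalfEdges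

/-- The invariant `𝔗_{G;(α₃,α₄)}`, a sum over all spanning c-subgraphs of `G`. -/
noncomputable def invariant (α₃ α₄ : ℚ) (G : StrandedGraph) : InvRing :=
  ∑ S ∈ G.edges.powerset, invTerm α₃ α₄ G (G.cSubgraph S)

/-! ### Weakly-coloured graphs -/

/-- Equality up to trivial discs (and up to relabelling of the pre-edges). -/
def EquivUpToDiscs (G G' : StrandedGraph) : Prop :=
  ∃ φ : G.Flag ≃ G'.Flag,
    (∀ h, G'.color (φ h) = G.color h) ∧
    (∀ h, G'.opp (φ h) = φ (G.opp h)) ∧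
    ∀ (p : G.Point) (p' : G'.Point), p'.1 = (φ p.1.1, p.1.2) →
      (G'.chord p').1 = (φ (G.chord p).1.1, (G.chord p).1.2)

theorem EquivUpToDiscs.refl (G : StrandedGraph) : EquivUpToDiscs G G := by
  refine ⟨Equiv.refl _, fun _ => rfl, fun _ => rfl, fun p p' h => ?_⟩
  have : p' = p := Subtype.ext h
  rw [this]; rfl

theorem EquivUpToDiscs.symm {G G' : StrandedGraph} (H : EquivUpToDiscs G G') :
    EquivUpToDiscs G' G := by
  obtain ⟨φ, hc, ho, hch⟩ := H
  refine ⟨φ.symm, fun h => ?_, fun h => ?_, fun p p' h => ?_⟩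
  · rw [← hc, φ.apply_symm_apply]
  · rw [Equiv.eq_symm_apply, ← ho, φ.apply_symm_apply]
  · have h1 : p.1 = (φ p'.1.1, p'.1.2) := by rw [h]; simp
    have h2 := hch p' p h1
    rw [h2]; simp

theorem EquivUpToDiscs.trans {G G' G'' : StrandedGraph} (H : EquivUpToDiscs G G')
    (H' : EquivUpToDiscs G' G'') : EquivUpToDiscs G G'' := by
  obtain ⟨φ, hc, ho, hch⟩ := H
  obtain ⟨ψ, hc', ho', hch'⟩ := H'
  refine ⟨φ.trans ψ, fun h => ?_, fun h => ?_, fun p p'' h => ?_⟩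
  · simp [hc, hc']
  · simp [ho, ho']
  · let p' : G'.Point := ⟨(φ p.1.1, p.1.2), by simpa [hc] using p.2⟩
    have h1 := hch p p' rfl
    have h2 := hch' p' p'' h
    rw [h2, h1]; rfl

instance discSetoid : Setoid StrandedGraph where
  r := EquivUpToDiscs
  iseqv := ⟨EquivUpToDiscs.refl, EquivUpToDiscs.symm, EquivUpToDiscs.trans⟩

/-- `G'` is obtained from `G` by successive edge contractions. -/
inductive ContractsTo (G : StrandedGraph) : StrandedGraph → Prop
  | refl : ContractsTo G G
  | step {G' : StrandedGraph} (e : G'.Edge) : ContractsTo G G' → ContractsTo G (G'.contract e)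

end StrandedGraph

/-- A half-edged coloured tensor graph of rank 4, in compact form: a finite bipartite graph in which
every vertex meets, for each of the five colours, exactly one edge or half-edge of that
colour. `nbr i v` is the other end of the edge of colour `i` at `v`, and it is `v` itself if there
is a half-edge of colour `i` at `v`. -/
structure ColoredTensorGraph where
  Vertex : Type
  finite_vertex : Finite Vertex
  sign : Vertex → Bool
  nbr : Fin 5 → Vertex → Vertex
  nbr_nbr : ∀ i v, nbr i (nbr i v) = v
  bipartite : ∀ i v, nbr i v ≠ v → sign (nbr i v) ≠ sign v

namespace ColoredTensorGraph

attribute [instance] ColoredTensorGraph.finite_vertex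

/-- The stranded graph of a coloured tensor graph: `v` has five pre-edges `(v, i)`, and for any
`i ≠ j` one chord of `v` joins a point of `(v, i)` to a point of `(v, j)` (so that the vertex graph
is the complete graph on five vertices). -/
def toStranded (C : ColoredTensorGraph) : StrandedGraph where
  Flag := C.Vertex × Fin 5
  finite_flag := inferInstance
  color h := h.2
  chord p := ⟨((p.1.1.1, p.1.2), p.1.1.2), p.2.symm⟩
  chord_chord _ := rfl
  chord_ne p h := p.2 (congrArg (fun r => r.1.1.2) h)
  chord_pair _ := Sym2.eq_swap
  opp h := (C.nbr h.2 h.1, h.2)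
  opp_opp h := Prod.ext (C.nbr_nbr _ _) rfl
  opp_color _ := rfl
  discs := 0

end ColoredTensorGraph

/-- A rank 4 w-coloured graph: the class up to trivial discs of a stranded graph obtained by
successive edge contractions of a half-edged coloured tensor graph. -/
def WColoredGraph : Type 1 :=
  {𝔊 : Quotient StrandedGraph.discSetoid //
    ∃ (C : ColoredTensorGraph) (G : StrandedGraph),
      StrandedGraph.ContractsTo C.toStranded G ∧ 𝔊 = Quotient.mk _ G}

/-- `G` is a representative of the w-coloured graph `𝔊`. -/
def WColoredGraph.IsRepresentative (𝔊 : WColoredGraph) (G : StrandedGraph) : Prop :=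
  𝔊.1 = Quotient.mk _ G

/-!
The spanning c-subgraphs of `G` fall into those that cut `e` and those that contain it. The first
ones are the spanning c-subgraphs of `G ∨ e`, the second ones become, after contraction of `e`, the
spanning c-subgraphs of `G / e`. So everything follows from a comparison, for one graph `A` with
an edge `e`, of the weights of `A`, of its contraction and (if `e` is a bridge) of `A ∨ e`.

A contraction never changes the closed faces (an inner face is replaced by a disc), the half-edges
or the boundary graph. What can change are vertices, components and bubbles, all of which are
classes of pre-edges with colours in some set `C` under chords and possibly edges (`BubbleRel`).
The class of `e` is replaced by the classes of the pre-edges that hang on the ends of `e`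
(`IsContraction.card_quot_bubbleRel`), and the question is how many these are.

* For a trivial loop they correspond to the outer strands of `e` with colours in `C`, directly by
  the definition of triviality (`IsContraction.card_hangs_of_isTrivialLoop`).
* If `e` is not a loop there is only one (`IsContraction.card_hangs_of_not_isLoop`). For general
  stranded graphs this is false; it holds for weakly-coloured graphs since the bipartition of the
  original tensor graph gives signs to the pre-edges (`Orientation`), which survive contractions
  and make opposite charges of the two ends of each chord. Let a pre-edge `h` of colour `i` be taken
  away from its vertex, and let `K` be a component of the rest. Let `N c` be the signed number of
  pre-edges of colour `c` in `K`. A chord from `(h, j)` to `K` shows up as `N i - N j ≠ 0`, its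
  absence as `N i - N j = 0`, and `N j = N k` for all `j, k ≠ i`. Hence either all or none of the
  chords of `h` lead to `K` (`exists_strand_of_balanced`).

The same charge argument, with open faces in place of chords, shows that the boundary component of
a half-edge stays connected when this half-edge is removed. This gives the effect of cutting a
bridge on the boundary graph (`IsBridge.card_boundaryHangs`). It also shows that each open face has
two ends on different half-edges, so that no face becomes closed when the two halves of a bridge are
joined.
-/

/-! ### Counting the classes of a generated equivalence relation -/

/-- The quotients of two relations have the same size if there are maps between the underlying types
that are mutually inverse on classes. -/
theorem card_quot_eq {α β : Type*} {r : α → α → Prop} {s : β → β → Prop} (f : α → β) (g : β → α)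
    (hf : ∀ a b, r a b → Quot.mk s (f a) = Quot.mk s (f b))
    (hg : ∀ a b, s a b → Quot.mk r (g a) = Quot.mk r (g b))
    (hgf : ∀ a, Quot.mk r (g (f a)) = Quot.mk r a)
    (hfg : ∀ b, Quot.mk s (f (g b)) = Quot.mk s b) :
    Nat.card (Quot r) = Nat.card (Quot s) := by
  refine Nat.card_congr ⟨Quot.lift (fun a => Quot.mk s (f a)) hf,
    Quot.lift (fun b => Quot.mk r (g b)) hg, ?_, ?_⟩
  · rintro ⟨a⟩; exact hgf a
  · rintro ⟨b⟩; exact hfg b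

/-- If a function is constant along `r`, it is constant on the classes of `r`. -/
theorem eq_of_quot_eq {α γ : Type*} {r : α → α → Prop} (f : α → γ) (h : ∀ a b, r a b → f a = f b)
    {a b : α} (hab : Quot.mk r a = Quot.mk r b) : f a = f b :=
  congrArg (Quot.lift f h) hab

/-- If a property is kept along `r`, it is shared by the elements of a class of `r`. -/
theorem iff_of_quot_eq {α : Type*} {r : α → α → Prop} (P : α → Prop)
    (h : ∀ a b, r a b → (P a ↔ P b)) {a b : α} (hab : Quot.mk r a = Quot.mk r b) : P a ↔ P b :=
  iff_of_eq (eq_of_quot_eq P (fun a b hr => propext (h a b hr)) hab)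

theorem quot_eq_iff_eqvGen {α : Type*} {r : α → α → Prop} {a b : α} :
    Quot.mk r a = Quot.mk r b ↔ Relation.EqvGen r a b :=
  ⟨Quot.eqvGen_exact, Quot.eqvGen_sound⟩

section Link

variable {α J : Type*} {r r' : α → α → Prop} {a b : J → α}

/-- `r'` is generated by `r` and by links from `a j` to `b j`, and no two links meet the same class:
two elements with the same class for `r'` have the same class for `r`, or they are both in the
classes of the ends of one link. -/
theorem quot_eq_of_link (hb : ∀ j k, Quot.mk r (b j) = Quot.mk r (b k) → j = k)
    (hab : ∀ j k, Quot.mk r (a j) ≠ Quot.mk r (b k))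
    (ha : ∀ j k, Quot.mk r (a j) = Quot.mk r (a k) → j = k)
    (h' : ∀ x y, r' x y → Quot.mk r x = Quot.mk r y ∨
      ∃ j, (Quot.mk r x = Quot.mk r (a j) ∧ Quot.mk r y = Quot.mk r (b j)) ∨
        (Quot.mk r x = Quot.mk r (b j) ∧ Quot.mk r y = Quot.mk r (a j)))
    {x y : α} (hxy : Quot.mk r' x = Quot.mk r' y) :
    Quot.mk r x = Quot.mk r y ∨
      ∃ j, (Quot.mk r x = Quot.mk r (a j) ∨ Quot.mk r x = Quot.mk r (b j)) ∧
        (Quot.mk r y = Quot.mk r (a j) ∨ Quot.mk r y = Quot.mk r (b j)) := by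
  rw [quot_eq_iff_eqvGen] at hxy
  induction hxy with
  | rel x y h =>
    rcases h' x y h with h | ⟨j, h | h⟩
    · exact Or.inl h
    · exact Or.inr ⟨j, Or.inl h.1, Or.inr h.2⟩
    · exact Or.inr ⟨j, Or.inr h.1, Or.inl h.2⟩
  | refl x => exact Or.inl rfl
  | symm x y _ ih =>
    rcases ih with h | ⟨j, h1, h2⟩
    · exact Or.inl h.symm
    · exact Or.inr ⟨j, h2, h1⟩
  | trans x y z _ _ ih1 ih2 =>
    rcases ih1 with h | ⟨j, h1, h2⟩
    · rw [h]; exact ih2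
    · rcases ih2 with h | ⟨k, h3, h4⟩
      · rw [← h]; exact Or.inr ⟨j, h1, h2⟩
      · have hjk : j = k := by
          rcases h2 with h2 | h2 <;> rcases h3 with h3 | h3
          · exact ha j k (h2.symm.trans h3)
          · exact absurd (h2.symm.trans h3) (hab j k)
          · exact absurd (h3.symm.trans h2) (hab k j)
          · exact hb j k (h2.symm.trans h3)
        subst hjk
        exact Or.inr ⟨j, h1, h4⟩

/-- Linking the classes of `a j` and `b j` for all `j` lowers the number of classes by the number
of links, as long as the classes of the `b j` are pairwise distinct and contain no `a k`. -/
theorem card_quot_link [Finite α] (hb : ∀ j k, Quot.mk r (b j) = Quot.mk r (b k) → j = k)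
    (hab : ∀ j k, Quot.mk r (a j) ≠ Quot.mk r (b k))
    (h : ∀ x y, r x y → Quot.mk r' x = Quot.mk r' y)
    (hl : ∀ j, Quot.mk r' (a j) = Quot.mk r' (b j))
    (h' : ∀ x y, r' x y → Quot.mk r x = Quot.mk r y ∨
      ∃ j, (Quot.mk r x = Quot.mk r (a j) ∧ Quot.mk r y = Quot.mk r (b j)) ∨
        (Quot.mk r x = Quot.mk r (b j) ∧ Quot.mk r y = Quot.mk r (a j))) :
    Nat.card (Quot r) = Nat.card (Quot r') + Nat.card J := by
  classical
  let B : Quot r → Prop := fun q => ∃ j, q = Quot.mk r (b j)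
  have hBJ : Nat.card {q // B q} = Nat.card J := by
    refine (Nat.card_congr (Equiv.ofBijective
      (fun j => (⟨Quot.mk r (b j), j, rfl⟩ : {q // B q})) ⟨?_, ?_⟩)).symm
    · intro j k hjk; exact hb j k (congrArg Subtype.val hjk)
    · rintro ⟨q, j, rfl⟩; exact ⟨j, rfl⟩
  -- The classes for `r'` are represented by those for `r` that contain no `b j`: move `b j` to `a j`.
  let ret : Quot r → {q // ¬ B q} := fun q =>
    if hq : B q then ⟨Quot.mk r (a hq.choose), fun ⟨k, hk⟩ => hab _ k hk⟩ else ⟨q, hq⟩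
  have ret_b : ∀ j, (ret (Quot.mk r (b j))).1 = Quot.mk r (a j) := by
    intro j
    have hq : B (Quot.mk r (b j)) := ⟨j, rfl⟩
    have h1 : ret (Quot.mk r (b j)) = ⟨Quot.mk r (a hq.choose), fun ⟨k, hk⟩ => hab _ k hk⟩ :=
      dif_pos hq
    rw [h1]
    exact congrArg (fun k => Quot.mk r (a k)) (hb j _ hq.choose_spec).symm
  have ret_n : ∀ q, ¬ B q → (ret q).1 = q := fun q hq => by
    have h1 : ret q = ⟨q, hq⟩ := dif_neg hq
    rw [h1]
  have ret_a : ∀ j, (ret (Quot.mk r (a j))).1 = Quot.mk r (a j) :=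
    fun j => ret_n _ (fun ⟨k, hk⟩ => hab j k hk)
  let m : Quot r → Quot r' := Quot.lift (fun x => Quot.mk r' x) h
  have hA : Nat.card (Quot r') = Nat.card {q // ¬ B q} := by
    refine Nat.card_congr ⟨Quot.lift (fun x => ret (Quot.mk r x)) ?_, fun q => m q.1, ?_, ?_⟩
    · intro x y hxy
      apply Subtype.ext
      rcases h' x y hxy with h1 | ⟨j, h1 | h1⟩
      · rw [h1]
      · rw [h1.1, h1.2, ret_a, ret_b]
      · rw [h1.1, h1.2, ret_a, ret_b]
    · rintro ⟨x⟩
      change m (ret (Quot.mk r x)).1 = Quot.mk r' x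
      by_cases hx : B (Quot.mk r x)
      · obtain ⟨j, hj⟩ := hx
        rw [hj, ret_b]
        calc Quot.mk r' (a j) = Quot.mk r' (b j) := hl j
          _ = m (Quot.mk r (b j)) := rfl
          _ = m (Quot.mk r x) := by rw [hj]
      · rw [ret_n _ hx]
    · rintro ⟨⟨x⟩, hx⟩
      exact Subtype.ext (ret_n _ hx)
  rw [hA, ← hBJ, ← Nat.card_congr (Equiv.sumCompl B), Nat.card_sum, add_comm]

end Link

/-- Removing a set of equivalent elements (those with `E`). The remaining ones form `β`,
with a relation `s` that agrees with `r` away from the removed elements; `N` holds at the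
neighbours of the removed elements. The class of the removed elements is replaced by the classes of
their neighbours, and the other classes do not change. -/
theorem card_quot_remove {α β : Type*} [Finite α] {r : α → α → Prop} {s : β → β → Prop}
    (ι : β → α) (E : α → Prop) (N : β → Prop) (e : α)
    (hinj : Function.Injective ι) (hrange : ∀ x, E x ∨ ∃ b, ι b = x) (hE : ∀ b, ¬ E (ι b))
    (hsr : ∀ b c, s b c → Quot.mk r (ι b) = Quot.mk r (ι c))
    (hrs : ∀ b c, r (ι b) (ι c) → Quot.mk s b = Quot.mk s c)
    (hN : ∀ x c, E x → r x (ι c) ∨ r (ι c) x → N c)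
    (hNe : ∀ c, N c → Quot.mk r (ι c) = Quot.mk r e)
    (hEe : ∀ x, E x → Quot.mk r x = Quot.mk r e) (he : E e) :
    Nat.card (Quot r) + Nat.card {q : Quot s // ∃ c, N c ∧ Quot.mk s c = q} =
      Nat.card (Quot s) + 1 := by
  classical
  have hβ : Finite β := Finite.of_injective ι hinj
  let M : Quot s → Prop := fun q => ∃ c, N c ∧ Quot.mk s c = q
  let P : α → Prop := fun x => ∃ b, ι b = x ∧ ¬ M (Quot.mk s b)
  -- All removed elements and all that hangs on them go to `none`, the other classes are kept.
  let f : α → Option {q // ¬ M q} := fun x =>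
    if h : P x then some ⟨Quot.mk s h.choose, h.choose_spec.2⟩ else none
  have f_some : ∀ b (hb : ¬ M (Quot.mk s b)), f (ι b) = some ⟨Quot.mk s b, hb⟩ := by
    intro b hb
    have h : P (ι b) := ⟨b, rfl, hb⟩
    have h1 : f (ι b) = some ⟨Quot.mk s h.choose, h.choose_spec.2⟩ := dif_pos h
    rw [h1]
    congr 2
    rw [hinj h.choose_spec.1]
  have f_none : ∀ b, M (Quot.mk s b) → f (ι b) = none := by
    intro b hb
    refine dif_neg ?_
    rintro ⟨c, hc, hc'⟩
    rw [hinj hc] at hc'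
    exact hc' hb
  have f_E : ∀ x, E x → f x = none := by
    intro x hx
    refine dif_neg ?_
    rintro ⟨c, rfl, -⟩
    exact hE c hx
  have f_eq : ∀ b c, Quot.mk s b = Quot.mk s c → f (ι b) = f (ι c) := by
    intro b c hbc
    by_cases hb : M (Quot.mk s b)
    · rw [f_none b hb, f_none c (hbc ▸ hb)]
    · rw [f_some b hb, f_some c (hbc ▸ hb)]
      congr 2
  have f_step : ∀ x y, r x y → f x = f y := by
    intro x y hxy
    rcases hrange x with hx | ⟨b, rfl⟩ <;> rcases hrange y with hy | ⟨c, rfl⟩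
    · rw [f_E x hx, f_E y hy]
    · rw [f_E x hx, f_none c ⟨c, hN x c hx (Or.inl hxy), rfl⟩]
    · rw [f_E y hy, f_none b ⟨b, hN y b hy (Or.inr hxy), rfl⟩]
    · exact f_eq b c (hrs b c hxy)
  let m : Quot s → Quot r := Quot.lift (fun b => Quot.mk r (ι b)) hsr
  have key : Nat.card (Quot r) = Nat.card (Option {q // ¬ M q}) := by
    refine Nat.card_congr ⟨Quot.lift f f_step,
      fun o => o.elim (Quot.mk r e) (fun q => m q.1), ?_, ?_⟩
    · rintro ⟨x⟩
      change (f x).elim (Quot.mk r e) (fun q => m q.1) = Quot.mk r x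
      rcases hrange x with hx | ⟨b, rfl⟩
      · rw [f_E x hx]; exact (hEe x hx).symm
      · by_cases hb : M (Quot.mk s b)
        · rw [f_none b hb]
          obtain ⟨c, hc, hcb⟩ := hb
          calc Quot.mk r e = m (Quot.mk s c) := (hNe c hc).symm
            _ = m (Quot.mk s b) := by rw [hcb]
        · rw [f_some b hb]; rfl
    · rintro (_ | ⟨⟨b⟩, hb⟩)
      · exact f_E e he
      · exact f_some b hb
  rw [key, Finite.card_option, ← Nat.card_congr (Equiv.sumCompl M), Nat.card_sum]
  ring

/-! ### Signed counting of frontier points -/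

section Charge

variable {H : Type}

/-- The charge, for the pair of colours `{c, d}`, of a point `(h, j)`: the sign of `h` if `h` has
colour `c` and `j = d`, the opposite of this sign if `h` has colour `d` and `j = c`, and `0` if the
strand through the point has another pair of colours. -/
def pointCharge (color : H → Fin 5) (sign : H → ℤ) (c d : Fin 5) (x : H × Fin 5) : ℤ :=
  sign x.1 * ((if color x.1 = c ∧ x.2 = d then 1 else 0) -
    (if color x.1 = d ∧ x.2 = c then 1 else 0))

theorem pointCharge_ne_zero {color : H → Fin 5} {sign : H → ℤ} {c d : Fin 5} {x : H × Fin 5}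
    (h : pointCharge color sign c d x ≠ 0) :
    (color x.1 = c ∧ x.2 = d) ∨ (color x.1 = d ∧ x.2 = c) := by
  by_contra hx
  rw [not_or] at hx
  exact h (by simp [pointCharge, hx.1, hx.2])

theorem sum_frontierPoint [Fintype H] {color : H → Fin 5} [Fintype (FrontierPoint color)]
    (g : H × Fin 5 → ℤ) (hg : ∀ x, x.2 = color x.1 → g x = 0) :
    ∑ p : FrontierPoint color, g p.1 = ∑ h, ∑ j, g (h, j) := by
  classical
  rw [← Fintype.sum_prod_type (f := g), ← Finset.sum_filter_of_ne
    (p := fun x : H × Fin 5 => x.2 ≠ color x.1) (fun x _ hx h => hx (hg x h))]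
  exact (Finset.sum_subtype _ (fun x => by simp) g).symm

theorem sum_pointCharge_fst [Fintype H] {color : H → Fin 5} [Fintype (FrontierPoint color)]
    (sign : H → ℤ) (K : Set H) [DecidablePred (· ∈ K)] {c d : Fin 5} (hcd : c ≠ d) :
    ∑ p : FrontierPoint color, (if p.1.1 ∈ K then pointCharge color sign c d p.1 else 0) =
      (∑ h, if h ∈ K ∧ color h = c then sign h else 0) -
        ∑ h, if h ∈ K ∧ color h = d then sign h else 0 := by
  classical
  rw [sum_frontierPoint (fun x => if x.1 ∈ K then pointCharge color sign c d x else 0),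
    ← Finset.sum_sub_distrib]
  · refine Finset.sum_congr rfl fun h _ => ?_
    by_cases hK : h ∈ K
    · simp only [hK, if_true, true_and, pointCharge, ← Finset.mul_sum, Finset.sum_sub_distrib,
        ite_and]
      by_cases h1 : color h = c <;> by_cases h2 : color h = d <;>
        simp [h1, h2, hcd, hcd.symm]
    · simp [hK]
  · intro x hx
    by_contra h0
    have h1 : pointCharge color sign c d x ≠ 0 := fun h => h0 (by simp [h])
    rcases pointCharge_ne_zero h1 with h | h
    · exact hcd (h.1.symm.trans (hx.symm.trans h.2))
    · exact hcd (h.2.symm.trans (hx.trans h.1))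

/-- The points are labelled by strands, and along every strand the charges add up to zero. A set `K`
that is closed under following strands with colours in `C`, except into `h₀`, is then met by all
of the strands from `h₀` with colours in `C`, or by none: the signed number of elements of a given
colour in `K` is the same for all colours `c ≠ color h₀` in `C`, and its difference with the one
for `color h₀` is the contribution of the strand from `(h₀, c)`. -/
theorem exists_strand_of_balanced {T : Type*} [Finite H] {color : H → Fin 5} {sign : H → ℤ}
    [Fintype (FrontierPoint color)] (t : FrontierPoint color → T)
    (hbal : ∀ c d (Φ : Set T) [DecidablePred fun p => t p ∈ Φ],
      ∑ p with t p ∈ Φ, pointCharge color sign c d p.1 = 0)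
    (C : Finset (Fin 5)) {h₀ : H} (hC : color h₀ ∈ C) (hs : sign h₀ ≠ 0) {K : Set H} (hK₀ : h₀ ∉ K)
    (hK : ∀ p q : FrontierPoint color, t p = t q → p.1.1 ∈ K → color p.1.1 ∈ C → p.1.2 ∈ C →
      color q.1.1 ∈ C → q.1.2 ∈ C → q.1.1 ≠ h₀ → q.1.1 ∈ K)
    {j k : Fin 5} (hj : j ∈ C) (hk : k ∈ C) (hj₀ : j ≠ color h₀) (hk₀ : k ≠ color h₀)
    (hp : ∃ p : FrontierPoint color, p.1.1 ∈ K ∧ color p.1.1 ∈ C ∧ p.1.2 ∈ C ∧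
      t p = t ⟨(h₀, j), hj₀⟩) :
    ∃ p : FrontierPoint color, p.1.1 ∈ K ∧ color p.1.1 ∈ C ∧ p.1.2 ∈ C ∧
      t p = t ⟨(h₀, k), hk₀⟩ := by
  classical
  have := Fintype.ofFinite H
  let Φ : Set T := {φ | ∃ p, p.1.1 ∈ K ∧ color p.1.1 ∈ C ∧ p.1.2 ∈ C ∧ t p = φ}
  -- `N c` counts the elements of `K` of colour `c`, `D c d` is the contribution of the points of `h₀`.
  let N : Fin 5 → ℤ := fun c => ∑ h, if h ∈ K ∧ color h = c then sign h else 0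
  let D : Fin 5 → Fin 5 → ℤ := fun c d => ∑ p : FrontierPoint color,
    if p.1.1 = h₀ ∧ t p ∈ Φ then pointCharge color sign c d p.1 else 0
  have split : ∀ c d, c ∈ C → d ∈ C → c ≠ d → N c - N d + D c d = 0 := by
    intro c d hc hd hcd
    rw [← sum_pointCharge_fst (color := color) sign K hcd, ← Finset.sum_add_distrib]
    refine Eq.trans ?_ (hbal c d Φ)
    rw [Finset.sum_filter]
    refine Finset.sum_congr rfl fun p _ => ?_
    by_cases h0 : pointCharge color sign c d p.1 = 0
    · simp [h0]
    have hpC : color p.1.1 ∈ C ∧ p.1.2 ∈ C := by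
      rcases pointCharge_ne_zero h0 with h | h
      · rw [h.1, h.2]; exact ⟨hc, hd⟩
      · rw [h.1, h.2]; exact ⟨hd, hc⟩
    by_cases hpK : p.1.1 ∈ K
    · have h1 : t p ∈ Φ := ⟨p, hpK, hpC.1, hpC.2, rfl⟩
      have h2 : p.1.1 ≠ h₀ := fun h => hK₀ (h ▸ hpK)
      simp [hpK, h1, h2]
    · by_cases hph : p.1.1 = h₀
      · simp [hph, hK₀]
      · have h1 : t p ∉ Φ := by
          rintro ⟨q, hq, hqC, hqC', hqt⟩
          exact hpK (hK q p hqt hq hqC hqC' hpC.1 hpC.2 hph)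
        simp [hpK, hph, h1]
  have single : ∀ c (hc : c ≠ color h₀), D (color h₀) c =
      if t ⟨(h₀, c), hc⟩ ∈ Φ then sign h₀ else 0 := by
    intro c hc
    refine (Finset.sum_eq_single (⟨(h₀, c), hc⟩ : FrontierPoint color) ?_ (by simp)).trans ?_
    · intro p _ hp
      by_contra h0
      rw [ite_eq_right_iff, Classical.not_imp] at h0
      obtain ⟨⟨h1, -⟩, h2⟩ := h0
      rcases pointCharge_ne_zero h2 with h | h
      · exact hp (Subtype.ext (Prod.ext h1 h.2))
      · exact p.2 (by rw [h.2, h1])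
    · simp [pointCharge, hc, hc.symm]
  -- The equations for the pairs `{color h₀, j}`, `{color h₀, k}`, `{j, k}` then force the strands
  -- from `(h₀, j)` and `(h₀, k)` to meet `K` both or not at all.
  by_cases hjk : j = k
  · subst hjk; exact hp
  have zero : D j k = 0 := by
    refine Finset.sum_eq_zero fun p _ => ?_
    by_contra h0
    rw [ite_eq_right_iff, Classical.not_imp] at h0
    obtain ⟨⟨h1, -⟩, h2⟩ := h0
    rcases pointCharge_ne_zero h2 with h | h
    · exact hj₀ (by rw [← h.1, h1])
    · exact hk₀ (by rw [← h.1, h1])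
  have e1 := split _ j hC hj hj₀.symm
  have e2 := split _ k hC hk hk₀.symm
  have e3 := split j k hj hk hjk
  rw [single j hj₀, if_pos (show t ⟨(h₀, j), hj₀⟩ ∈ Φ from hp)] at e1
  rw [zero] at e3
  by_contra hn
  rw [single k hk₀, if_neg (show t ⟨(h₀, k), hk₀⟩ ∉ Φ from hn)] at e2
  exact hs (by linarith)

end Charge

namespace StrandedGraph

/-! ### Orientations -/

variable {G : StrandedGraph}

/-- A sign for every pre-edge that is reversed by edges, that is reversed by chords between
pre-edges of the same colour and that is kept by chords between pre-edges of different colours.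
For a coloured tensor graph it is given by the bipartition. -/
structure Orientation (G : StrandedGraph) where
  sign : G.Flag → ℤ
  sign_ne : ∀ h, sign h ≠ 0
  sign_chord : ∀ p : G.Point, sign (G.chord p).1.1 =
    if G.color (G.chord p).1.1 = G.color p.1.1 then -sign p.1.1 else sign p.1.1
  sign_opp : ∀ h, G.opp h ≠ h → sign (G.opp h) = -sign h

/-- The other end of a chord has the same colours, in the same or in the other order. -/
theorem chord_colors (p : G.Point) :
    (G.color (G.chord p).1.1 = G.color p.1.1 ∧ (G.chord p).1.2 = p.1.2) ∨
      (G.color (G.chord p).1.1 = p.1.2 ∧ (G.chord p).1.2 = G.color p.1.1) := by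
  have h := G.chord_pair p
  rw [pairOfColors, pairOfColors, Sym2.eq_iff] at h
  exact h

/-- Orientations survive a contraction: a strand of the contracted edge reverses the sign, and so
does the composition of the two chords at its ends. -/
noncomputable def Orientation.contract (o : G.Orientation) (e : G.Edge) :
    (G.contract e).Orientation where
  sign h := o.sign h.1
  sign_ne h := o.sign_ne h.1
  sign_opp h hh := o.sign_opp h.1 (fun h' => hh (Subtype.ext h'))
  sign_chord := by
    intro p
    suffices H : ∀ p : G.Point, o.sign (G.throughChord e p).1.1 =
        if G.color (G.throughChord e p).1.1 = G.color p.1.1 then -o.sign p.1.1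
          else o.sign p.1.1 from
      H ⟨(p.1.1.1, p.1.2), p.2⟩
    intro p
    by_cases hq : G.IsEnd e (G.chord p).1.1
    · have ht : G.throughChord e p = G.chord (G.strand (G.chord p)) := if_pos hq
      rw [ht]
      have hne : G.opp (G.chord p).1.1 ≠ (G.chord p).1.1 := by
        rcases hq with h | h <;> rw [h]
        · exact e.2
        · rw [G.opp_opp]; exact e.2.symm
      have h1 := o.sign_chord p
      have h2 := o.sign_opp _ hne
      have h3 := o.sign_chord (G.strand (G.chord p))
      have c1 := chord_colors p
      have c3 := chord_colors (G.strand (G.chord p))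
      have hp := p.2
      have hcol : G.color (G.strand (G.chord p)).1.1 = G.color (G.chord p).1.1 := G.opp_color _
      have hsnd : (G.strand (G.chord p)).1.2 = (G.chord p).1.2 := rfl
      have hsg : o.sign (G.strand (G.chord p)).1.1 = -o.sign (G.chord p).1.1 := h2
      rw [hsg, h1] at h3
      rw [hcol, hsnd] at c3
      rw [hcol] at h3
      rw [h3]
      rcases c1 with ⟨a, b⟩ | ⟨a, b⟩ <;> rcases c3 with ⟨c, d⟩ | ⟨c, d⟩ <;>
        simp [a, b, c, hp, hp.symm]
    · have ht : G.throughChord e p = G.chord p := if_neg hq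
      rw [ht]
      exact o.sign_chord p

open Classical in
theorem cSubgraph_opp (S : Finset (Sym2 G.Flag)) (h : G.Flag) :
    (G.cSubgraph S).opp h = if s(h, G.opp h) ∈ S then G.opp h else h := rfl

/-- Orientations survive the cutting of edges. -/
noncomputable def Orientation.cSubgraph (o : G.Orientation) (S : Finset (Sym2 G.Flag)) :
    (G.cSubgraph S).Orientation where
  sign := o.sign
  sign_ne := o.sign_ne
  sign_chord := o.sign_chord
  sign_opp h hh := by
    by_cases hS : s(h, G.opp h) ∈ S
    · have h1 : (G.cSubgraph S).opp h = G.opp h := (cSubgraph_opp S h).trans (if_pos hS)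
      exact (congrArg o.sign h1).trans (o.sign_opp h fun h' => hh (h1.trans h'))
    · exact absurd ((cSubgraph_opp S h).trans (if_neg hS)) hh

theorem Orientation.of_contractsTo {G' : StrandedGraph} (o : G.Orientation)
    (h : ContractsTo G G') : Nonempty G'.Orientation := by
  induction h with
  | refl => exact ⟨o⟩
  | step e _ ih => exact ih.elim fun o' => ⟨o'.contract e⟩

theorem Orientation.of_equivUpToDiscs {G' : StrandedGraph} (o : G.Orientation)
    (h : EquivUpToDiscs G' G) : Nonempty G'.Orientation := by
  obtain ⟨φ, hc, ho, hch⟩ := h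
  refine ⟨⟨fun h => o.sign (φ h), fun h => o.sign_ne _, fun p => ?_, fun h hh => ?_⟩⟩
  · let p' : G.Point := ⟨(φ p.1.1, p.1.2), by simpa [hc] using p.2⟩
    have h1 := o.sign_chord p'
    have h2 : (G.chord p').1.1 = φ (G'.chord p).1.1 := congrArg Prod.fst (hch p p' rfl)
    have h3 : p'.1.1 = φ p.1.1 := rfl
    rw [h2, h3, hc, hc] at h1
    exact h1
  · rw [← ho]
    exact o.sign_opp _ (by rw [ho]; exact fun h' => hh (φ.injective h'))

/-- The orientation of a coloured tensor graph given by its bipartition. -/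
def _root_.ColoredTensorGraph.orientation (C : ColoredTensorGraph) :
    C.toStranded.Orientation where
  sign h := if C.sign h.1 then 1 else -1
  sign_ne h := by split_ifs <;> decide
  sign_chord p := (if_neg p.2).symm
  sign_opp h hh := by
    have h1 := C.bipartite h.2 h.1 (fun h' => hh (Prod.ext h' rfl))
    change (if C.sign (C.nbr h.2 h.1) then (1 : ℤ) else -1) = -(if C.sign h.1 then 1 else -1)
    cases h2 : C.sign (C.nbr h.2 h.1) <;> cases h3 : C.sign h.1 <;> simp_all

theorem _root_.WColoredGraph.IsRepresentative.nonempty_orientation {𝔊 : WColoredGraph}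
    (hG : 𝔊.IsRepresentative G) : Nonempty G.Orientation := by
  obtain ⟨C, G', hc, h⟩ := 𝔊.2
  obtain ⟨o⟩ := C.orientation.of_contractsTo hc
  exact o.of_equivUpToDiscs (Quotient.exact (hG.symm.trans h))

theorem Orientation.charge_chord (o : G.Orientation) (c d : Fin 5) (p : G.Point) :
    pointCharge G.color o.sign c d (G.chord p).1 = -pointCharge G.color o.sign c d p.1 := by
  have h := o.sign_chord p
  have hp := p.2
  unfold pointCharge
  rcases chord_colors p with ⟨a, b⟩ | ⟨a, b⟩
  · rw [if_pos a] at h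
    rw [a, b, h]; ring
  · rw [if_neg (a ▸ hp)] at h
    rw [a, b, h]
    simp only [and_comm (a := p.1.2 = _)]
    ring

theorem Orientation.charge_strand (o : G.Orientation) (c d : Fin 5) (p : G.Point)
    (hp : G.opp p.1.1 ≠ p.1.1) :
    pointCharge G.color o.sign c d (G.strand p).1 = -pointCharge G.color o.sign c d p.1 := by
  have h1 : (G.strand p).1 = (G.opp p.1.1, p.1.2) := rfl
  simp only [pointCharge, h1, G.opp_color, o.sign_opp _ hp]
  ring

/-- The two ends of a chord have opposite charges. -/
theorem Orientation.sum_charge_of_chord (o : G.Orientation) [Fintype G.Point] (c d : Fin 5)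
    (P : G.Point → Prop) [DecidablePred P] (hP : ∀ p, P p → P (G.chord p)) :
    ∑ p with P p, pointCharge G.color o.sign c d p.1 = 0 := by
  refine Finset.sum_involution (fun p _ => G.chord p) ?_ ?_ ?_ ?_
  · intro p _; rw [o.charge_chord]; ring
  · intro p _ _; exact G.chord_ne p
  · intro p hp
    rw [Finset.mem_filter] at hp ⊢
    exact ⟨Finset.mem_univ _, hP p hp.2⟩
  · intro p _; exact G.chord_chord p

/-- The two ends of a strand of an edge have opposite charges. -/
theorem Orientation.sum_charge_of_strand (o : G.Orientation) [Fintype G.Point] (c d : Fin 5)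
    (P : G.Point → Prop) [DecidablePred P] (hP : ∀ p, P p → P (G.strand p))
    (hE : ∀ p, P p → G.opp p.1.1 ≠ p.1.1) :
    ∑ p with P p, pointCharge G.color o.sign c d p.1 = 0 := by
  refine Finset.sum_involution (fun p _ => G.strand p) ?_ ?_ ?_ ?_
  · intro p hp
    rw [Finset.mem_filter] at hp
    rw [o.charge_strand c d p (hE p hp.2)]; ring
  · intro p hp _ h
    rw [Finset.mem_filter] at hp
    exact hE p hp.2 (congrArg (fun r => r.1.1) h)
  · intro p hp
    rw [Finset.mem_filter] at hp ⊢
    exact ⟨Finset.mem_univ _, hP p hp.2⟩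
  · intro p _; exact strand_strand p

theorem face_chord (p : G.Point) : Quot.mk G.FaceStep (G.chord p) = Quot.mk G.FaceStep p :=
  (Quot.sound (r := G.FaceStep) (Or.inl rfl)).symm

theorem face_strand (p : G.Point) : Quot.mk G.FaceStep (G.strand p) = Quot.mk G.FaceStep p :=
  (Quot.sound (r := G.FaceStep) (Or.inr rfl)).symm

/-- The points on half-edges, seen as points of the graph. -/
def halfPoint (p : FrontierPoint fun a : G.HalfEdge => G.color a.1) : G.Point :=
  ⟨(p.1.1.1, p.1.2), p.2⟩

/-- The charges at the ends of an open face add up to zero: all points of the face cancel along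
chords, and those on edges cancel along strands. -/
theorem Orientation.sum_charge_halfPoint (o : G.Orientation)
    [Fintype (FrontierPoint fun a : G.HalfEdge => G.color a.1)] (c d : Fin 5) (Φ : Set G.Face)
    [DecidablePred fun p : FrontierPoint (fun a : G.HalfEdge => G.color a.1) =>
      Quot.mk G.FaceStep (halfPoint p) ∈ Φ] :
    ∑ p with Quot.mk G.FaceStep (halfPoint p) ∈ Φ,
      pointCharge (fun a : G.HalfEdge => G.color a.1) (fun a => o.sign a.1) c d p.1 = 0 := by
  classical
  have := Fintype.ofFinite G.Point
  have h1 := o.sum_charge_of_chord c d (fun p => Quot.mk G.FaceStep p ∈ Φ)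
    (fun p hp => by rw [face_chord]; exact hp)
  have h2 := o.sum_charge_of_strand c d
    (fun p => Quot.mk G.FaceStep p ∈ Φ ∧ G.opp p.1.1 ≠ p.1.1)
    (fun p hp => by
      rw [face_strand]
      refine ⟨hp.1, ?_⟩
      change G.opp (G.opp p.1.1) ≠ G.opp p.1.1
      rw [G.opp_opp]; exact hp.2.symm)
    (fun p hp => hp.2)
  rw [← Finset.sum_filter_add_sum_filter_not _ (fun p : G.Point => G.opp p.1.1 ≠ p.1.1),
    Finset.filter_filter, Finset.filter_filter, h2, zero_add] at h1
  rw [← h1]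
  refine Finset.sum_bij (fun p _ => halfPoint p) ?_ ?_ ?_ ?_
  · intro p hp
    rw [Finset.mem_filter] at hp ⊢
    exact ⟨Finset.mem_univ _, hp.2, fun h => h p.1.1.2⟩
  · intro p _ q _ h
    refine Subtype.ext (Prod.ext (Subtype.ext ?_) ?_)
    · exact congrArg (fun r : G.Point => r.1.1) h
    · exact congrArg (fun r : G.Point => r.1.2) h
  · intro p hp
    rw [Finset.mem_filter, not_not] at hp
    exact ⟨⟨(⟨p.1.1, hp.2.2⟩, p.1.2), p.2⟩, Finset.mem_filter.2 ⟨Finset.mem_univ _, hp.2.1⟩, rfl⟩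
  · intro p _; rfl

end StrandedGraph

namespace StrandedGraph

variable {G A B : StrandedGraph}

/-! ### Components of bubbles -/

/-- Adjacency of pre-edges with colours in `C` through the chords with both colours in `C` and
through `ρ`. Taking for `ρ` the edges one gets bubbles, and components if `C` contains all colours;
without edges one gets vertices. -/
def BubbleRel (G : StrandedGraph) (ρ : G.Flag → G.Flag → Prop) (C : Finset (Fin 5))
    (h h' : {h : G.Flag // G.color h ∈ C}) : Prop :=
  (∃ p : G.Point, p.1.2 ∈ C ∧ p.1.1 = h.1 ∧ (G.chord p).1.1 = h'.1) ∨ ρ h.1 h'.1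

theorem card_quot_chordAdj (G : StrandedGraph) : Nat.card (Quot G.ChordAdj) =
    Nat.card (Quot (G.BubbleRel (fun _ _ => False) Finset.univ)) := by
  refine card_quot_eq (fun h => ⟨h, Finset.mem_univ _⟩) Subtype.val ?_ ?_ (fun _ => rfl)
    (fun _ => rfl)
  · rintro a b ⟨p, hp, hp'⟩
    exact Quot.sound (Or.inl ⟨p, Finset.mem_univ _, hp, hp'⟩)
  · rintro a b (⟨p, -, hp, hp'⟩ | h)
    · exact Quot.sound ⟨p, hp, hp'⟩
    · exact h.elim

/-- Two pre-edges joined by an edge, or equal and carrying a half-edge. -/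
def EdgeRel (G : StrandedGraph) (h h' : G.Flag) : Prop := G.opp h = h'

theorem card_quot_adj (G : StrandedGraph) : Nat.card (Quot G.Adj) =
    Nat.card (Quot (G.BubbleRel G.EdgeRel Finset.univ)) := by
  refine card_quot_eq (fun h => ⟨h, Finset.mem_univ _⟩) Subtype.val ?_ ?_ (fun _ => rfl)
    (fun _ => rfl)
  · rintro a b (⟨p, hp, hp'⟩ | h)
    · exact Quot.sound (Or.inl ⟨p, Finset.mem_univ _, hp, hp'⟩)
    · exact Quot.sound (Or.inr h)
  · rintro a b (⟨p, -, hp, hp'⟩ | h)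
    · exact Quot.sound (Or.inl ⟨p, hp, hp'⟩)
    · exact Quot.sound (Or.inr h)

/-- The chord from a point with both colours in `C` ends at such a point. -/
theorem chord_mem {C : Finset (Fin 5)} {p : G.Point} (h1 : G.color p.1.1 ∈ C) (h2 : p.1.2 ∈ C) :
    G.color (G.chord p).1.1 ∈ C ∧ (G.chord p).1.2 ∈ C := by
  rcases chord_colors p with ⟨a, b⟩ | ⟨a, b⟩ <;> rw [a, b]
  · exact ⟨h1, h2⟩
  · exact ⟨h2, h1⟩

/-! ### Ends of an edge and its inner strands -/

theorem isEnd_fst (e : G.Edge) : G.IsEnd e e.1 := Or.inl rfl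

theorem isEnd_snd (e : G.Edge) : G.IsEnd e (G.opp e.1) := Or.inr rfl

theorem isEnd_cases {e : G.Edge} {p : G.Point} (h : G.IsEnd e p.1.1) :
    ∃ hj : p.1.2 ≠ G.color e.1,
      p = ⟨(e.1, p.1.2), hj⟩ ∨ p = G.strand ⟨(e.1, p.1.2), hj⟩ := by
  refine ⟨h.color_eq ▸ p.2, ?_⟩
  rcases h with h | h
  · exact Or.inl (Subtype.ext (Prod.ext h rfl))
  · exact Or.inr (Subtype.ext (Prod.ext h rfl))

theorem isEnd_chord_iff {e : G.Edge} {p : G.Point} (h : G.IsEnd e p.1.1) :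
    G.IsEnd e (G.chord p).1.1 ↔ G.IsInnerStrand p := by
  refine ⟨fun h' => ?_, fun h' => ?_⟩
  · have h2 : (G.chord p).1.2 = p.1.2 :=
      snd_eq_of_pair (h'.color_eq.trans h.color_eq.symm) (G.chord_pair _)
    rcases eq_or_eq_opp h h' with h3 | h3
    · exact absurd (Subtype.ext (Prod.ext h3 h2)) (G.chord_ne p)
    · exact Subtype.ext (Prod.ext h3 h2)
  · rw [h']; exact h.opp

theorem isInnerStrand_strand {p : G.Point} :
    G.IsInnerStrand (G.strand p) ↔ G.IsInnerStrand p := by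
  unfold IsInnerStrand
  rw [strand_strand]
  refine ⟨fun h => ?_, fun h => ?_⟩
  · calc G.chord p = G.chord (G.chord (G.strand p)) := by rw [h]
      _ = G.strand p := G.chord_chord _
  · rw [← h, G.chord_chord]

open Classical in
/-- The colours `j` for which the strand of `e` through `(e, j)` is an outer strand. -/
noncomputable def outerColors (G : StrandedGraph) (e : G.Edge) : Finset (Fin 5) :=
  Finset.univ.filter fun j => ∃ h : j ≠ G.color e.1, ¬ G.IsInnerStrand ⟨(e.1, j), h⟩

theorem mem_outerColors {e : G.Edge} {j : Fin 5} :
    j ∈ G.outerColors e ↔ ∃ h : j ≠ G.color e.1, ¬ G.IsInnerStrand ⟨(e.1, j), h⟩ := by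
  simp [outerColors]

/-- The four strands of an edge are inner or outer. -/
theorem card_outerColors (e : G.Edge) : (G.outerColors e).card + G.innerCount e = 4 := by
  classical
  have h1 : G.innerCount e = (Finset.univ.filter fun j =>
      ∃ h : j ≠ G.color e.1, G.IsInnerStrand ⟨(e.1, j), h⟩).card := by
    rw [← Fintype.card_subtype, ← Nat.card_eq_fintype_card, innerCount]
    have hne (p : {p : G.Point // p.1.1 = e.1 ∧ G.IsInnerStrand p}) :
        p.1.1.2 ≠ G.color e.1 := fun h => p.1.2 (h.trans (congrArg G.color p.2.1.symm))
    refine Nat.card_congr ⟨fun p => ⟨p.1.1.2, hne p, ?_⟩,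
      fun j => ⟨⟨(e.1, j.1), j.2.1⟩, rfl, j.2.2⟩, ?_, fun _ => rfl⟩
    · have h1 : p.1 = ⟨(e.1, p.1.1.2), hne p⟩ := Subtype.ext (Prod.ext p.2.1 rfl)
      exact (iff_of_eq (congrArg G.IsInnerStrand h1)).1 p.2.2
    · rintro ⟨⟨⟨h, j⟩, hj⟩, h', hp⟩
      exact Subtype.ext (Subtype.ext (Prod.ext h'.symm rfl))
  have h2 : (Finset.univ.filter fun j => j ≠ G.color e.1).card = 4 := by
    rw [Finset.filter_ne', Finset.card_erase_of_mem (Finset.mem_univ _)]; rfl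
  rw [h1, ← h2, outerColors, ← Finset.card_union_of_disjoint]
  · congr 1
    ext j
    simp only [Finset.mem_union, Finset.mem_filter, Finset.mem_univ, true_and]
    refine ⟨fun h => h.elim Exists.fst Exists.fst, fun h => ?_⟩
    by_cases h' : G.IsInnerStrand ⟨(e.1, j), h⟩
    · exact Or.inr ⟨h, h'⟩
    · exact Or.inl ⟨h, h'⟩
  · rw [Finset.disjoint_filter]
    rintro j - ⟨_, h⟩ ⟨_, h'⟩
    exact h h'

/-- A point on an end of `e` leads by its chord to a pre-edge that is not an end of `e` exactly if
its strand is outer. -/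
theorem snd_mem_outerColors {e : G.Edge} {p : G.Point} (h : G.IsEnd e p.1.1) :
    p.1.2 ∈ G.outerColors e ↔ ¬ G.IsEnd e (G.chord p).1.1 := by
  rw [isEnd_chord_iff h, mem_outerColors]
  obtain ⟨hj, hp⟩ := isEnd_cases h
  have h1 : G.IsInnerStrand p ↔ G.IsInnerStrand ⟨(e.1, p.1.2), hj⟩ := by
    rcases hp with hp | hp
    · exact iff_of_eq (congrArg _ hp)
    · exact (iff_of_eq (congrArg _ hp)).trans isInnerStrand_strand
  rw [h1]
  exact ⟨fun h => h.2, fun h => ⟨hj, h⟩⟩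

theorem not_isEnd_chord_of_not_isLoop {e : G.Edge} (he : ¬ G.IsLoop e) {p : G.Point}
    (h : G.IsEnd e p.1.1) : ¬ G.IsEnd e (G.chord p).1.1 := by
  intro h'
  have h1 : G.chord p = G.strand p := (isEnd_chord_iff h).1 h'
  have h2 : G.ChordAdj p.1.1 (G.opp p.1.1) := ⟨p, rfl, by rw [h1]; rfl⟩
  rcases h with h | h <;> rw [h] at h2
  · exact he (Relation.EqvGen.rel _ _ h2)
  · rw [G.opp_opp] at h2
    exact he (Relation.EqvGen.symm _ _ (Relation.EqvGen.rel _ _ h2))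

theorem innerCount_eq_zero {e : G.Edge} (he : ¬ G.IsLoop e) : G.innerCount e = 0 := by
  have : IsEmpty {p : G.Point // p.1.1 = e.1 ∧ G.IsInnerStrand p} :=
    ⟨fun p => not_isEnd_chord_of_not_isLoop he (Or.inl p.2.1)
      ((isEnd_chord_iff (Or.inl p.2.1)).2 p.2.2)⟩
  exact Nat.card_of_isEmpty

/-! ### Contractions -/

/-- The image of a point under a map of pre-edges that preserves colours. -/
def mapPoint (ι : B.Flag → A.Flag) (hc : ∀ b, B.color b = A.color (ι b)) (p : B.Point) : A.Point :=
  ⟨(ι p.1.1, p.1.2), by rw [← hc]; exact p.2⟩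

/-- `B` is the contraction of `A` along `e`; the map `ι` identifies the pre-edges of `B` with those
of `A` that are not ends of `e`. -/
structure IsContraction (A B : StrandedGraph) (e : A.Edge) (ι : B.Flag → A.Flag) : Prop where
  injective : Function.Injective ι
  isEnd_or : ∀ x, A.IsEnd e x ∨ ∃ b, ι b = x
  not_isEnd : ∀ b, ¬ A.IsEnd e (ι b)
  color : ∀ b, B.color b = A.color (ι b)
  opp : ∀ b, ι (B.opp b) = A.opp (ι b)
  chord : ∀ p, mapPoint ι color (B.chord p) = A.throughChord e (mapPoint ι color p)
  discs : B.discs = A.discs + A.innerCount e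

namespace IsContraction

variable {e : A.Edge} {ι : B.Flag → A.Flag}

theorem exists_flag (H : IsContraction A B e ι) {x : A.Flag} (hx : ¬ A.IsEnd e x) :
    ∃ b, ι b = x :=
  (H.isEnd_or x).resolve_left hx

/-- A chord of `A` between pre-edges that are not ends of `e` is a chord of `B`. -/
theorem chord_of_not_isEnd (H : IsContraction A B e ι) (p : B.Point)
    (hp : ¬ A.IsEnd e (A.chord (mapPoint ι H.color p)).1.1) :
    mapPoint ι H.color (B.chord p) = A.chord (mapPoint ι H.color p) :=
  (H.chord p).trans (if_neg hp)

theorem chord_of_isEnd (H : IsContraction A B e ι) (p : B.Point)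
    (hp : A.IsEnd e (A.chord (mapPoint ι H.color p)).1.1) :
    mapPoint ι H.color (B.chord p) = A.chord (A.strand (A.chord (mapPoint ι H.color p))) :=
  (H.chord p).trans (if_pos hp)

variable {ρ : A.Flag → A.Flag → Prop} {σ : B.Flag → B.Flag → Prop} {C : Finset (Fin 5)}

/-- The pre-edge `c` is reached from an end of `e` by a chord with both colours in `C`. -/
def Hangs (A : StrandedGraph) (e : A.Edge) (ι : B.Flag → A.Flag) (C : Finset (Fin 5))
    (c : {h : B.Flag // B.color h ∈ C}) : Prop :=
  ∃ p : A.Point, A.IsEnd e p.1.1 ∧ p.1.2 ∈ C ∧ (A.chord p).1.1 = ι c.1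

theorem bubbleRel_of (H : IsContraction A B e ι) (hσ : ∀ b c, σ b c ↔ ρ (ι b) (ι c))
    {b c : {h : B.Flag // B.color h ∈ C}}
    (h : A.BubbleRel ρ C ⟨ι b.1, H.color b.1 ▸ b.2⟩ ⟨ι c.1, H.color c.1 ▸ c.2⟩) :
    B.BubbleRel σ C b c := by
  rcases h with ⟨p, hpC, hp, hp'⟩ | h
  · dsimp only at hp hp'
    let p' : B.Point := ⟨(b.1, p.1.2), by rw [H.color, ← hp]; exact p.2⟩
    have h1 : mapPoint ι H.color p' = p := Subtype.ext (Prod.ext hp.symm rfl)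
    have h2 := H.chord_of_not_isEnd p' (by rw [h1, hp']; exact H.not_isEnd c.1)
    refine Or.inl ⟨p', hpC, rfl, H.injective ?_⟩
    rw [← hp', ← h1, ← h2]; rfl
  · exact Or.inr ((hσ _ _).2 h)

/-- The two pre-edges hanging on the two ends of an outer strand of `e` are joined by a chord
of the contraction. -/
theorem bubbleRel_strand (H : IsContraction A B e ι)
    {b c : {h : B.Flag // B.color h ∈ C}} {p : A.Point} (hp : A.IsEnd e p.1.1) (hpC : p.1.2 ∈ C)
    (he : A.color e.1 ∈ C)
    (hb : (A.chord p).1.1 = ι b.1) (hc : (A.chord (A.strand p)).1.1 = ι c.1) :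
    B.BubbleRel σ C b c := by
  let p' : B.Point := ⟨(b.1, (A.chord p).1.2), by rw [H.color, ← hb]; exact (A.chord p).2⟩
  have h1 : mapPoint ι H.color p' = A.chord p := Subtype.ext (Prod.ext hb.symm rfl)
  have h2 := H.chord_of_isEnd p' (by rw [h1, A.chord_chord]; exact hp)
  rw [h1, A.chord_chord] at h2
  refine Or.inl ⟨p', (chord_mem (hp.color_eq ▸ he) hpC).2, rfl, H.injective ?_⟩
  rw [← hc, ← h2]; rfl

/-- In the passage to the contraction, the bubble through `e` is replaced by the bubbles of the
pre-edges that hang on the ends of `e`. -/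
theorem card_quot_bubbleRel (H : IsContraction A B e ι) (hσ : ∀ b c, σ b c ↔ ρ (ι b) (ι c))
    (hρ : ∀ x y, ρ x y → y = x ∨ y = A.opp x) (he : A.color e.1 ∈ C)
    (hend : Quot.mk (A.BubbleRel ρ C) ⟨A.opp e.1, (A.opp_color e.1).symm ▸ he⟩ =
      Quot.mk (A.BubbleRel ρ C) ⟨e.1, he⟩) :
    Nat.card (Quot (A.BubbleRel ρ C)) +
        Nat.card {q : Quot (B.BubbleRel σ C) // ∃ c, Hangs A e ι C c ∧ Quot.mk _ c = q} =
      Nat.card (Quot (B.BubbleRel σ C)) + 1 := by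
  have hE : ∀ x : {h : A.Flag // A.color h ∈ C}, A.IsEnd e x.1 →
      Quot.mk (A.BubbleRel ρ C) x = Quot.mk (A.BubbleRel ρ C) ⟨e.1, he⟩ := by
    rintro ⟨x, hx⟩ h
    rcases h with h | h
    · congr 1; exact Subtype.ext h
    · rw [← hend]; congr 1; exact Subtype.ext h
  have hnend : ∀ {x y}, ρ x y → (A.IsEnd e x ↔ A.IsEnd e y) := by
    intro x y h
    rcases hρ x y h with rfl | rfl
    · rfl
    · exact ⟨IsEnd.opp, fun h => by simpa [A.opp_opp] using h.opp⟩
  have hchord : ∀ (p : A.Point) (h1 : A.color p.1.1 ∈ C) (h2 : p.1.2 ∈ C),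
      Quot.mk (A.BubbleRel ρ C) ⟨(A.chord p).1.1, (chord_mem h1 h2).1⟩ =
        Quot.mk (A.BubbleRel ρ C) ⟨p.1.1, h1⟩ := fun p h1 h2 =>
    (Quot.sound (r := A.BubbleRel ρ C) (Or.inl ⟨p, h2, rfl, rfl⟩)).symm
  refine card_quot_remove (fun b => ⟨ι b.1, H.color b.1 ▸ b.2⟩) (fun x => A.IsEnd e x.1)
    (Hangs A e ι C) ⟨e.1, he⟩ ?_ ?_ ?_ ?_ ?_ ?_ ?_ hE (isEnd_fst e)
  · intro b c hbc
    exact Subtype.ext (H.injective (congrArg Subtype.val hbc))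
  · rintro ⟨x, hx⟩
    refine (H.isEnd_or x).imp id ?_
    rintro ⟨b, rfl⟩
    exact ⟨⟨b, (H.color b).symm ▸ hx⟩, rfl⟩
  · exact fun b => H.not_isEnd b.1
  · rintro ⟨b, hb⟩ ⟨c, hc⟩ (⟨p, hpC, hp, hp'⟩ | h)
    · dsimp only at hp hp'
      subst hp hp'
      have hpA : A.color (mapPoint ι H.color p).1.1 ∈ C := H.color p.1.1 ▸ hb
      have hc1 := hchord (mapPoint ι H.color p) hpA hpC
      by_cases hq : A.IsEnd e (A.chord (mapPoint ι H.color p)).1.1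
      · have h2 := H.chord_of_isEnd p hq
        have hm := chord_mem hpA (p := mapPoint ι H.color p) hpC
        have hc2 := hchord (A.strand (A.chord (mapPoint ι H.color p)))
          ((IsEnd.color_eq hq.opp).symm ▸ he) hm.2
        have h3 : ι (B.chord p).1.1 = (A.chord (A.strand (A.chord (mapPoint ι H.color p)))).1.1 :=
          congrArg (fun r : A.Point => r.1.1) h2
        simp only [h3]
        exact hc1.symm.trans ((hE _ hq).trans ((hE _ hq.opp).symm.trans hc2.symm))
      · have h2 := H.chord_of_not_isEnd p hq
        have h3 : ι (B.chord p).1.1 = (A.chord (mapPoint ι H.color p)).1.1 :=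
          congrArg (fun r : A.Point => r.1.1) h2
        simp only [h3]
        exact hc1.symm
    · exact Quot.sound (Or.inr ((hσ _ _).1 h))
  · exact fun b c h => Quot.sound (H.bubbleRel_of hσ h)
  · rintro ⟨x, hx⟩ ⟨c, hc⟩ hxe ((⟨p, hpC, hp, hp'⟩ | h) | (⟨p, hpC, hp, hp'⟩ | h))
    · exact ⟨p, hp ▸ hxe, hpC, hp'⟩
    · exact absurd ((hnend h).1 hxe) (H.not_isEnd c)
    · refine ⟨A.chord p, by rw [hp']; exact hxe, ?_, by rw [A.chord_chord]; exact hp⟩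
      refine (chord_mem ?_ hpC).2
      rw [hp, ← H.color]; exact hc
    · exact absurd ((hnend h).2 hxe) (H.not_isEnd c)
  · rintro ⟨c, hc⟩ ⟨p, hp, hpC, hp'⟩
    dsimp only at hp' ⊢
    have h1 := hchord p (by rw [hp.color_eq]; exact he) hpC
    simp only [hp'] at h1
    exact h1.trans (hE _ hp)

/-- Bubbles without the colour of `e` are not affected by the contraction. -/
theorem card_quot_bubbleRel_of_notMem (H : IsContraction A B e ι)
    (hσ : ∀ b c, σ b c ↔ ρ (ι b) (ι c)) (he : A.color e.1 ∉ C) :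
    Nat.card (Quot (A.BubbleRel ρ C)) = Nat.card (Quot (B.BubbleRel σ C)) := by
  have hne : ∀ x : {h : A.Flag // A.color h ∈ C}, ¬ A.IsEnd e x.1 := fun x hx =>
    he (hx.color_eq ▸ x.2)
  choose g hg using fun x : {h : A.Flag // A.color h ∈ C} => H.exists_flag (hne x)
  let g' : {h : A.Flag // A.color h ∈ C} → {h : B.Flag // B.color h ∈ C} := fun x =>
    ⟨g x, by rw [H.color, hg]; exact x.2⟩
  let f : {h : B.Flag // B.color h ∈ C} → {h : A.Flag // A.color h ∈ C} := fun b =>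
    ⟨ι b.1, H.color b.1 ▸ b.2⟩
  have hfg : ∀ x, f (g' x) = x := fun x => Subtype.ext (hg x)
  have hgf : ∀ b, g' (f b) = b := fun b => Subtype.ext (H.injective (hg _))
  refine card_quot_eq g' f ?_ ?_ (fun x => by rw [hfg]) (fun b => by rw [hgf])
  · intro x y h
    refine Quot.sound (H.bubbleRel_of hσ ?_)
    change A.BubbleRel ρ C (f (g' x)) (f (g' y))
    rwa [hfg, hfg]
  · rintro ⟨b, hb⟩ ⟨c, hc⟩ (⟨p, hpC, hp, hp'⟩ | h)
    · dsimp only at hp hp'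
      subst hp hp'
      have hpA : A.color (mapPoint ι H.color p).1.1 ∈ C := (f ⟨_, hb⟩).2
      have hq := hne ⟨_, (chord_mem hpA (p := mapPoint ι H.color p) hpC).1⟩
      have h2 := H.chord_of_not_isEnd p hq
      exact Quot.sound (Or.inl ⟨mapPoint ι H.color p, hpC, rfl,
        (congrArg (fun r : A.Point => r.1.1) h2).symm⟩)
    · exact Quot.sound (Or.inr ((hσ _ _).1 h))

end IsContraction

end StrandedGraph

namespace StrandedGraph

variable {G A B : StrandedGraph}

namespace IsContraction

variable {e : A.Edge} {ι : B.Flag → A.Flag} {ρ : A.Flag → A.Flag → Prop}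
  {σ : B.Flag → B.Flag → Prop} {C : Finset (Fin 5)}

/-- If `e` is not a loop, all that hangs on the ends of `e` in a bubble stays connected. This is
where the orientation is needed: removing one pre-edge from a vertex does not disconnect it. -/
theorem card_hangs_of_not_isLoop (H : IsContraction A B e ι) (o : A.Orientation)
    (hloop : ¬ A.IsLoop e) (hσ : ∀ b c, σ b c ↔ ρ (ι b) (ι c)) (he : A.color e.1 ∈ C)
    (hC : ∃ j ∈ C, j ≠ A.color e.1) :
    Nat.card {q : Quot (B.BubbleRel σ C) // ∃ c, Hangs A e ι C c ∧ Quot.mk _ c = q} = 1 := by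
  classical
  have := Fintype.ofFinite A.Point
  obtain ⟨j, hj, hj₀⟩ := hC
  have hout : ∀ p : A.Point, A.IsEnd e p.1.1 → p.1.2 ∈ C →
      ∃ c : {h : B.Flag // B.color h ∈ C}, (A.chord p).1.1 = ι c.1 := by
    intro p hp hpC
    obtain ⟨b, hb⟩ := H.exists_flag (not_isEnd_chord_of_not_isLoop hloop hp)
    refine ⟨⟨b, ?_⟩, hb.symm⟩
    rw [H.color, hb]
    exact (chord_mem (by rw [hp.color_eq]; exact he) hpC).1
  obtain ⟨n, hn⟩ := hout ⟨(e.1, j), hj₀⟩ (isEnd_fst e) hj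
  -- `K` is the part of the vertex of `e.1`, without `e.1`, that is connected to `n` in `B`. It is not
  -- reached by chords from the other end of `e`, which lies on another vertex.
  let K : Set A.Flag := {x | ∃ b : {h : B.Flag // B.color h ∈ C}, ι b.1 = x ∧
    Quot.mk (B.BubbleRel σ C) b = Quot.mk _ n ∧ Quot.mk A.ChordAdj x = Quot.mk _ e.1}
  have hlabel : ∀ p q : A.Point, s(p, A.chord p) = s(q, A.chord q) → p = q ∨ q = A.chord p := by
    intro p q h
    rcases Sym2.eq_iff.1 h with h | h
    · exact Or.inl h.1
    · exact Or.inr h.2.symm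
  have hchord : ∀ p : A.Point, Quot.mk A.ChordAdj (A.chord p).1.1 = Quot.mk _ p.1.1 := fun p =>
    (Quot.sound (r := A.ChordAdj) ⟨p, rfl, rfl⟩).symm
  have key : ∀ k (hk₀ : k ≠ A.color e.1), k ∈ C → (A.chord ⟨(e.1, k), hk₀⟩).1.1 ∈ K := by
    intro k hk₀ hk
    have h1 := exists_strand_of_balanced (color := A.color) (sign := o.sign)
      (fun p => s(p, A.chord p)) (fun c d Φ _ => o.sum_charge_of_chord c d _ (fun p hp => by
        rw [A.chord_chord, Sym2.eq_swap]; exact hp)) C he (o.sign_ne _) (K := K) ?_ ?_ hj hk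
        hj₀ hk₀ ?_
    · obtain ⟨p, hp, -, -, hpt⟩ := h1
      rcases hlabel _ _ hpt.symm with h | h
      · obtain ⟨b, hb, -⟩ := hp
        rw [← h] at hb
        exact absurd (hb ▸ isEnd_fst e) (H.not_isEnd b.1)
      · rwa [← h]
    · rintro ⟨b, hb, -⟩
      exact H.not_isEnd b.1 (hb ▸ isEnd_fst e)
    · rintro p q hpq ⟨b, hb, hbn, hbe⟩ - hpC hqC - hq
      rcases hlabel p q hpq with rfl | rfl
      · exact ⟨b, hb, hbn, hbe⟩
      · have hqe := (hchord p).trans hbe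
        have hqE : ¬ A.IsEnd e (A.chord p).1.1 := by
          rintro (h | h)
          · exact hq h
          · rw [h] at hqe
            exact hloop (Relation.EqvGen.symm _ _ (quot_eq_iff_eqvGen.1 hqe))
        obtain ⟨c, hc⟩ := H.exists_flag hqE
        refine ⟨⟨c, by rw [H.color, hc]; exact hqC⟩, hc, ?_, hqe⟩
        rw [← hbn]
        refine (Quot.sound (H.bubbleRel_of hσ (Or.inl ⟨p, hpC, hb.symm, hc.symm⟩))).symm
    · refine ⟨A.chord ⟨(e.1, j), hj₀⟩, ⟨n, hn.symm, rfl, hchord _⟩, ?_, ?_, ?_⟩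
      · exact (chord_mem (p := ⟨(e.1, j), hj₀⟩) he hj).1
      · exact (chord_mem (p := ⟨(e.1, j), hj₀⟩) he hj).2
      · rw [A.chord_chord, Sym2.eq_swap]
  refine Nat.card_eq_one_iff_exists.2
    ⟨⟨Quot.mk _ n, n, ⟨⟨(e.1, j), hj₀⟩, isEnd_fst e, hj, hn⟩, rfl⟩, ?_⟩
  rintro ⟨_, c, ⟨p, hp, hpC, hpc⟩, rfl⟩
  apply Subtype.ext
  obtain ⟨hk, h | h⟩ := isEnd_cases hp
  · obtain ⟨b, hb, hbn, -⟩ := key p.1.2 hk hpC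
    rw [← h, hpc] at hb
    have hbc : b = c := Subtype.ext (H.injective hb)
    rwa [hbc] at hbn
  · obtain ⟨b, hb, hbn, -⟩ := key p.1.2 hk hpC
    refine Eq.trans (Quot.sound ?_) hbn
    refine H.bubbleRel_strand hp hpC he hpc ?_
    rw [h, strand_strand]
    exact hb.symm

/-- For a trivial loop `e`, the bubbles that hang on the ends of `e` correspond to the outer strands
of `e`. -/
theorem card_hangs_of_isTrivialLoop (H : IsContraction A B e ι) (htriv : A.IsTrivialLoop e)
    (hσ : ∀ b c, σ b c ↔ ρ (ι b) (ι c)) (hρ : ∀ x y, ρ x y → y = x ∨ y = A.opp x)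
    (he : A.color e.1 ∈ C) :
    Nat.card {q : Quot (B.BubbleRel σ C) // ∃ c, Hangs A e ι C c ∧ Quot.mk _ c = q} =
      (A.outerColors e ∩ C).card := by
  classical
  have hout : ∀ p : A.Point, A.IsEnd e p.1.1 → p.1.2 ∈ A.outerColors e → p.1.2 ∈ C →
      ∃ c : {h : B.Flag // B.color h ∈ C}, (A.chord p).1.1 = ι c.1 := by
    intro p hp hpo hpC
    obtain ⟨b, hb⟩ := H.exists_flag ((snd_mem_outerColors hp).1 hpo)
    refine ⟨⟨b, ?_⟩, hb.symm⟩
    rw [H.color, hb]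
    exact (chord_mem (by rw [hp.color_eq]; exact he) hpC).1
  have hne : ∀ {j}, j ∈ A.outerColors e → j ≠ A.color e.1 := fun h => (mem_outerColors.1 h).1
  choose n hn using fun j : {j // j ∈ A.outerColors e ∩ C} =>
    hout ⟨(e.1, j.1), hne (Finset.mem_inter.1 j.2).1⟩ (isEnd_fst e) (Finset.mem_inter.1 j.2).1
      (Finset.mem_inter.1 j.2).2
  -- The sector of the outer strand `j`: what hangs on one of its two end points.
  let Sec : Fin 5 → A.Flag → Prop := fun j x => ∃ p : A.Point, A.IsEnd e p.1.1 ∧ p.1.2 = j ∧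
    ¬ A.IsEnd e (A.chord p).1.1 ∧ Relation.EqvGen (A.AdjOutside e) (A.chord p).1.1 x
  have hsec : ∀ j k x, Sec j x → Sec k x → j = k := by
    rintro j k x ⟨p, hp, rfl, hpo, hpx⟩ ⟨q, hq, rfl, hqo, hqx⟩
    by_contra hjk
    exact htriv.2 p q hp hq hjk hpo hqo (hpx.trans _ _ _ (hqx.symm _ _))
  have hstep : ∀ j x y, ¬ A.IsEnd e x → ¬ A.IsEnd e y → A.Adj x y → (Sec j x ↔ Sec j y) := by
    intro j x y hx hy hxy
    have h : Relation.EqvGen (A.AdjOutside e) x y := .rel _ _ ⟨hx, hy, hxy⟩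
    exact ⟨fun ⟨p, h1, h2, h3, h4⟩ => ⟨p, h1, h2, h3, h4.trans _ _ _ h⟩,
      fun ⟨p, h1, h2, h3, h4⟩ => ⟨p, h1, h2, h3, h4.trans _ _ _ (h.symm _ _)⟩⟩
  have hsec_end : ∀ j (p : A.Point), A.IsEnd e p.1.1 → ¬ A.IsEnd e (A.chord p).1.1 →
      (Sec j (A.chord p).1.1 ↔ p.1.2 = j) := fun j p hp hpo =>
    ⟨fun h => hsec _ _ _ ⟨p, hp, rfl, hpo, .refl _⟩ h, fun h => ⟨p, hp, h, hpo, .refl _⟩⟩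
  have hinv : ∀ j, ∀ b c : {h : B.Flag // B.color h ∈ C}, B.BubbleRel σ C b c →
      (Sec j (ι b.1) ↔ Sec j (ι c.1)) := by
    rintro j ⟨b, hb⟩ ⟨c, hc⟩ (⟨p, -, hp, hp'⟩ | h)
    · dsimp only at hp hp' ⊢
      subst hp hp'
      by_cases hq : A.IsEnd e (A.chord (mapPoint ι H.color p)).1.1
      · have h2 := H.chord_of_isEnd p hq
        have h3 : ι (B.chord p).1.1 = (A.chord (A.strand (A.chord (mapPoint ι H.color p)))).1.1 :=
          congrArg (fun r : A.Point => r.1.1) h2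
        have h4 := hsec_end j _ hq (by rw [A.chord_chord]; exact H.not_isEnd _)
        rw [A.chord_chord] at h4
        rw [h3]
        exact h4.trans (hsec_end j (A.strand (A.chord (mapPoint ι H.color p))) hq.opp
          (by rw [← h3]; exact H.not_isEnd _)).symm
      · have h2 := H.chord_of_not_isEnd p hq
        have h3 : ι (B.chord p).1.1 = (A.chord (mapPoint ι H.color p)).1.1 :=
          congrArg (fun r : A.Point => r.1.1) h2
        rw [h3]
        exact hstep j _ _ (H.not_isEnd _) hq (Or.inl ⟨mapPoint ι H.color p, rfl, rfl⟩)
    · rcases hρ _ _ ((hσ _ _).1 h) with h | h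
      · dsimp only
        rw [h]
      · exact hstep j _ _ (H.not_isEnd _) (H.not_isEnd _) (Or.inr h.symm)
  rw [← Fintype.card_coe, ← Nat.card_eq_fintype_card]
  refine (Nat.card_congr (Equiv.ofBijective (fun j => ⟨Quot.mk _ (n j), n j,
    ⟨⟨(e.1, j.1), hne (Finset.mem_inter.1 j.2).1⟩, isEnd_fst e, (Finset.mem_inter.1 j.2).2,
      hn j⟩, rfl⟩) ⟨?_, ?_⟩)).symm
  · intro j k hjk
    have hjk' : Quot.mk (B.BubbleRel σ C) (n j) = Quot.mk _ (n k) := congrArg Subtype.val hjk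
    have h1 := iff_of_quot_eq (fun b => Sec j.1 (ι b.1)) (hinv j.1) hjk'
    have h2 : ∀ j k : {j // j ∈ A.outerColors e ∩ C}, Sec j.1 (ι (n k).1) ↔ k.1 = j.1 := by
      intro j k
      rw [← hn k]
      exact hsec_end j.1 ⟨(e.1, k.1), hne (Finset.mem_inter.1 k.2).1⟩ (isEnd_fst e)
        (by rw [hn k]; exact H.not_isEnd _)
    exact Subtype.ext (((h2 j k).1 (h1.1 ((h2 j j).2 rfl))).symm)
  · rintro ⟨_, c, ⟨p, hp, hpC, hpc⟩, rfl⟩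
    have hpo := (snd_mem_outerColors hp).2 (by rw [hpc]; exact H.not_isEnd _)
    obtain ⟨hj, h⟩ := isEnd_cases hp
    let j : {j // j ∈ A.outerColors e ∩ C} := ⟨p.1.2, Finset.mem_inter.2 ⟨hpo, hpC⟩⟩
    refine ⟨j, Subtype.ext ?_⟩
    rcases h with h | h
    · have h1 : n j = c := by
        refine Subtype.ext (H.injective ?_)
        rw [← hn j, ← hpc]
        exact congrArg (fun q : A.Point => (A.chord q).1.1) h.symm
      exact congrArg (Quot.mk _) h1
    · refine (Quot.sound (H.bubbleRel_strand hp hpC he hpc ?_)).symm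
      rw [← hn j]
      exact congrArg (fun q : A.Point => (A.chord q).1.1)
        ((congrArg A.strand h).trans (strand_strand _))

/-! ### Vertices, components and bubbles of a contraction -/

theorem edgeRel_iff (H : IsContraction A B e ι) (b c : B.Flag) :
    B.EdgeRel b c ↔ A.EdgeRel (ι b) (ι c) := by
  rw [EdgeRel, EdgeRel, ← H.opp]
  exact H.injective.eq_iff.symm

theorem quot_bubbleRel_edgeRel (he : A.color e.1 ∈ C) :
    Quot.mk (A.BubbleRel A.EdgeRel C)
        ⟨A.opp e.1, (A.opp_color e.1).symm ▸ he⟩ =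
      Quot.mk (A.BubbleRel A.EdgeRel C) ⟨e.1, he⟩ :=
  Quot.sound (Or.inr (A.opp_opp e.1))

theorem exists_ne_color (hC : 2 ≤ C.card) (i : Fin 5) : ∃ j ∈ C, j ≠ i :=
  Finset.exists_mem_ne (by omega) i

/-- Contracting an edge that is not a loop merges two vertices. -/
theorem numVertices_of_not_isLoop (H : IsContraction A B e ι) (o : A.Orientation)
    (hloop : ¬ A.IsLoop e) : A.numVertices = B.numVertices + 1 := by
  have hσ : ∀ b c, False ↔ A.IsEnd e (ι b) ∧ A.IsEnd e (ι c) :=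
    fun b c => ⟨False.elim, fun h => H.not_isEnd b h.1⟩
  have hρ : ∀ x y, A.IsEnd e x ∧ A.IsEnd e y → y = x ∨ y = A.opp x :=
    fun x y h => eq_or_eq_opp h.1 h.2
  have he := Finset.mem_univ (A.color e.1)
  -- The contraction keeps the classes once the ends of `e` are linked, which merges two vertices.
  have h1 := H.card_quot_bubbleRel (ρ := fun x y => A.IsEnd e x ∧ A.IsEnd e y) hσ hρ he
    (Quot.sound (Or.inr ⟨isEnd_snd e, isEnd_fst e⟩))
  rw [H.card_hangs_of_not_isLoop (ρ := fun x y => A.IsEnd e x ∧ A.IsEnd e y) o hloop hσ he (exists_ne_color (by decide) _)] at h1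
  have h2 := card_quot_link (J := Unit) (r := A.BubbleRel (fun _ _ => False) Finset.univ)
    (r' := A.BubbleRel (fun x y => A.IsEnd e x ∧ A.IsEnd e y) Finset.univ)
    (a := fun _ => ⟨e.1, Finset.mem_univ _⟩) (b := fun _ => ⟨A.opp e.1, Finset.mem_univ _⟩)
    (fun _ _ _ => rfl) ?_ ?_ ?_ ?_
  · rw [Nat.card_unique (α := Unit)] at h2
    rw [numVertices, numVertices, card_quot_chordAdj, card_quot_chordAdj, H.discs,
      innerCount_eq_zero hloop]
    omega
  · intro _ _ h
    refine hloop (quot_eq_iff_eqvGen.1 (eq_of_quot_eq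
      (fun x : {h : A.Flag // A.color h ∈ Finset.univ} => Quot.mk A.ChordAdj x.1) ?_ h))
    rintro x y (⟨p, -, hp, hp'⟩ | h)
    · exact Quot.sound ⟨p, hp, hp'⟩
    · exact h.elim
  · rintro x y (h | h)
    · exact Quot.sound (Or.inl h)
    · exact h.elim
  · exact fun _ => Quot.sound (Or.inr ⟨isEnd_fst e, isEnd_snd e⟩)
  · rintro ⟨x, hx⟩ ⟨y, hy⟩ (h | ⟨hx | hx, hy | hy⟩)
    · exact Or.inl (Quot.sound (Or.inl h))
    · exact Or.inl (congrArg _ (Subtype.ext (hx.trans hy.symm)))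
    · exact Or.inr ⟨(), Or.inl ⟨congrArg _ (Subtype.ext hx), congrArg _ (Subtype.ext hy)⟩⟩
    · exact Or.inr ⟨(), Or.inr ⟨congrArg _ (Subtype.ext hx), congrArg _ (Subtype.ext hy)⟩⟩
    · exact Or.inl (congrArg _ (Subtype.ext (hx.trans hy.symm)))

theorem numComponents_of_not_isLoop (H : IsContraction A B e ι) (o : A.Orientation)
    (hloop : ¬ A.IsLoop e) : A.numComponents = B.numComponents := by
  have he := Finset.mem_univ (A.color e.1)
  have h1 := H.card_quot_bubbleRel (ρ := A.EdgeRel) (σ := B.EdgeRel) H.edgeRel_iff (fun _ _ h => Or.inr h.symm) he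
    (quot_bubbleRel_edgeRel he)
  rw [H.card_hangs_of_not_isLoop (ρ := A.EdgeRel) (σ := B.EdgeRel) o hloop H.edgeRel_iff he (exists_ne_color (by decide) _)] at h1
  rw [numComponents, numComponents, card_quot_adj, card_quot_adj, H.discs,
    innerCount_eq_zero hloop]
  omega

theorem numBubbles_of_not_isLoop (H : IsContraction A B e ι) (o : A.Orientation)
    (hloop : ¬ A.IsLoop e) {d : ℕ} (hd : 2 ≤ d) : A.numBubbles d = B.numBubbles d := by
  refine Finset.sum_congr rfl fun C hC => ?_
  change Nat.card (Quot (A.BubbleRel A.EdgeRel C)) =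
    Nat.card (Quot (B.BubbleRel B.EdgeRel C))
  by_cases he : A.color e.1 ∈ C
  · have h1 := H.card_quot_bubbleRel (ρ := A.EdgeRel) (σ := B.EdgeRel) H.edgeRel_iff (fun _ _ h => Or.inr h.symm) he
      (quot_bubbleRel_edgeRel he)
    rw [H.card_hangs_of_not_isLoop (ρ := A.EdgeRel) (σ := B.EdgeRel) o hloop H.edgeRel_iff he
      (exists_ne_color ((Finset.mem_powersetCard.1 hC).2 ▸ hd) _)] at h1
    omega
  · exact H.card_quot_bubbleRel_of_notMem (ρ := A.EdgeRel) (σ := B.EdgeRel) H.edgeRel_iff he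

/-- Contracting a trivial loop replaces its vertex by one vertex for each of its four strands: a
disc for an inner strand, the sector for an outer strand. -/
theorem numVertices_of_isTrivialLoop (H : IsContraction A B e ι) (htriv : A.IsTrivialLoop e) :
    B.numVertices = A.numVertices + 3 := by
  have hρ : ∀ x y : A.Flag, False → y = x ∨ y = A.opp x := fun _ _ h => h.elim
  have he := Finset.mem_univ (A.color e.1)
  have h1 := H.card_quot_bubbleRel (ρ := fun _ _ => False) (σ := fun _ _ => False) (fun _ _ => Iff.rfl) hρ
    he ?_
  · rw [H.card_hangs_of_isTrivialLoop (ρ := fun _ _ => False) htriv (fun _ _ => Iff.rfl) hρ he,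
      Finset.inter_univ] at h1
    have h2 := card_outerColors e
    rw [numVertices, numVertices, card_quot_chordAdj, card_quot_chordAdj, H.discs]
    omega
  · refine eq_of_quot_eq (r := A.ChordAdj) (fun x : A.Flag => Quot.mk
      (A.BubbleRel (fun _ _ => False) Finset.univ) ⟨x, Finset.mem_univ _⟩) ?_
      (quot_eq_iff_eqvGen.2 htriv.1).symm
    rintro x y ⟨p, hp, hp'⟩
    exact Quot.sound (Or.inl ⟨p, Finset.mem_univ _, hp, hp'⟩)

theorem numComponents_of_isTrivialLoop (H : IsContraction A B e ι) (htriv : A.IsTrivialLoop e) :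
    B.numComponents = A.numComponents + 3 := by
  have he := Finset.mem_univ (A.color e.1)
  have hρ : ∀ x y, A.EdgeRel x y → y = x ∨ y = A.opp x := fun _ _ h => Or.inr h.symm
  have h1 := H.card_quot_bubbleRel (ρ := A.EdgeRel) (σ := B.EdgeRel) H.edgeRel_iff hρ he (quot_bubbleRel_edgeRel he)
  rw [H.card_hangs_of_isTrivialLoop (ρ := A.EdgeRel) (σ := B.EdgeRel) htriv H.edgeRel_iff hρ he, Finset.inter_univ] at h1
  have h2 := card_outerColors e
  rw [numComponents, numComponents, card_quot_adj, card_quot_adj, H.discs]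
  omega

theorem numBubbles_of_isTrivialLoop (H : IsContraction A B e ι) (htriv : A.IsTrivialLoop e)
    (d : ℕ) :
    A.numBubbles d + ∑ C ∈ Finset.powersetCard d (Finset.univ : Finset (Fin 5)),
        (if A.color e.1 ∈ C then (A.outerColors e ∩ C).card else 0) =
      B.numBubbles d + ∑ C ∈ Finset.powersetCard d (Finset.univ : Finset (Fin 5)),
        (if A.color e.1 ∈ C then 1 else 0) := by
  rw [numBubbles, numBubbles, ← Finset.sum_add_distrib, ← Finset.sum_add_distrib]
  refine Finset.sum_congr rfl fun C _ => ?_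
  change Nat.card (Quot (A.BubbleRel A.EdgeRel C)) + _ =
    Nat.card (Quot (B.BubbleRel B.EdgeRel C)) + _
  by_cases he : A.color e.1 ∈ C
  · have hρ : ∀ x y, A.EdgeRel x y → y = x ∨ y = A.opp x := fun _ _ h => Or.inr h.symm
    have h1 := H.card_quot_bubbleRel (ρ := A.EdgeRel) (σ := B.EdgeRel) H.edgeRel_iff hρ he (quot_bubbleRel_edgeRel he)
    rw [H.card_hangs_of_isTrivialLoop (ρ := A.EdgeRel) (σ := B.EdgeRel) htriv H.edgeRel_iff hρ he] at h1
    rwa [if_pos he, if_pos he]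
  · rw [if_neg he, if_neg he, H.card_quot_bubbleRel_of_notMem (ρ := A.EdgeRel) (σ := B.EdgeRel) H.edgeRel_iff he]

end IsContraction

theorem sum_powersetCard_mem (i : Fin 5) :
    (∑ C ∈ Finset.powersetCard 3 (Finset.univ : Finset (Fin 5)), if i ∈ C then 1 else 0) = 6 ∧
    (∑ C ∈ Finset.powersetCard 4 (Finset.univ : Finset (Fin 5)), if i ∈ C then 1 else 0) = 4 := by
  decide +revert

/-- The sum counts each `j ∈ J` once for every `C` with `i, j ∈ C`; a pair of colours is contained in
three sets of three colours and in three sets of four. -/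
theorem sum_powersetCard_inter_card {d : ℕ} (hd : d = 3 ∨ d = 4) (i : Fin 5) (J : Finset (Fin 5))
    (hi : i ∉ J) :
    (∑ C ∈ Finset.powersetCard d (Finset.univ : Finset (Fin 5)),
      if i ∈ C then (J ∩ C).card else 0) = 3 * J.card := by
  have h3 : ∀ i j : Fin 5, j ≠ i →
      (∑ C ∈ Finset.powersetCard 3 (Finset.univ : Finset (Fin 5)),
        if i ∈ C ∧ j ∈ C then 1 else 0) = 3 := by decide
  have h4 : ∀ i j : Fin 5, j ≠ i →
      (∑ C ∈ Finset.powersetCard 4 (Finset.univ : Finset (Fin 5)),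
        if i ∈ C ∧ j ∈ C then 1 else 0) = 3 := by decide
  have h : ∀ C : Finset (Fin 5), (if i ∈ C then (J ∩ C).card else 0) =
      ∑ j ∈ J, if i ∈ C ∧ j ∈ C then 1 else 0 := by
    intro C
    by_cases hC : i ∈ C
    · simp [hC]
    · simp [hC]
  simp only [h]
  rw [Finset.sum_comm, Finset.sum_congr rfl (g := fun _ => 3), Finset.sum_const, smul_eq_mul,
    mul_comm]
  intro j hj
  have hji : j ≠ i := fun h => hi (h ▸ hj)
  rcases hd with rfl | rfl
  · exact h3 i j hji
  · exact h4 i j hji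

end StrandedGraph

namespace StrandedGraph

variable {G A B : StrandedGraph}

/-! ### Faces and boundary of a contraction -/

/-- Adjacency of half-edges with colours in `C` through open faces with both colours in `C`. -/
def BoundaryRel (G : StrandedGraph) (C : Finset (Fin 5))
    (a b : {a : G.HalfEdge // G.color a.1 ∈ C}) : Prop :=
  ∃ p q : G.Point, p.1.1 = a.1.1 ∧ q.1.1 = b.1.1 ∧ p.1.2 ∈ C ∧ q.1.2 ∈ C ∧
    Quot.mk G.FaceStep p = Quot.mk G.FaceStep q

theorem numBoundaryComponents_eq_card (G : StrandedGraph) :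
    G.numBoundaryComponents = Nat.card (Quot (G.BoundaryRel Finset.univ)) := by
  refine card_quot_eq (fun h => ⟨h, Finset.mem_univ _⟩) Subtype.val ?_ ?_ (fun _ => rfl)
    (fun _ => rfl)
  · rintro a b ⟨p, q, hp, hq, h⟩
    exact Quot.sound ⟨p, q, hp, hq, Finset.mem_univ _, Finset.mem_univ _, h⟩
  · rintro a b ⟨p, q, hp, hq, -, -, h⟩
    exact Quot.sound ⟨p, q, hp, hq, h⟩

theorem opp_ne_of_isEnd {e : G.Edge} {h : G.Flag} (H : G.IsEnd e h) : G.opp h ≠ h := by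
  rcases H with h | h <;> rw [h]
  · exact e.2
  · rw [G.opp_opp]; exact e.2.symm

namespace IsContraction

variable {e : A.Edge} {ι : B.Flag → A.Flag}

theorem opp_eq_iff (H : IsContraction A B e ι) (b : B.Flag) :
    A.opp (ι b) = ι b ↔ B.opp b = b := by
  rw [← H.opp]; exact H.injective.eq_iff

theorem mapPoint_injective (H : IsContraction A B e ι) :
    Function.Injective (mapPoint ι H.color) := fun _ _ h =>
  Subtype.ext (Prod.ext (H.injective (congrArg (fun r : A.Point => r.1.1) h))
    (congrArg (fun r : A.Point => r.1.2) h))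

theorem exists_point (H : IsContraction A B e ι) {p : A.Point} (hp : ¬ A.IsEnd e p.1.1) :
    ∃ b, mapPoint ι H.color b = p := by
  obtain ⟨b, hb⟩ := H.exists_flag hp
  exact ⟨⟨(b, p.1.2), by rw [H.color, hb]; exact p.2⟩, Subtype.ext (Prod.ext hb rfl)⟩

theorem strand_mapPoint (H : IsContraction A B e ι) (p : B.Point) :
    mapPoint ι H.color (B.strand p) = A.strand (mapPoint ι H.color p) :=
  Subtype.ext (Prod.ext (H.opp _) rfl)

theorem face_mapPoint (H : IsContraction A B e ι) {p q : B.Point}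
    (h : Quot.mk B.FaceStep p = Quot.mk B.FaceStep q) :
    Quot.mk A.FaceStep (mapPoint ι H.color p) = Quot.mk A.FaceStep (mapPoint ι H.color q) := by
  refine eq_of_quot_eq (fun p => Quot.mk A.FaceStep (mapPoint ι H.color p)) ?_ h
  rintro p q (rfl | rfl)
  · by_cases hp : A.IsEnd e (A.chord (mapPoint ι H.color p)).1.1
    · rw [H.chord_of_isEnd p hp, face_chord, face_strand, face_chord]
    · rw [H.chord_of_not_isEnd p hp, face_chord]
  · rw [H.strand_mapPoint, face_strand]

open Classical in
/-- The face of the contraction that a point of `A` belongs to after the removal of the ends of `e`;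
there is none for the points of the inner faces of `e`. -/
noncomputable def faceOf (H : IsContraction A B e ι) (p : A.Point) : Option B.Face :=
  if h : ∃ b : B.Point, mapPoint ι H.color b = p ∨
      (A.IsEnd e p.1.1 ∧ mapPoint ι H.color b = A.chord p)
    then some (Quot.mk _ h.choose) else none

theorem faceOf_mapPoint (H : IsContraction A B e ι) (b : B.Point) :
    H.faceOf (mapPoint ι H.color b) = some (Quot.mk _ b) := by
  have h : ∃ c : B.Point, mapPoint ι H.color c = mapPoint ι H.color b ∨
      (A.IsEnd e (mapPoint ι H.color b).1.1 ∧
        mapPoint ι H.color c = A.chord (mapPoint ι H.color b)) := ⟨b, Or.inl rfl⟩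
  refine (dif_pos h).trans ?_
  rcases h.choose_spec with h1 | h1
  · rw [H.mapPoint_injective h1]
  · exact absurd h1.1 (H.not_isEnd b.1.1)

theorem faceOf_of_isEnd (H : IsContraction A B e ι) {p : A.Point} (hp : A.IsEnd e p.1.1)
    {b : B.Point} (hb : mapPoint ι H.color b = A.chord p) :
    H.faceOf p = some (Quot.mk _ b) := by
  have h : ∃ c : B.Point, mapPoint ι H.color c = p ∨
      (A.IsEnd e p.1.1 ∧ mapPoint ι H.color c = A.chord p) := ⟨b, Or.inr ⟨hp, hb⟩⟩
  refine (dif_pos h).trans ?_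
  rcases h.choose_spec with h1 | h1
  · rw [← h1] at hp
    exact absurd hp (H.not_isEnd _)
  · rw [H.mapPoint_injective (h1.2.trans hb.symm)]

theorem faceOf_eq_none (H : IsContraction A B e ι) {p : A.Point} (hp : A.IsEnd e p.1.1)
    (hp' : A.IsEnd e (A.chord p).1.1) : H.faceOf p = none := by
  refine dif_neg ?_
  rintro ⟨b, h | h⟩
  · rw [← h] at hp; exact H.not_isEnd _ hp
  · rw [← h.2] at hp'; exact H.not_isEnd _ hp'

theorem faceOf_step (H : IsContraction A B e ι) {p q : A.Point} (h : A.FaceStep p q) :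
    H.faceOf p = H.faceOf q := by
  rcases h with rfl | rfl
  · by_cases hp : A.IsEnd e p.1.1 <;> by_cases hq : A.IsEnd e (A.chord p).1.1
    · rw [H.faceOf_eq_none hp hq, H.faceOf_eq_none hq (by rw [A.chord_chord]; exact hp)]
    · obtain ⟨b, hb⟩ := H.exists_point hq
      rw [H.faceOf_of_isEnd hp hb, ← hb, H.faceOf_mapPoint]
    · obtain ⟨b, hb⟩ := H.exists_point hp
      rw [H.faceOf_of_isEnd hq (b := b) (by rw [A.chord_chord, hb]), ← hb, H.faceOf_mapPoint]
    · obtain ⟨b, hb⟩ := H.exists_point hp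
      subst hb
      rw [← H.chord_of_not_isEnd b hq, H.faceOf_mapPoint, H.faceOf_mapPoint, face_chord]
  · by_cases hp : A.IsEnd e p.1.1
    · have hs : A.IsEnd e (A.strand p).1.1 := hp.opp
      by_cases hq : A.IsEnd e (A.chord p).1.1
      · have hq' : A.IsEnd e (A.chord (A.strand p)).1.1 :=
          (isEnd_chord_iff hs).2 (isInnerStrand_strand.2 ((isEnd_chord_iff hp).1 hq))
        rw [H.faceOf_eq_none hp hq, H.faceOf_eq_none hs hq']
      · have hq' : ¬ A.IsEnd e (A.chord (A.strand p)).1.1 := fun h =>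
          hq ((isEnd_chord_iff hp).2 (isInnerStrand_strand.1 ((isEnd_chord_iff hs).1 h)))
        obtain ⟨b, hb⟩ := H.exists_point hq
        obtain ⟨c, hc⟩ := H.exists_point hq'
        rw [H.faceOf_of_isEnd hp hb, H.faceOf_of_isEnd hs hc, ← face_chord b]
        have h1 := H.chord_of_isEnd b (by rw [hb, A.chord_chord]; exact hp)
        rw [hb, A.chord_chord, ← hc] at h1
        rw [H.mapPoint_injective h1]
    · obtain ⟨b, hb⟩ := H.exists_point hp
      rw [← hb, ← H.strand_mapPoint, H.faceOf_mapPoint, H.faceOf_mapPoint, face_strand]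

theorem face_mapPoint_iff (H : IsContraction A B e ι) {p q : B.Point} :
    Quot.mk A.FaceStep (mapPoint ι H.color p) = Quot.mk A.FaceStep (mapPoint ι H.color q) ↔
      Quot.mk B.FaceStep p = Quot.mk B.FaceStep q := by
  refine ⟨fun h => ?_, H.face_mapPoint⟩
  have h1 := eq_of_quot_eq H.faceOf (fun _ _ => H.faceOf_step) h
  rw [H.faceOf_mapPoint, H.faceOf_mapPoint] at h1
  exact Option.some_injective _ h1

/-- The face of `A` that contains a given face of the contraction. -/
def mapFace (H : IsContraction A B e ι) : B.Face → A.Face :=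
  Quot.lift (fun p => Quot.mk _ (mapPoint ι H.color p)) fun _ _ h => H.face_mapPoint (Quot.sound h)

theorem mapFace_injective (H : IsContraction A B e ι) : Function.Injective H.mapFace := by
  rintro ⟨p⟩ ⟨q⟩ h
  exact H.face_mapPoint_iff.1 h

theorem isOpenFace_mapFace (H : IsContraction A B e ι) (φ : B.Face) :
    A.IsOpenFace (H.mapFace φ) ↔ B.IsOpenFace φ := by
  refine ⟨?_, ?_⟩
  · rintro ⟨p, hp, hopen⟩
    obtain ⟨b, rfl⟩ := H.exists_point (p := p) fun h => opp_ne_of_isEnd h hopen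
    exact ⟨b, H.mapFace_injective hp, (H.opp_eq_iff _).1 hopen⟩
  · rintro ⟨b, rfl, hopen⟩
    exact ⟨mapPoint ι H.color b, rfl, (H.opp_eq_iff _).2 hopen⟩

theorem numHalfEdges_eq (H : IsContraction A B e ι) : A.numHalfEdges = B.numHalfEdges := by
  refine (Nat.card_congr (Equiv.ofBijective
    (fun b : B.HalfEdge => (⟨ι b.1, (H.opp_eq_iff _).2 b.2⟩ : A.HalfEdge)) ⟨?_, ?_⟩)).symm
  · exact fun b c h => Subtype.ext (H.injective (congrArg Subtype.val h))
  · rintro ⟨x, hx⟩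
    obtain ⟨b, rfl⟩ := H.exists_flag fun h => opp_ne_of_isEnd h hx
    exact ⟨⟨b, (H.opp_eq_iff _).1 hx⟩, rfl⟩

theorem numBoundaryEdges_eq (H : IsContraction A B e ι) :
    A.numBoundaryEdges = B.numBoundaryEdges := by
  refine (Nat.card_congr (Equiv.ofBijective
    (fun φ : {φ : B.Face // B.IsOpenFace φ} =>
      (⟨H.mapFace φ.1, (H.isOpenFace_mapFace _).2 φ.2⟩ : {φ : A.Face // A.IsOpenFace φ}))
    ⟨?_, ?_⟩)).symm
  · exact fun φ ψ h => Subtype.ext (H.mapFace_injective (congrArg Subtype.val h))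
  · rintro ⟨_, p, rfl, hp⟩
    obtain ⟨b, rfl⟩ := H.exists_point (p := p) fun h => opp_ne_of_isEnd h hp
    exact ⟨⟨Quot.mk _ b, b, rfl, (H.opp_eq_iff _).1 hp⟩, rfl⟩

/-- A contraction does not change the number of closed faces: the inner faces of `e` are replaced by
discs. -/
theorem numInternalFaces_eq (H : IsContraction A B e ι) :
    A.numInternalFaces = B.numInternalFaces := by
  -- The points `(x, j)`, `x` an end of `e`, on an inner strand form a face of their own.
  have inner_inv : ∀ (j : Fin 5) (p q : A.Point), A.FaceStep p q →
      (A.IsEnd e p.1.1 ∧ A.IsInnerStrand p ∧ p.1.2 = j ↔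
        A.IsEnd e q.1.1 ∧ A.IsInnerStrand q ∧ q.1.2 = j) := by
    have hs : ∀ (j : Fin 5) (p : A.Point), A.IsEnd e p.1.1 ∧ A.IsInnerStrand p ∧ p.1.2 = j →
        A.IsEnd e (A.strand p).1.1 ∧ A.IsInnerStrand (A.strand p) ∧ (A.strand p).1.2 = j :=
      fun j p h => ⟨h.1.opp, isInnerStrand_strand.2 h.2.1, h.2.2⟩
    have hc : ∀ (j : Fin 5) (p : A.Point), A.IsEnd e p.1.1 ∧ A.IsInnerStrand p ∧ p.1.2 = j →
        A.IsEnd e (A.chord p).1.1 ∧ A.IsInnerStrand (A.chord p) ∧ (A.chord p).1.2 = j :=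
      fun j p h => by
        have h1 : A.chord p = A.strand p := h.2.1
        rw [h1]; exact hs j p h
    rintro j p q (rfl | rfl)
    · exact ⟨hc j p, fun h => by simpa only [A.chord_chord] using hc j _ h⟩
    · exact ⟨hs j p, fun h => by simpa only [strand_strand] using hs j _ h⟩
  have closed_inner : ∀ p : A.Point, A.IsEnd e p.1.1 → A.IsInnerStrand p →
      ¬ A.IsOpenFace (Quot.mk _ p) := by
    rintro p hp hin ⟨q, hq, hopen⟩
    have h1 := (iff_of_quot_eq _ (inner_inv p.1.2) hq).2 ⟨hp, hin, rfl⟩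
    exact opp_ne_of_isEnd h1.1 hopen
  let f : {φ : B.Face // ¬ B.IsOpenFace φ} ⊕ {p : A.Point // p.1.1 = e.1 ∧ A.IsInnerStrand p} →
      {φ : A.Face // ¬ A.IsOpenFace φ} :=
    Sum.elim (fun φ => ⟨H.mapFace φ.1, fun h => φ.2 ((H.isOpenFace_mapFace _).1 h)⟩)
      (fun p => ⟨Quot.mk _ p.1, closed_inner p.1 (Or.inl p.2.1) p.2.2⟩)
  have hdisj : ∀ (φ : B.Face) (p : A.Point), p.1.1 = e.1 → A.IsInnerStrand p →
      H.mapFace φ ≠ Quot.mk _ p := by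
    rintro ⟨b⟩ p hp hin h
    have h1 := (iff_of_quot_eq _ (inner_inv p.1.2) h).2 ⟨Or.inl hp, hin, rfl⟩
    exact H.not_isEnd _ h1.1
  have hf : Function.Bijective f := by
    refine ⟨?_, ?_⟩
    · rintro (φ | p) (ψ | q) h <;> have h' := congrArg Subtype.val h
      · exact congrArg _ (Subtype.ext (H.mapFace_injective h'))
      · exact absurd h' (hdisj φ.1 q.1 q.2.1 q.2.2)
      · exact absurd h'.symm (hdisj ψ.1 p.1 p.2.1 p.2.2)
      · have h1 := (iff_of_quot_eq _ (inner_inv p.1.1.2) h').1 ⟨Or.inl p.2.1, p.2.2, rfl⟩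
        exact congrArg _ (Subtype.ext (Subtype.ext
          (Prod.ext (p.2.1.trans q.2.1.symm) h1.2.2.symm)))
    · rintro ⟨⟨p⟩, hφ⟩
      by_cases hp : A.IsEnd e p.1.1
      · by_cases hq : A.IsEnd e (A.chord p).1.1
        · have hin := (isEnd_chord_iff hp).1 hq
          obtain ⟨hj, h | h⟩ := isEnd_cases hp
          · exact ⟨Sum.inr ⟨p, congrArg (fun r : A.Point => r.1.1) h, hin⟩, rfl⟩
          · refine ⟨Sum.inr ⟨⟨(e.1, p.1.2), hj⟩, rfl, ?_⟩, Subtype.ext ?_⟩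
            · rw [h] at hin
              exact isInnerStrand_strand.1 hin
            · exact (face_strand _).symm.trans (congrArg (Quot.mk A.FaceStep) h.symm)
        · obtain ⟨b, hb⟩ := H.exists_point hq
          have h1 : H.mapFace (Quot.mk _ b) = Quot.mk _ p :=
            (congrArg (Quot.mk A.FaceStep) hb).trans (face_chord p)
          exact ⟨Sum.inl ⟨Quot.mk _ b, fun h => hφ (by
            have := (H.isOpenFace_mapFace _).2 h
            rwa [h1] at this)⟩, Subtype.ext h1⟩
      · obtain ⟨b, rfl⟩ := H.exists_point hp
        exact ⟨Sum.inl ⟨Quot.mk _ b, fun h => hφ ((H.isOpenFace_mapFace _).2 h)⟩, rfl⟩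
  rw [numInternalFaces, numInternalFaces, ← Nat.card_congr (Equiv.ofBijective f hf), Nat.card_sum,
    H.discs, innerCount]
  ring

theorem card_quot_boundaryRel (H : IsContraction A B e ι) (C : Finset (Fin 5)) :
    Nat.card (Quot (A.BoundaryRel C)) = Nat.card (Quot (B.BoundaryRel C)) := by
  let f : {b : B.HalfEdge // B.color b.1 ∈ C} → {a : A.HalfEdge // A.color a.1 ∈ C} := fun b =>
    ⟨⟨ι b.1.1, (H.opp_eq_iff _).2 b.1.2⟩, H.color b.1.1 ▸ b.2⟩
  have hsurj : ∀ a, ∃ b, f b = a := by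
    rintro ⟨⟨x, hx⟩, hxC⟩
    obtain ⟨b, rfl⟩ := H.exists_flag fun h => opp_ne_of_isEnd h hx
    exact ⟨⟨⟨b, (H.opp_eq_iff _).1 hx⟩, (H.color b).symm ▸ hxC⟩, rfl⟩
  have hinj : Function.Injective f := fun b c h =>
    Subtype.ext (Subtype.ext (H.injective (congrArg (fun a => a.1.1) h)))
  have hrel : ∀ b c, A.BoundaryRel C (f b) (f c) ↔ B.BoundaryRel C b c := by
    intro b c
    constructor
    · rintro ⟨p, q, hp, hq, hpC, hqC, h⟩
      obtain ⟨p', rfl⟩ := H.exists_point (p := p) (by rw [hp]; exact H.not_isEnd _)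
      obtain ⟨q', rfl⟩ := H.exists_point (p := q) (by rw [hq]; exact H.not_isEnd _)
      exact ⟨p', q', H.injective hp, H.injective hq, hpC, hqC, H.face_mapPoint_iff.1 h⟩
    · rintro ⟨p, q, hp, hq, hpC, hqC, h⟩
      exact ⟨mapPoint ι H.color p, mapPoint ι H.color q, congrArg ι hp, congrArg ι hq, hpC, hqC,
        H.face_mapPoint h⟩
  choose g hg using hsurj
  refine card_quot_eq g f ?_ ?_ (fun a => by rw [hg]) (fun b => by rw [hinj (hg (f b))])
  · intro a b h
    refine Quot.sound ((hrel _ _).1 ?_)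
    rwa [hg, hg]
  · exact fun b c h => Quot.sound ((hrel _ _).2 h)

theorem numBoundaryComponents_eq (H : IsContraction A B e ι) :
    A.numBoundaryComponents = B.numBoundaryComponents := by
  rw [numBoundaryComponents_eq_card, numBoundaryComponents_eq_card, H.card_quot_boundaryRel]

theorem numBoundaryFaces_eq (H : IsContraction A B e ι) :
    A.numBoundaryFaces = B.numBoundaryFaces :=
  Finset.sum_congr rfl fun C _ => H.card_quot_boundaryRel C

end IsContraction

end StrandedGraph

namespace StrandedGraph

variable {G A : StrandedGraph}

/-! ### Cutting a bridge -/

theorem quot_adj_of_face {p q : G.Point} (h : Quot.mk G.FaceStep p = Quot.mk G.FaceStep q) :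
    Quot.mk G.Adj p.1.1 = Quot.mk G.Adj q.1.1 := by
  refine eq_of_quot_eq (fun p : G.Point => Quot.mk G.Adj p.1.1) ?_ h
  rintro p q (rfl | rfl)
  · exact Quot.sound (Or.inl ⟨p, rfl, rfl⟩)
  · exact Quot.sound (Or.inr rfl)

theorem pair_of_face {p q : G.Point} (h : Quot.mk G.FaceStep p = Quot.mk G.FaceStep q) :
    pairOfColors G.color p = pairOfColors G.color q := by
  refine eq_of_quot_eq (pairOfColors G.color) ?_ h
  rintro p q (rfl | rfl)
  · exact (G.chord_pair p).symm
  · exact (pair_strand p).symm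

theorem color_mem_of_face {C : Finset (Fin 5)} {p q : G.Point}
    (h : Quot.mk G.FaceStep p = Quot.mk G.FaceStep q) (h1 : G.color p.1.1 ∈ C) (h2 : p.1.2 ∈ C) :
    G.color q.1.1 ∈ C ∧ q.1.2 ∈ C := by
  have h3 := pair_of_face h
  rw [pairOfColors, pairOfColors, Sym2.eq_iff] at h3
  rcases h3 with h3 | h3 <;> rw [← h3.1, ← h3.2]
  · exact ⟨h1, h2⟩
  · exact ⟨h2, h1⟩

/-- In an oriented graph, an open face passes through at least two half-edges. -/
theorem Orientation.exists_other_end (o : G.Orientation) {p : G.Point} (hp : G.opp p.1.1 = p.1.1) :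
    ∃ q : G.Point, G.opp q.1.1 = q.1.1 ∧ q.1.1 ≠ p.1.1 ∧
      Quot.mk G.FaceStep q = Quot.mk G.FaceStep p := by
  classical
  have := Fintype.ofFinite (FrontierPoint fun a : G.HalfEdge => G.color a.1)
  by_contra hno
  push Not at hno
  let p₀ : FrontierPoint fun a : G.HalfEdge => G.color a.1 := ⟨(⟨p.1.1, hp⟩, p.1.2), p.2⟩
  have h1 := o.sum_charge_halfPoint (G.color p.1.1) p.1.2 {Quot.mk G.FaceStep p}
  rw [Finset.sum_eq_single p₀] at h1
  · have h2 := o.sign_ne p.1.1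
    have h3 := p.2
    refine h2 ?_
    simpa [pointCharge, p₀, h3, h3.symm] using h1
  · intro q hq hne
    rw [Finset.mem_filter] at hq
    have hq2 : Quot.mk G.FaceStep (halfPoint q) = Quot.mk G.FaceStep p := hq.2
    by_cases hqp : q.1.1.1 = p.1.1
    · refine absurd (Subtype.ext (Prod.ext (Subtype.ext hqp) ?_)) hne
      exact snd_eq_of_pair (p := halfPoint q) (congrArg G.color hqp) (pair_of_face hq2)
    · exact absurd hq2 (hno (halfPoint q) q.1.1.2 hqp)
  · exact fun h => (h (Finset.mem_filter.2 ⟨Finset.mem_univ _, Set.mem_singleton _⟩)).elim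

theorem mem_edges {ε : Sym2 G.Flag} : ε ∈ G.edges ↔ ∃ h, G.opp h ≠ h ∧ ε = s(h, G.opp h) := by
  simp [edges]

theorem mk_eq_mk_iff_isEnd {e : G.Edge} {h : G.Flag} :
    s(h, G.opp h) = s(e.1, G.opp e.1) ↔ G.IsEnd e h := by
  rw [Sym2.eq_iff]
  refine ⟨fun h => h.imp And.left And.left, ?_⟩
  rintro (rfl | rfl)
  · exact Or.inl ⟨rfl, rfl⟩
  · exact Or.inr ⟨rfl, G.opp_opp _⟩

theorem cut_opp_of_isEnd {e : A.Edge} {h : A.Flag} (hh : A.IsEnd e h) : (A.cut e).opp h = h := by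
  classical
  refine (cSubgraph_opp _ h).trans (if_neg ?_)
  rw [mk_eq_mk_iff_isEnd.2 hh]
  exact Finset.notMem_erase _ _

theorem cut_opp_of_not_isEnd {e : A.Edge} {h : A.Flag} (hh : ¬ A.IsEnd e h) :
    (A.cut e).opp h = A.opp h := by
  classical
  refine (cSubgraph_opp _ h).trans ?_
  by_cases h1 : A.opp h = h
  · rw [h1, ite_self]
  · exact if_pos (Finset.mem_erase.2 ⟨fun h2 => hh (mk_eq_mk_iff_isEnd.1 h2),
      mem_edges.2 ⟨h, h1, rfl⟩⟩)

theorem cut_halfEdge_iff {e : A.Edge} {h : A.Flag} :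
    (A.cut e).opp h = h ↔ A.IsEnd e h ∨ A.opp h = h := by
  by_cases hh : A.IsEnd e h
  · exact ⟨fun _ => Or.inl hh, fun _ => cut_opp_of_isEnd hh⟩
  · rw [cut_opp_of_not_isEnd hh]
    exact ⟨Or.inr, fun h => h.resolve_left hh⟩

theorem cut_strand_of_isEnd {e : A.Edge} {p : A.Point} (hp : A.IsEnd e p.1.1) :
    (A.cut e).strand p = p :=
  Subtype.ext (Prod.ext (cut_opp_of_isEnd hp) rfl)

theorem cut_strand_of_not_isEnd {e : A.Edge} {p : A.Point} (hp : ¬ A.IsEnd e p.1.1) :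
    (A.cut e).strand p = A.strand p :=
  Subtype.ext (Prod.ext (cut_opp_of_not_isEnd hp) rfl)

section

variable {e : A.Edge}

/-- One step along a face of the cut graph. -/
def CutStep (A : StrandedGraph) (e : A.Edge) : A.Point → A.Point → Prop := (A.cut e).FaceStep

/-- Adjacency in the cut graph. -/
def CutAdj (A : StrandedGraph) (e : A.Edge) : A.Flag → A.Flag → Prop := (A.cut e).Adj

theorem face_of_cut_face {p q : A.Point}
    (h : Quot.mk (A.CutStep e) p = Quot.mk (A.CutStep e) q) :
    Quot.mk A.FaceStep p = Quot.mk A.FaceStep q := by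
  refine eq_of_quot_eq (fun p : A.Point => Quot.mk A.FaceStep p) ?_ h
  intro p q h
  by_cases hp : A.IsEnd e p.1.1
  · rcases h with h | h
    · exact Quot.sound (Or.inl h)
    · rw [← (cut_strand_of_isEnd hp).symm.trans h]
  · rcases h with h | h
    · exact Quot.sound (Or.inl h)
    · exact Quot.sound (Or.inr ((cut_strand_of_not_isEnd hp).symm.trans h))

/-- A bridge separates its two ends in the cut graph. -/
theorem IsBridge.quot_ne (hb : A.IsBridge e) {x y : A.Flag} (hx : A.IsEnd e x) (hy : A.IsEnd e y)
    (hxy : x ≠ y) : Quot.mk (A.CutAdj e) x ≠ Quot.mk (A.CutAdj e) y := by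
  intro h
  have h := quot_eq_iff_eqvGen.1 h
  rcases hx with rfl | rfl <;> rcases hy with rfl | rfl
  · exact hxy rfl
  · exact hb h
  · exact hb (h.symm _ _)
  · exact hxy rfl

theorem not_isLoop_of_isBridge (hb : A.IsBridge e) : ¬ A.IsLoop e := fun h =>
  hb (h.mono fun _ _ h => Or.inl h)

/-- The point `j` of the first pre-edge of `e`. -/
def endPoint (e : A.Edge) (j : {j : Fin 5 // j ≠ A.color e.1}) : A.Point := ⟨(e.1, j.1), j.2⟩

theorem card_ne (i : Fin 5) : Nat.card {j : Fin 5 // j ≠ i} = 4 := by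
  rw [Nat.card_eq_fintype_card, Fintype.card_subtype_compl]; simp

theorem IsBridge.endPoint_ne (hb : A.IsBridge e) (j k : {j : Fin 5 // j ≠ A.color e.1}) :
    Quot.mk (A.CutStep e) (endPoint e j) ≠
      Quot.mk (A.CutStep e) (A.strand (endPoint e k)) := fun h =>
  hb.quot_ne (isEnd_fst e) (isEnd_snd e) e.2.symm (quot_adj_of_face (G := A.cut e) h)

theorem endPoint_inj (j k : {j : Fin 5 // j ≠ A.color e.1})
    (h : Quot.mk (A.CutStep e) (endPoint e j) =
      Quot.mk (A.CutStep e) (endPoint e k)) : j = k :=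
  Subtype.ext (snd_eq_of_pair (p := endPoint e j) (q := endPoint e k) rfl
    (pair_of_face (G := A.cut e) h))

theorem strand_endPoint_inj (j k : {j : Fin 5 // j ≠ A.color e.1})
    (h : Quot.mk (A.CutStep e) (A.strand (endPoint e j)) =
      Quot.mk (A.CutStep e) (A.strand (endPoint e k))) : j = k :=
  Subtype.ext (snd_eq_of_pair (p := A.strand (endPoint e j)) (q := A.strand (endPoint e k)) rfl
    (pair_of_face (G := A.cut e) h))

theorem isEnd_point {p : A.Point} (hp : A.IsEnd e p.1.1) :
    ∃ j, p = endPoint e j ∨ p = A.strand (endPoint e j) :=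
  let ⟨hj, h⟩ := isEnd_cases hp
  ⟨⟨p.1.2, hj⟩, h⟩

theorem faceStep_cut_or {p q : A.Point} (h : A.FaceStep p q) :
    Quot.mk (A.CutStep e) p = Quot.mk (A.CutStep e) q ∨
      ∃ j, (Quot.mk (A.CutStep e) p = Quot.mk (A.CutStep e) (endPoint e j) ∧
          Quot.mk (A.CutStep e) q = Quot.mk (A.CutStep e) (A.strand (endPoint e j))) ∨
        (Quot.mk (A.CutStep e) p = Quot.mk (A.CutStep e) (A.strand (endPoint e j)) ∧
          Quot.mk (A.CutStep e) q = Quot.mk (A.CutStep e) (endPoint e j)) := by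
  rcases h with h | rfl
  · exact Or.inl (Quot.sound (Or.inl h))
  · by_cases hp : A.IsEnd e p.1.1
    · obtain ⟨j, rfl | rfl⟩ := isEnd_point hp
      · exact Or.inr ⟨j, Or.inl ⟨rfl, rfl⟩⟩
      · exact Or.inr ⟨j, Or.inr ⟨rfl, congrArg _ (strand_strand _)⟩⟩
    · exact Or.inl (Quot.sound (Or.inr (cut_strand_of_not_isEnd hp)))

/-- Points on one face of `A` that are on different faces of the cut graph are on faces that pass
through the ends of the bridge. -/
theorem IsBridge.cut_face_or (hb : A.IsBridge e) {p q : A.Point}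
    (h : Quot.mk A.FaceStep p = Quot.mk A.FaceStep q) :
    Quot.mk (A.CutStep e) p = Quot.mk (A.CutStep e) q ∨
      ∃ x y : A.Point, A.IsEnd e x.1.1 ∧ A.IsEnd e y.1.1 ∧
        Quot.mk (A.CutStep e) p = Quot.mk (A.CutStep e) x ∧
        Quot.mk (A.CutStep e) q = Quot.mk (A.CutStep e) y := by
  refine (quot_eq_of_link (r := (A.CutStep e)) (a := endPoint e)
    (b := fun j => A.strand (endPoint e j)) strand_endPoint_inj hb.endPoint_ne endPoint_inj
    (fun _ _ => faceStep_cut_or) h).imp id ?_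
  rintro ⟨j, h1 | h1, h2 | h2⟩
  · exact ⟨_, _, isEnd_fst e, isEnd_fst e, h1, h2⟩
  · exact ⟨_, _, isEnd_fst e, isEnd_snd e, h1, h2⟩
  · exact ⟨_, _, isEnd_snd e, isEnd_fst e, h1, h2⟩
  · exact ⟨_, _, isEnd_snd e, isEnd_snd e, h1, h2⟩

theorem IsBridge.card_face_cut (hb : A.IsBridge e) :
    Nat.card (A.cut e).Face = Nat.card A.Face + 4 := by
  rw [← card_ne (A.color e.1)]
  exact card_quot_link (α := A.Point) (r := (A.CutStep e)) (a := endPoint e)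
    (b := fun j => A.strand (endPoint e j)) strand_endPoint_inj hb.endPoint_ne
    (fun _ _ h => face_of_cut_face (e := e) (Quot.sound h)) (fun j => (face_strand _).symm)
    (fun _ _ => faceStep_cut_or)

/-- The face of `A` that contains a given face of the cut graph. -/
def cutFace (e : A.Edge) : (A.cut e).Face → A.Face :=
  Quot.lift (fun p : A.Point => Quot.mk A.FaceStep p)
    fun _ _ h => face_of_cut_face (e := e) (Quot.sound h)

/-- The face of the cut graph through an end of the bridge passes through another half-edge. -/
theorem IsBridge.exists_halfEdge (hb : A.IsBridge e) (o : A.Orientation) {p : A.Point}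
    (hp : A.IsEnd e p.1.1) : ∃ q : A.Point, A.opp q.1.1 = q.1.1 ∧ ¬ A.IsEnd e q.1.1 ∧
      Quot.mk (A.CutStep e) q = Quot.mk (A.CutStep e) p := by
  obtain ⟨q, hq, hqp, h⟩ := (o.cSubgraph _ : (A.cut e).Orientation).exists_other_end
    (p := p) (cut_opp_of_isEnd hp)
  have hqe : ¬ A.IsEnd e q.1.1 := fun hqe =>
    hb.quot_ne hqe hp hqp (quot_adj_of_face (G := A.cut e) h)
  exact ⟨q, (cut_halfEdge_iff.1 hq).resolve_left hqe, hqe, h⟩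

theorem IsBridge.isOpenFace_cutFace (hb : A.IsBridge e) (o : A.Orientation) (φ : (A.cut e).Face) :
    A.IsOpenFace (cutFace e φ) ↔ (A.cut e).IsOpenFace φ := by
  refine ⟨?_, ?_⟩
  · obtain ⟨p, rfl⟩ := Quot.exists_rep φ
    rintro ⟨q, hq, hopen⟩
    rcases hb.cut_face_or hq with h | ⟨x, y, hx, hy, h1, h2⟩
    · exact ⟨q, h, cut_halfEdge_iff.2 (Or.inr hopen)⟩
    · exact ⟨y, h2.symm, cut_opp_of_isEnd hy⟩
  · rintro ⟨p, rfl, hopen⟩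
    rcases cut_halfEdge_iff.1 hopen with h | h
    · obtain ⟨q, hq, -, hqp⟩ := hb.exists_halfEdge o h
      exact ⟨q, face_of_cut_face hqp, hq⟩
    · exact ⟨p, rfl, h⟩

theorem IsBridge.numInternalFaces_cut (hb : A.IsBridge e) (o : A.Orientation) :
    (A.cut e).numInternalFaces = A.numInternalFaces := by
  change _ + A.discs = _ + A.discs
  congr 1
  refine Nat.card_congr (Equiv.ofBijective
    (fun φ : {φ : (A.cut e).Face // ¬ (A.cut e).IsOpenFace φ} =>
      (⟨cutFace e φ.1, fun h => φ.2 ((hb.isOpenFace_cutFace o _).1 h)⟩ :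
        {φ : A.Face // ¬ A.IsOpenFace φ})) ⟨?_, ?_⟩)
  · rintro ⟨φ, hφ⟩ ⟨ψ, hψ⟩ h
    obtain ⟨p, rfl⟩ := Quot.exists_rep φ
    obtain ⟨q, rfl⟩ := Quot.exists_rep ψ
    apply Subtype.ext
    rcases hb.cut_face_or (congrArg Subtype.val h) with h | ⟨x, y, hx, hy, h1, h2⟩
    · exact h
    · exact absurd ⟨x, h1.symm, cut_opp_of_isEnd hx⟩ hφ
  · rintro ⟨φ, hφ⟩
    obtain ⟨p, rfl⟩ := Quot.exists_rep φ
    exact ⟨⟨Quot.mk (A.CutStep e) p, fun h => hφ ((hb.isOpenFace_cutFace o _).2 h)⟩, rfl⟩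

theorem card_face (G : StrandedGraph) : Nat.card G.Face =
    G.numBoundaryEdges + Nat.card {φ : G.Face // ¬ G.IsOpenFace φ} := by
  classical
  rw [← Nat.card_congr (Equiv.sumCompl G.IsOpenFace), Nat.card_sum, numBoundaryEdges]

theorem IsBridge.numBoundaryEdges_cut (hb : A.IsBridge e) (o : A.Orientation) :
    (A.cut e).numBoundaryEdges = A.numBoundaryEdges + 4 := by
  have h1 : _ + A.discs = _ + A.discs := hb.numInternalFaces_cut o
  have h2 := hb.card_face_cut
  rw [card_face, card_face] at h2
  omega

theorem numHalfEdges_cut (e : A.Edge) : (A.cut e).numHalfEdges = A.numHalfEdges + 2 := by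
  classical
  have h1 : Nat.card {h : A.Flag // A.IsEnd e h} = 2 := by
    rw [Nat.subtype_card {e.1, A.opp e.1} (fun h => by simp [IsEnd])]
    exact Finset.card_pair e.2.symm
  have h2 : Nat.card {h : A.Flag // A.opp h = h ∨ A.IsEnd e h} =
      Nat.card {h : A.Flag // A.opp h = h} + Nat.card {h : A.Flag // A.IsEnd e h} := by
    rw [← Nat.card_sum]
    exact Nat.card_congr (subtypeOrEquiv _ _ (Pi.disjoint_iff.2 fun h => by
      rw [Prop.disjoint_iff, not_and]
      exact fun h1 h2 => opp_ne_of_isEnd h2 h1))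
  rw [h1] at h2
  rw [numHalfEdges, numHalfEdges, ← h2]
  exact Nat.card_congr (Equiv.subtypeEquivRight fun h => (cut_halfEdge_iff).trans or_comm)

/-! ### Components and bubbles of a cut graph -/

theorem adj_or_eq_of_cut {x y : A.Flag} (h : (A.CutAdj e) x y) :
    A.Adj x y ∨ x = y := by
  rcases h with h | h
  · exact Or.inl (Or.inl h)
  · by_cases hx : A.IsEnd e x
    · exact Or.inr ((cut_opp_of_isEnd hx).symm.trans h)
    · exact Or.inl (Or.inr ((cut_opp_of_not_isEnd hx).symm.trans h))

theorem numComponents_cut_of_not_isBridge (hb : ¬ A.IsBridge e) :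
    (A.cut e).numComponents = A.numComponents := by
  change _ + A.discs = _ + A.discs
  congr 1
  have hb : Quot.mk (A.CutAdj e) e.1 = Quot.mk (A.CutAdj e) (A.opp e.1) :=
    quot_eq_iff_eqvGen.2 (not_not.1 hb)
  refine card_quot_eq (α := A.Flag) (β := A.Flag) id id ?_ ?_ (fun _ => rfl) (fun _ => rfl)
  · intro x y h
    rcases adj_or_eq_of_cut h with h | rfl
    · exact Quot.sound h
    · rfl
  · rintro x y (h | rfl)
    · exact Quot.sound (Or.inl h)
    · by_cases hx : A.IsEnd e x
      · rcases hx with rfl | rfl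
        · exact hb
        · simp only [id, A.opp_opp]; exact hb.symm
      · exact Quot.sound (Or.inr (cut_opp_of_not_isEnd hx))

theorem IsBridge.card_quot_bubbleRel_cut (hb : A.IsBridge e) (C : Finset (Fin 5)) :
    Nat.card (Quot ((A.cut e).BubbleRel (A.cut e).EdgeRel C)) =
      Nat.card (Quot (A.BubbleRel A.EdgeRel C)) + if A.color e.1 ∈ C then 1 else 0 := by
  have hdown : ∀ x y : {h : A.Flag // A.color h ∈ C},
      (A.cut e).BubbleRel (A.cut e).EdgeRel C x y →
        Quot.mk (A.BubbleRel A.EdgeRel C) x = Quot.mk (A.BubbleRel A.EdgeRel C) y := by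
    rintro x y (h | h)
    · exact Quot.sound (Or.inl h)
    · by_cases hx : A.IsEnd e x.1
      · rw [Subtype.ext ((cut_opp_of_isEnd hx).symm.trans h)]
      · exact Quot.sound (Or.inr ((cut_opp_of_not_isEnd hx).symm.trans h))
  by_cases he : A.color e.1 ∈ C
  · rw [if_pos he]
    refine (card_quot_link (J := Unit) (α := {h : A.Flag // A.color h ∈ C})
      (r := (A.cut e).BubbleRel (A.cut e).EdgeRel C) (r' := A.BubbleRel A.EdgeRel C)
      (a := fun _ => ⟨e.1, he⟩) (b := fun _ => ⟨A.opp e.1, (A.opp_color e.1).symm ▸ he⟩)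
      (fun _ _ _ => rfl) ?_ hdown ?_ ?_).trans (by rw [Nat.card_unique (α := Unit)])
    · intro _ _ h
      refine hb.quot_ne (isEnd_fst e) (isEnd_snd e) e.2.symm (eq_of_quot_eq
        (fun x : {h : A.Flag // A.color h ∈ C} => Quot.mk (A.CutAdj e) x.1) ?_ h)
      rintro x y (⟨p, -, hp, hp'⟩ | h)
      · exact Quot.sound (Or.inl ⟨p, hp, hp'⟩)
      · exact Quot.sound (Or.inr h)
    · exact fun _ => (IsContraction.quot_bubbleRel_edgeRel he).symm
    · rintro ⟨x, hx⟩ ⟨y, hy⟩ (h | h)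
      · exact Or.inl (Quot.sound (Or.inl h))
      · have h' : A.opp x = y := h
        by_cases hxe : A.IsEnd e x
        · rcases hxe with rfl | rfl
          · subst h'
            exact Or.inr ⟨(), Or.inl ⟨rfl, rfl⟩⟩
          · rw [A.opp_opp] at h'
            subst h'
            exact Or.inr ⟨(), Or.inr ⟨rfl, rfl⟩⟩
        · exact Or.inl (Quot.sound (Or.inr ((cut_opp_of_not_isEnd hxe).trans h')))
  · rw [if_neg he, add_zero]
    refine card_quot_eq (α := {h : A.Flag // A.color h ∈ C}) (β := {h : A.Flag // A.color h ∈ C})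
      id id hdown ?_ (fun _ => rfl) (fun _ => rfl)
    rintro x y (h | h)
    · exact Quot.sound (Or.inl h)
    · have hx : ¬ A.IsEnd e x.1 := fun hx => he (hx.color_eq ▸ x.2)
      exact Quot.sound (Or.inr ((cut_opp_of_not_isEnd hx).trans h))

theorem IsBridge.numComponents_cut (hb : A.IsBridge e) :
    (A.cut e).numComponents = A.numComponents + 1 := by
  change _ + A.discs = _ + A.discs + 1
  have h := hb.card_quot_bubbleRel_cut Finset.univ
  rw [if_pos (Finset.mem_univ _), ← card_quot_adj, ← card_quot_adj] at h
  omega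

theorem IsBridge.numBubbles_cut (hb : A.IsBridge e) (d : ℕ) :
    (A.cut e).numBubbles d = A.numBubbles d +
      ∑ C ∈ Finset.powersetCard d (Finset.univ : Finset (Fin 5)),
        if A.color e.1 ∈ C then 1 else 0 := by
  rw [numBubbles, numBubbles, ← Finset.sum_add_distrib]
  exact Finset.sum_congr rfl fun C _ => hb.card_quot_bubbleRel_cut C

end

end StrandedGraph

namespace StrandedGraph

variable {G A : StrandedGraph} {e : A.Edge} {C : Finset (Fin 5)}

/-! ### The boundary graph of a cut bridge -/

/-- The half-edges with colour in `C` of the cut graph. -/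
abbrev CutHalfEdge (A : StrandedGraph) (e : A.Edge) (C : Finset (Fin 5)) : Type :=
  {a : {h : A.Flag // (A.cut e).opp h = h} // A.color a.1 ∈ C}

/-- Adjacency of half-edges in the boundary of the cut graph. -/
def CutBoundaryRel (A : StrandedGraph) (e : A.Edge) (C : Finset (Fin 5))
    (a b : A.CutHalfEdge e C) : Prop :=
  ∃ p q : A.Point, p.1.1 = a.1.1 ∧ q.1.1 = b.1.1 ∧ p.1.2 ∈ C ∧ q.1.2 ∈ C ∧
    Quot.mk (A.CutStep e) p = Quot.mk (A.CutStep e) q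

/-- A half-edge of `A`, seen in the cut graph. -/
def toCutHalfEdge (b : {a : A.HalfEdge // A.color a.1 ∈ C}) : A.CutHalfEdge e C :=
  ⟨⟨b.1.1, cut_halfEdge_iff.2 (Or.inr b.1.2)⟩, b.2⟩

theorem toCutHalfEdge_injective :
    Function.Injective (toCutHalfEdge : _ → A.CutHalfEdge e C) := fun _ _ h =>
  Subtype.ext (Subtype.ext (congrArg (fun x : A.CutHalfEdge e C => x.1.1) h))

theorem isEnd_or_toCutHalfEdge (x : A.CutHalfEdge e C) :
    A.IsEnd e x.1.1 ∨ ∃ b, toCutHalfEdge b = x :=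
  (cut_halfEdge_iff.1 x.1.2).imp id fun h => ⟨⟨⟨x.1.1, h⟩, x.2⟩, rfl⟩

theorem not_isEnd_toCutHalfEdge (b : {a : A.HalfEdge // A.color a.1 ∈ C}) :
    ¬ A.IsEnd e b.1.1 := fun h => opp_ne_of_isEnd h b.1.2

/-- The half-edge `c` is adjacent, in the boundary of the cut graph, to an end of `e`. -/
def BoundaryHangs (A : StrandedGraph) (e : A.Edge) (C : Finset (Fin 5))
    (c : {a : A.HalfEdge // A.color a.1 ∈ C}) : Prop :=
  ∃ p q : A.Point, A.IsEnd e p.1.1 ∧ q.1.1 = c.1.1 ∧ p.1.2 ∈ C ∧ q.1.2 ∈ C ∧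
    Quot.mk (A.CutStep e) p = Quot.mk (A.CutStep e) q

/-- Whatever is adjacent to an end of a bridge in the boundary of the cut graph is connected in the
boundary of `A`. As for vertices, this comes from the orientation: removing a half-edge does not
disconnect its boundary component. -/
theorem IsBridge.card_boundaryHangs (hb : A.IsBridge e) (o : A.Orientation)
    (he : A.color e.1 ∈ C) (hC : ∃ j ∈ C, j ≠ A.color e.1) :
    Nat.card {q : Quot (A.BoundaryRel C) // ∃ c, A.BoundaryHangs e C c ∧ Quot.mk _ c = q} = 1 := by
  classical
  obtain ⟨j, hj, hj₀⟩ := hC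
  let H : Type := (A.cut e).HalfEdge
  let col : H → Fin 5 := fun a => A.color a.1
  have := Fintype.ofFinite (FrontierPoint col)
  let hp (p : FrontierPoint col) : A.Point := halfPoint (G := A.cut e) p
  let o' : (A.cut e).Orientation := o.cSubgraph _
  let h₀ : H := ⟨e.1, cut_opp_of_isEnd (isEnd_fst e)⟩
  obtain ⟨n', hn, hne, hnp⟩ := hb.exists_halfEdge o (p := ⟨(e.1, j), hj₀⟩) (isEnd_fst e)
  have hnC := color_mem_of_face (face_of_cut_face hnp).symm he hj
  let n : {a : A.HalfEdge // A.color a.1 ∈ C} := ⟨⟨n'.1.1, hn⟩, hnC.1⟩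
  -- `K` is the part of the component of `e.1` in the cut graph, without `e.1`, that is connected to `n`
  -- in the boundary of `A`. The other end of `e` is in another component, as `e` is a bridge.
  let K : Set H := {x | ∃ b : {a : A.HalfEdge // A.color a.1 ∈ C}, b.1.1 = x.1 ∧
    Quot.mk (A.BoundaryRel C) b = Quot.mk _ n ∧
    Quot.mk (A.CutAdj e) b.1.1 = Quot.mk (A.CutAdj e) e.1}
  have key : ∀ k (hk₀ : k ≠ A.color e.1), k ∈ C → ∃ p : FrontierPoint col, p.1.1 ∈ K ∧
      col p.1.1 ∈ C ∧ p.1.2 ∈ C ∧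
      Quot.mk (A.CutStep e) (hp p) = Quot.mk (A.CutStep e) ⟨(e.1, k), hk₀⟩ := by
    intro k hk₀ hk
    refine exists_strand_of_balanced (h₀ := h₀) (sign := fun a : H => o'.sign a.1) (fun p => Quot.mk (A.CutStep e) (hp p))
      (fun c d Φ inst => @Orientation.sum_charge_halfPoint _ o' this c d Φ inst) C he (o.sign_ne _) ?_ ?_ hj hk hj₀ hk₀ ?_
    · rintro ⟨b, hbe, -⟩
      exact not_isEnd_toCutHalfEdge b (Or.inl hbe)
    · rintro p q hpq ⟨b, hbp, hbn, hbe⟩ - hpC hqC hqC' hq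
      have hqe : Quot.mk (A.CutAdj e) q.1.1.1 = Quot.mk (A.CutAdj e) e.1 := by
        rw [← hbe, hbp]
        exact (quot_adj_of_face (G := A.cut e) hpq).symm
      have hqE : ¬ A.IsEnd e q.1.1.1 := fun h =>
        hb.quot_ne h (isEnd_fst e) (fun h' => hq (Subtype.ext h')) hqe
      refine ⟨⟨⟨q.1.1.1, (cut_halfEdge_iff.1 q.1.1.2).resolve_left hqE⟩, hqC⟩, rfl, ?_, hqe⟩
      rw [← hbn]
      exact Quot.sound ⟨hp q, hp p, rfl, hbp.symm, hqC', hpC, (face_of_cut_face hpq).symm⟩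
    · refine ⟨⟨(⟨n'.1.1, cut_halfEdge_iff.2 (Or.inr hn)⟩, n'.1.2), n'.2⟩, ⟨n, rfl, rfl, ?_⟩,
        hnC.1, hnC.2, hnp⟩
      exact quot_adj_of_face (G := A.cut e) hnp
  refine Nat.card_eq_one_iff_exists.2
    ⟨⟨Quot.mk _ n, n, ⟨⟨(e.1, j), hj₀⟩, n', isEnd_fst e, rfl, hj, hnC.2, hnp.symm⟩, rfl⟩, ?_⟩
  rintro ⟨_, c, ⟨p, q, hpe, hq, hpC, hqC, hpq⟩, rfl⟩
  apply Subtype.ext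
  obtain ⟨hk, hpk⟩ := isEnd_cases hpe
  obtain ⟨r, ⟨b, hbr, hbn, -⟩, -, hrC, hr⟩ := key p.1.2 hk hpC
  refine Eq.trans (Quot.sound ⟨q, hp r, hq, hbr.symm, hqC, hrC, ?_⟩) hbn
  refine (face_of_cut_face hpq).symm.trans (Eq.trans ?_ (face_of_cut_face hr).symm)
  rcases hpk with h | h
  · exact congrArg _ h
  · exact (congrArg _ h).trans (face_strand _)

theorem IsBridge.card_quot_cutBoundaryRel (hb : A.IsBridge e) (o : A.Orientation)
    (hC : 2 ≤ C.card) : Nat.card (Quot (A.CutBoundaryRel e C)) =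
      Nat.card (Quot (A.BoundaryRel C)) + if A.color e.1 ∈ C then 1 else 0 := by
  by_cases he : A.color e.1 ∈ C
  · rw [if_pos he]
    let x₁ : A.CutHalfEdge e C := ⟨⟨e.1, cut_opp_of_isEnd (isEnd_fst e)⟩, he⟩
    let x₂ : A.CutHalfEdge e C :=
      ⟨⟨A.opp e.1, cut_opp_of_isEnd (isEnd_snd e)⟩, (A.opp_color e.1).symm ▸ he⟩
    have hend : ∀ x : A.CutHalfEdge e C, A.IsEnd e x.1.1 → x = x₁ ∨ x = x₂ := fun x hx =>
      hx.imp (fun h => Subtype.ext (Subtype.ext h)) (fun h => Subtype.ext (Subtype.ext h))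
    -- The two ends of `e` are linked first, which merges two classes, and removed afterwards.
    let r : A.CutHalfEdge e C → A.CutHalfEdge e C → Prop := fun x y =>
      A.CutBoundaryRel e C x y ∨ (x = x₁ ∧ y = x₂)
    have h1 := card_quot_link (J := Unit) (r := A.CutBoundaryRel e C) (r' := r)
      (a := fun _ => x₁) (b := fun _ => x₂) (fun _ _ _ => rfl) ?_
      (fun x y h => Quot.sound (Or.inl h)) (fun _ => Quot.sound (Or.inr ⟨rfl, rfl⟩)) ?_
    · have hEe : ∀ x : A.CutHalfEdge e C, A.IsEnd e x.1.1 → Quot.mk r x = Quot.mk r x₁ := by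
        intro x hx
        rcases hend x hx with rfl | rfl
        · rfl
        · exact (Quot.sound (r := r) (Or.inr ⟨rfl, rfl⟩)).symm
      have hNe : ∀ c, A.BoundaryHangs e C c → Quot.mk r (toCutHalfEdge c) = Quot.mk r x₁ := by
        rintro c ⟨p, q, hp, hq, hpC, hqC, h⟩
        let x : A.CutHalfEdge e C := ⟨⟨p.1.1, cut_opp_of_isEnd hp⟩, hp.color_eq ▸ he⟩
        rw [← hEe x hp]
        exact Quot.sound (Or.inl ⟨q, p, hq, rfl, hqC, hpC, h.symm⟩)
      have h2 := card_quot_remove (r := r) (s := A.BoundaryRel C) toCutHalfEdge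
        (fun x => A.IsEnd e x.1.1) (A.BoundaryHangs e C) x₁ toCutHalfEdge_injective
        isEnd_or_toCutHalfEdge not_isEnd_toCutHalfEdge ?_ ?_ ?_ hNe hEe (isEnd_fst e)
      · rw [hb.card_boundaryHangs o he (Finset.exists_mem_ne (by omega) _)] at h2
        rw [Nat.card_unique (α := Unit)] at h1
        omega
      · rintro b c ⟨p, q, hp, hq, hpC, hqC, h⟩
        rcases hb.cut_face_or h with h | ⟨x, y, hx, hy, hpx, hqy⟩
        · exact Quot.sound (Or.inl ⟨p, q, hp, hq, hpC, hqC, h⟩)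
        · have hxC := color_mem_of_face (face_of_cut_face hpx) (by rw [hp]; exact b.2) hpC
          have hyC := color_mem_of_face (face_of_cut_face hqy) (by rw [hq]; exact c.2) hqC
          rw [hNe b ⟨x, p, hx, hp, hxC.2, hpC, hpx.symm⟩,
            hNe c ⟨y, q, hy, hq, hyC.2, hqC, hqy.symm⟩]
      · rintro b c (⟨p, q, hp, hq, hpC, hqC, h⟩ | h)
        · exact Quot.sound ⟨p, q, hp, hq, hpC, hqC, face_of_cut_face h⟩
        · exact absurd (congrArg (fun x : A.CutHalfEdge e C => x.1.1) h.1)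
            fun h => not_isEnd_toCutHalfEdge b (Or.inl h)
      · rintro x c hx ((⟨p, q, hp, hq, hpC, hqC, h⟩ | h) | (⟨p, q, hp, hq, hpC, hqC, h⟩ | h))
        · exact ⟨p, q, by rw [hp]; exact hx, hq, hpC, hqC, h⟩
        · exact absurd (congrArg (fun x : A.CutHalfEdge e C => x.1.1) h.2)
            fun h => not_isEnd_toCutHalfEdge c (Or.inr h)
        · exact ⟨q, p, by rw [hq]; exact hx, hp, hqC, hpC, h.symm⟩
        · exact absurd (congrArg (fun x : A.CutHalfEdge e C => x.1.1) h.1)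
            fun h => not_isEnd_toCutHalfEdge c (Or.inl h)
    · intro _ _ h
      refine hb.quot_ne (isEnd_fst e) (isEnd_snd e) e.2.symm (eq_of_quot_eq
        (fun x : A.CutHalfEdge e C => Quot.mk (A.CutAdj e) x.1.1) ?_ h)
      rintro x y ⟨p, q, hp, hq, -, -, h⟩
      exact ((congrArg (Quot.mk (A.CutAdj e)) hp).symm.trans
        (quot_adj_of_face (G := A.cut e) h)).trans (congrArg (Quot.mk (A.CutAdj e)) hq)
    · rintro x y (h | ⟨rfl, rfl⟩)
      · exact Or.inl (Quot.sound h)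
      · exact Or.inr ⟨(), Or.inl ⟨rfl, rfl⟩⟩
  · rw [if_neg he, add_zero]
    have hne : ∀ x : A.CutHalfEdge e C, ¬ A.IsEnd e x.1.1 := fun x hx => he (hx.color_eq ▸ x.2)
    choose g hg using fun x : A.CutHalfEdge e C => (isEnd_or_toCutHalfEdge x).resolve_left (hne x)
    refine card_quot_eq g toCutHalfEdge ?_ ?_ (fun a => by rw [hg])
      (fun b => by rw [toCutHalfEdge_injective (hg (toCutHalfEdge b))])
    · rintro x y ⟨p, q, hp, hq, hpC, hqC, h⟩
      have hx : (g x).1.1 = x.1.1 := congrArg (fun x : A.CutHalfEdge e C => x.1.1) (hg x)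
      have hy : (g y).1.1 = y.1.1 := congrArg (fun x : A.CutHalfEdge e C => x.1.1) (hg y)
      exact Quot.sound ⟨p, q, hp.trans hx.symm, hq.trans hy.symm, hpC, hqC, face_of_cut_face h⟩
    · rintro b c ⟨p, q, hp, hq, hpC, hqC, h⟩
      rcases hb.cut_face_or h with h | ⟨x, y, hx, -, hpx, -⟩
      · exact Quot.sound ⟨p, q, hp, hq, hpC, hqC, h⟩
      · have hxC := color_mem_of_face (face_of_cut_face hpx) (by rw [hp]; exact b.2) hpC
        exact absurd (hx.color_eq ▸ hxC.1) he

theorem IsBridge.numBoundaryComponents_cut (hb : A.IsBridge e) (o : A.Orientation) :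
    (A.cut e).numBoundaryComponents = A.numBoundaryComponents + 1 := by
  have h := hb.card_quot_cutBoundaryRel o (C := Finset.univ) (by decide)
  rw [if_pos (Finset.mem_univ _)] at h
  rw [numBoundaryComponents_eq_card, numBoundaryComponents_eq_card]
  exact h

theorem IsBridge.numBoundaryFaces_cut (hb : A.IsBridge e) (o : A.Orientation) :
    (A.cut e).numBoundaryFaces = A.numBoundaryFaces + 6 := by
  rw [← (sum_powersetCard_mem (A.color e.1)).1, numBoundaryFaces, numBoundaryFaces,
    ← Finset.sum_add_distrib]
  refine Finset.sum_congr rfl fun C hC => ?_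
  exact hb.card_quot_cutBoundaryRel o (by rw [(Finset.mem_powersetCard.1 hC).2]; decide)

end StrandedGraph

namespace StrandedGraph

variable {G A B : StrandedGraph}

/-! ### Spanning c-subgraphs -/

theorem cSubgraph_opp_of_mem {S : Finset (Sym2 G.Flag)} {h : G.Flag} (hS : s(h, G.opp h) ∈ S) :
    (G.cSubgraph S).opp h = G.opp h :=
  (cSubgraph_opp S h).trans (if_pos hS)

theorem cSubgraph_opp_of_notMem {S : Finset (Sym2 G.Flag)} {h : G.Flag}
    (hS : s(h, G.opp h) ∉ S) : (G.cSubgraph S).opp h = h :=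
  (cSubgraph_opp S h).trans (if_neg hS)

theorem cSubgraph_opp_or (S : Finset (Sym2 G.Flag)) (h : G.Flag) :
    (G.cSubgraph S).opp h = G.opp h ∨ (G.cSubgraph S).opp h = h := by
  by_cases hS : s(h, G.opp h) ∈ S
  · exact Or.inl (cSubgraph_opp_of_mem hS)
  · exact Or.inr (cSubgraph_opp_of_notMem hS)

open Classical in
theorem cSubgraph_cSubgraph (S T : Finset (Sym2 G.Flag)) :
    (G.cSubgraph S).cSubgraph T = G.cSubgraph (S ∩ T) := by
  have h' : ((G.cSubgraph S).cSubgraph T).opp = (G.cSubgraph (S ∩ T)).opp := by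
    funext h
    by_cases hS : s(h, G.opp h) ∈ S
    · have h1 := cSubgraph_opp_of_mem hS
      by_cases hT : s(h, G.opp h) ∈ T
      · refine (cSubgraph_opp_of_mem (G := G.cSubgraph S) ?_).trans
          (h1.trans (cSubgraph_opp_of_mem (Finset.mem_inter.2 ⟨hS, hT⟩)).symm)
        rw [h1]; exact hT
      · refine (cSubgraph_opp_of_notMem (G := G.cSubgraph S) ?_).trans
          (cSubgraph_opp_of_notMem fun h => hT (Finset.mem_inter.1 h).2).symm
        rw [h1]; exact hT
    · have h1 := cSubgraph_opp_of_notMem hS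
      refine Eq.trans ?_ (cSubgraph_opp_of_notMem fun h => hS (Finset.mem_inter.1 h).1).symm
      exact (cSubgraph_opp_or (G := G.cSubgraph S) T h).elim (fun h => h.trans h1) id
  unfold cSubgraph at h' ⊢
  simp only [mk.injEq, heq_eq_eq, true_and, and_true]
  exact h'

open Classical in
theorem edges_cSubgraph (S : Finset (Sym2 G.Flag)) : (G.cSubgraph S).edges = G.edges ∩ S := by
  refine Finset.ext fun (ε : Sym2 G.Flag) => mem_edges.trans (Iff.trans ⟨?_, ?_⟩
    (Finset.mem_inter.trans (and_congr_left' mem_edges)).symm)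
  · rintro ⟨h, hne, rfl⟩
    by_cases hS : s(h, G.opp h) ∈ S
    · have h1 := cSubgraph_opp_of_mem hS
      rw [h1] at hne ⊢
      exact ⟨⟨h, hne, rfl⟩, hS⟩
    · exact absurd (cSubgraph_opp_of_notMem hS) hne
  · rintro ⟨⟨h, hne, rfl⟩, hS⟩
    have h1 := cSubgraph_opp_of_mem hS
    exact ⟨h, fun h' => hne (h1.symm.trans h'), (congrArg (fun x => s(h, x)) h1).symm⟩

theorem numEdges_cSubgraph {S : Finset (Sym2 G.Flag)} (hS : S ⊆ G.edges) :
    (G.cSubgraph S).numEdges = S.card := by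
  classical
  exact congrArg Finset.card ((edges_cSubgraph S).trans (Finset.inter_eq_right.2 hS))

theorem edge_mem_edges (e : G.Edge) : s(e.1, G.opp e.1) ∈ G.edges := mem_edges.2 ⟨e.1, e.2, rfl⟩

open Classical in
theorem edges_cut (e : G.Edge) : (G.cut e).edges = G.edges.erase s(e.1, G.opp e.1) :=
  (edges_cSubgraph _).trans (Finset.inter_eq_right.2 (Finset.erase_subset _ _))

theorem numEdges_cut (e : G.Edge) : (G.cut e).numEdges + 1 = G.numEdges := by
  classical
  rw [numEdges, numEdges, edges_cut]
  exact Finset.card_erase_add_one (edge_mem_edges e)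

open Classical in
theorem cSubgraph_of_cut (e : G.Edge) {S : Finset (Sym2 G.Flag)}
    (hS : S ⊆ G.edges.erase s(e.1, G.opp e.1)) : (G.cut e).cSubgraph S = G.cSubgraph S :=
  (cSubgraph_cSubgraph _ S).trans (by rw [Finset.inter_eq_right.2 hS])

theorem cSubgraph_adj {S : Finset (Sym2 G.Flag)} {x y : G.Flag} (h : (G.cSubgraph S).Adj x y) :
    G.Adj x y ∨ x = y := by
  rcases h with h | h
  · exact Or.inl (Or.inl h)
  · rcases cSubgraph_opp_or S x with h' | h'
    · exact Or.inl (Or.inr (h'.symm.trans h))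
    · exact Or.inr (h'.symm.trans h)

/-! ### Rank and nullity -/

/-- The subtraction in the definition of the rank is not truncated. -/
theorem numComponents_le_numVertices (G : StrandedGraph) : G.numComponents ≤ G.numVertices := by
  refine Nat.add_le_add_right (Nat.card_le_card_of_surjective
    (Quot.lift (fun x => Quot.mk G.Adj x) fun x y h => Quot.sound (Or.inl h)) ?_) _
  rintro ⟨x⟩
  exact ⟨Quot.mk _ x, rfl⟩

theorem numVertices_cut (e : G.Edge) : (G.cut e).numVertices = G.numVertices := rfl

theorem rank_cSubgraph_le (S : Finset (Sym2 G.Flag)) : (G.cSubgraph S).rank ≤ G.rank := by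
  refine Nat.sub_le_sub_left ?_ G.numVertices
  refine Nat.add_le_add_right (Nat.card_le_card_of_surjective
    (α := Quot (G.cSubgraph S).Adj) (Quot.lift (fun x : G.Flag => Quot.mk G.Adj x) ?_) ?_) _
  · intro x y h
    rcases cSubgraph_adj h with h | rfl
    · exact Quot.sound h
    · rfl
  · rintro ⟨x⟩
    exact ⟨Quot.mk _ x, rfl⟩

theorem IsBridge.rank_eq {e : G.Edge} (hb : G.IsBridge e) : G.rank = (G.cut e).rank + 1 := by
  have h1 := hb.numComponents_cut
  have h2 := (G.cut e).numComponents_le_numVertices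
  have h3 := numVertices_cut e
  rw [rank, rank]
  omega

theorem rank_cut_of_not_isBridge {e : G.Edge} (hb : ¬ G.IsBridge e) :
    (G.cut e).rank = G.rank := by
  rw [rank, rank, numComponents_cut_of_not_isBridge hb, numVertices_cut]

/-- The subtraction in the definition of the nullity is not truncated. -/
theorem rank_le_numEdges (G : StrandedGraph) : G.rank ≤ G.numEdges := by
  suffices H : ∀ n, ∀ G : StrandedGraph, G.numEdges = n → G.rank ≤ n from H _ G rfl
  intro n
  induction n with
  | zero =>
    intro G hG
    have h1 : ∀ h, G.opp h = h := by
      intro h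
      by_contra hne
      rw [numEdges, Finset.card_eq_zero] at hG
      have h2 := edge_mem_edges (⟨h, hne⟩ : G.Edge)
      rw [hG] at h2
      exact Finset.notMem_empty _ h2
    have h2 : Nat.card (Quot G.ChordAdj) = Nat.card (Quot G.Adj) := by
      refine card_quot_eq id id (fun x y h => Quot.sound (Or.inl h)) ?_ (fun _ => rfl)
        (fun _ => rfl)
      rintro x y (h | h)
      · exact Quot.sound h
      · rw [← h, h1]
    rw [rank, numVertices, numComponents, h2]
    omega
  | succ n ih =>
    intro G hG
    have h1 : G.edges.Nonempty := by rw [← Finset.card_pos]; exact lt_of_lt_of_eq n.succ_pos hG.symm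
    obtain ⟨ε, hε⟩ := h1
    obtain ⟨h, hne, -⟩ := mem_edges.1 hε
    let e : G.Edge := ⟨h, hne⟩
    have h2 := numEdges_cut e
    have h3 := ih (G.cut e) (by omega)
    by_cases hb : G.IsBridge e
    · have h4 := hb.rank_eq
      omega
    · have h4 := rank_cut_of_not_isBridge hb
      omega

/-! ### Contractions of spanning c-subgraphs -/

open Classical in
/-- The edge `e` in a spanning c-subgraph that contains it. -/
def edgeIn (e : G.Edge) (S : Finset (Sym2 G.Flag)) :
    (G.cSubgraph (insert s(e.1, G.opp e.1) S)).Edge :=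
  ⟨e.1, fun h => e.2 ((cSubgraph_opp_of_mem (Finset.mem_insert_self _ _)).symm.trans h)⟩

section

variable {e : G.Edge} {S : Finset (Sym2 G.Flag)}

open Classical

theorem opp_edgeIn : (G.cSubgraph (insert s(e.1, G.opp e.1) S)).opp e.1 = G.opp e.1 :=
  cSubgraph_opp_of_mem (Finset.mem_insert_self _ _)

theorem isEnd_edgeIn {h : G.Flag} :
    (G.cSubgraph (insert s(e.1, G.opp e.1) S)).IsEnd (edgeIn e S) h ↔ G.IsEnd e h :=
  or_congr Iff.rfl (iff_of_eq (congrArg (h = ·) opp_edgeIn))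

theorem strand_edgeIn {p : G.Point} (hp : G.IsEnd e p.1.1) :
    (G.cSubgraph (insert s(e.1, G.opp e.1) S)).strand p = G.strand p := by
  refine Subtype.ext (Prod.ext (cSubgraph_opp_of_mem ?_) rfl)
  rw [mk_eq_mk_iff_isEnd.2 hp]
  exact Finset.mem_insert_self _ _

theorem isInnerStrand_edgeIn {p : G.Point} (hp : G.IsEnd e p.1.1) :
    (G.cSubgraph (insert s(e.1, G.opp e.1) S)).IsInnerStrand p ↔ G.IsInnerStrand p :=
  iff_of_eq (congrArg (G.chord p = ·) (strand_edgeIn hp))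

theorem innerCount_edgeIn : (G.cSubgraph (insert s(e.1, G.opp e.1) S)).innerCount (edgeIn e S) =
    G.innerCount e :=
  Nat.card_congr (Equiv.subtypeEquivRight fun _ =>
    and_congr_right fun hp => isInnerStrand_edgeIn (Or.inl hp))

theorem throughChord_edgeIn (p : G.Point) :
    (G.cSubgraph (insert s(e.1, G.opp e.1) S)).throughChord (edgeIn e S) p =
      G.throughChord e p := by
  by_cases hp : G.IsEnd e (G.chord p).1.1
  · exact (if_pos (isEnd_edgeIn.2 hp)).trans
      ((congrArg G.chord (strand_edgeIn hp)).trans (if_pos hp).symm)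
  · exact (if_neg fun h => hp (isEnd_edgeIn.1 h)).trans (if_neg hp).symm

theorem cut_edgeIn (hS : S ⊆ G.edges.erase s(e.1, G.opp e.1)) :
    (G.cSubgraph (insert s(e.1, G.opp e.1) S)).cut (edgeIn e S) = G.cSubgraph S := by
  have h1 : (G.cSubgraph (insert s(e.1, G.opp e.1) S)).edges = insert s(e.1, G.opp e.1) S := by
    refine (edges_cSubgraph _).trans (Finset.inter_eq_right.2 (Finset.insert_subset
      (edge_mem_edges e) (hS.trans (Finset.erase_subset _ _))))
  have h2 : s((edgeIn e S).1, (G.cSubgraph (insert s(e.1, G.opp e.1) S)).opp (edgeIn e S).1) =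
      s(e.1, G.opp e.1) := congrArg (fun x => s(e.1, x)) opp_edgeIn
  have h3 : s(e.1, G.opp e.1) ∉ S := fun h => Finset.notMem_erase _ _ (hS h)
  rw [cut, h1]
  refine (cSubgraph_cSubgraph _ _).trans (congrArg G.cSubgraph ?_)
  refine (congrArg (fun ε => insert s(e.1, G.opp e.1) S ∩
    (insert s(e.1, G.opp e.1) S).erase ε) h2).trans ?_
  rw [Finset.erase_insert h3, Finset.inter_eq_right.2 (Finset.subset_insert _ _)]

theorem isLoop_edgeIn :
    (G.cSubgraph (insert s(e.1, G.opp e.1) S)).IsLoop (edgeIn e S) ↔ G.IsLoop e :=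
  iff_of_eq (congrArg (Relation.EqvGen G.ChordAdj e.1) opp_edgeIn)

theorem IsBridge.edgeIn (hb : G.IsBridge e) :
    (G.cSubgraph (insert s(e.1, G.opp e.1) S)).IsBridge (edgeIn e S) := by
  intro h
  refine hb (quot_eq_iff_eqvGen.1 (eq_of_quot_eq (fun x : G.Flag => Quot.mk (G.cut e).Adj x) ?_
    ((quot_eq_iff_eqvGen.2 h).trans (congrArg (Quot.mk _) opp_edgeIn))))
  intro x y h
  rcases h with h | h
  · exact Quot.sound (Or.inl h)
  · by_cases hx : G.IsEnd e x
    · exact congrArg _ ((cut_opp_of_isEnd (isEnd_edgeIn.2 hx)).symm.trans h)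
    · have h1 := (cut_opp_of_not_isEnd fun h => hx (isEnd_edgeIn.1 h)).symm.trans h
      rcases cSubgraph_opp_or (insert s(e.1, G.opp e.1) S) x with h2 | h2
      · exact Quot.sound (Or.inr ((cut_opp_of_not_isEnd hx).trans (h2.symm.trans h1)))
      · exact congrArg _ (h2.symm.trans h1)

theorem IsTrivialLoop.edgeIn (ht : G.IsTrivialLoop e) :
    (G.cSubgraph (insert s(e.1, G.opp e.1) S)).IsTrivialLoop (edgeIn e S) := by
  refine ⟨isLoop_edgeIn.2 ht.1, fun p q hp hq hpq hp' hq' h => ?_⟩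
  refine ht.2 p q (isEnd_edgeIn.1 hp) (isEnd_edgeIn.1 hq) hpq (fun h => hp' (isEnd_edgeIn.2 h))
    (fun h => hq' (isEnd_edgeIn.2 h)) (quot_eq_iff_eqvGen.1 (eq_of_quot_eq
      (fun x : G.Flag => Quot.mk (G.AdjOutside e) x) ?_ (quot_eq_iff_eqvGen.2 h)))
  rintro x y ⟨hx, hy, h⟩
  rcases cSubgraph_adj h with h | rfl
  · exact Quot.sound ⟨fun h => hx (isEnd_edgeIn.2 h), fun h => hy (isEnd_edgeIn.2 h), h⟩
  · rfl

/-- The edges of `G / e`, as edges of `G`. -/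
def liftEdge (e : G.Edge) : Sym2 (G.contract e).Flag ↪ Sym2 G.Flag :=
  Function.Embedding.sym2Map (Function.Embedding.subtype fun h => ¬ G.IsEnd e h)

theorem map_liftEdge_edges (e : G.Edge) :
    (G.contract e).edges.map (liftEdge e) = G.edges.erase s(e.1, G.opp e.1) := by
  ext ε
  rw [Finset.mem_map, Finset.mem_erase, mem_edges]
  constructor
  · rintro ⟨_, hε, rfl⟩
    obtain ⟨h, hne, rfl⟩ := mem_edges.1 hε
    exact ⟨fun h' => h.2 (mk_eq_mk_iff_isEnd.1 h'), h.1, fun h' => hne (Subtype.ext h'), rfl⟩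
  · rintro ⟨h1, h, hne, rfl⟩
    let h' : (G.contract e).Flag := ⟨h, fun h' => h1 (mk_eq_mk_iff_isEnd.2 h')⟩
    exact ⟨s(h', (G.contract e).opp h'),
      mem_edges.2 ⟨h', fun h2 => hne (congrArg Subtype.val h2), rfl⟩, rfl⟩

theorem isContraction_contract (e : G.Edge) :
    IsContraction G (G.contract e) e Subtype.val where
  injective := Subtype.val_injective
  isEnd_or x := or_iff_not_imp_left.2 fun h => ⟨⟨x, h⟩, rfl⟩
  not_isEnd b := b.2
  color _ := rfl
  opp _ := rfl
  chord _ := rfl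
  discs := rfl

/-- Contracting `e` in a spanning c-subgraph of `G` gives a spanning c-subgraph of `G / e`. -/
theorem isContraction_cSubgraph (e : G.Edge) (S : Finset (Sym2 (G.contract e).Flag)) :
    IsContraction (G.cSubgraph (insert s(e.1, G.opp e.1) (S.map (liftEdge e))))
      ((G.contract e).cSubgraph S) (edgeIn e _) Subtype.val where
  injective := Subtype.val_injective
  isEnd_or x := or_iff_not_imp_left.2 fun h => ⟨⟨x, fun h' => h (isEnd_edgeIn.2 h')⟩, rfl⟩
  not_isEnd b := fun h => b.2 (isEnd_edgeIn.1 h)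
  color _ := rfl
  opp b := by
    by_cases hb : s(b, (G.contract e).opp b) ∈ S
    · have h1 := cSubgraph_opp_of_mem hb
      refine (congrArg Subtype.val h1).trans (Eq.symm (cSubgraph_opp_of_mem ?_))
      exact Finset.mem_insert_of_mem (Finset.mem_map_of_mem (liftEdge e) hb)
    · have h1 := cSubgraph_opp_of_notMem hb
      refine (congrArg Subtype.val h1).trans (Eq.symm (cSubgraph_opp_of_notMem ?_))
      intro h
      rcases Finset.mem_insert.1 h with h | h
      · exact b.2 (mk_eq_mk_iff_isEnd.1 h)
      · exact hb ((Finset.mem_map' (liftEdge e)).1 h)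
  chord p := (throughChord_edgeIn (S := S.map (liftEdge e)) ⟨(p.1.1.1, p.1.2), p.2⟩).symm
  discs := congrArg (G.discs + ·) innerCount_edgeIn.symm

/-- The sets of edges of `G` without `e` are the sets of edges of `G / e`. -/
theorem sum_powerset_erase {M : Type*} [AddCommMonoid M] (e : G.Edge)
    (f : Finset (Sym2 G.Flag) → M) :
    ∑ S ∈ (G.edges.erase s(e.1, G.opp e.1)).powerset, f S =
      ∑ S ∈ (G.contract e).edges.powerset, f (S.map (liftEdge e)) := by
  symm
  refine Finset.sum_bij (fun S _ => S.map (liftEdge e)) ?_ ?_ ?_ (fun _ _ => rfl)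
  · intro S hS
    rw [Finset.mem_powerset] at hS ⊢
    rw [← map_liftEdge_edges]
    exact Finset.map_subset_map.2 hS
  · exact fun S _ T _ h => Finset.map_injective _ h
  · intro S hS
    rw [Finset.mem_powerset, ← map_liftEdge_edges, Finset.subset_map_iff] at hS
    obtain ⟨T, hT, rfl⟩ := hS
    exact ⟨T, Finset.mem_powerset.2 hT, rfl⟩

end

end StrandedGraph

theorem InvRing.zpow_mul_zpow (a b : ℚ) :
    InvRing.zpow a * InvRing.zpow b = InvRing.zpow (a + b) := by
  rw [zpow, zpow, zpow, AddMonoidAlgebra.single_mul_single, one_mul]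

namespace StrandedGraph

variable {A B : StrandedGraph} (α₃ α₄ : ℚ)

/-! ### Weights of spanning c-subgraphs -/

/-- The contribution of a spanning c-subgraph to the invariant, without the power of `x - 1`. -/
noncomputable def weight (A : StrandedGraph) : InvRing :=
  (InvRing.var .y - 1) ^ A.nullity *
    InvRing.zpow (9 * (A.numComponents : ℚ) - A.gamma α₃ α₄) *
    InvRing.var .s ^ A.numBoundaryComponents * InvRing.var .w ^ A.numBoundaryFaces *
    InvRing.var .q ^ A.numBoundaryEdges * InvRing.var .t ^ A.numHalfEdges

theorem invTerm_eq (G A : StrandedGraph) :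
    invTerm α₃ α₄ G A = (InvRing.var .x - 1) ^ (G.rank - A.rank) * weight α₃ α₄ A := by
  simp only [invTerm, weight, mul_assoc]

section

variable {e : A.Edge} {ι : B.Flag → A.Flag}

theorem IsContraction.rank_of_not_isLoop (H : IsContraction A B e ι) (o : A.Orientation)
    (hl : ¬ A.IsLoop e) : A.rank = B.rank + 1 := by
  have h1 := H.numVertices_of_not_isLoop o hl
  have h2 := H.numComponents_of_not_isLoop o hl
  have h3 := B.numComponents_le_numVertices
  rw [rank, rank]
  omega

theorem IsContraction.weight_of_not_isLoop (H : IsContraction A B e ι) (o : A.Orientation)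
    (hl : ¬ A.IsLoop e) (hE : A.numEdges = B.numEdges + 1) :
    weight α₃ α₄ A = weight α₃ α₄ B := by
  have hn : A.nullity = B.nullity := by
    rw [nullity, nullity, H.rank_of_not_isLoop o hl, hE, Nat.add_sub_add_right]
  have hγ : A.gamma α₃ α₄ = B.gamma α₃ α₄ := by
    rw [gamma, gamma, H.numVertices_of_not_isLoop o hl, hE, H.numInternalFaces_eq,
      H.numBubbles_of_not_isLoop o hl (by decide), H.numBubbles_of_not_isLoop o hl (by decide)]
    push_cast
    ring
  rw [weight, weight, hn, hγ, H.numComponents_of_not_isLoop o hl,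
    H.numBoundaryComponents_eq, H.numBoundaryFaces_eq, H.numBoundaryEdges_eq,
    H.numHalfEdges_eq]

/-- Cutting a bridge adds a component, six 3-bubbles, four 4-bubbles, two half-edges, and to the
boundary one component, six faces and four edges. -/
theorem IsBridge.weight_cut (hb : A.IsBridge e) (o : A.Orientation) :
    weight α₃ α₄ (A.cut e) = InvRing.zpow (15 + 4 * α₄) * InvRing.var .s * InvRing.var .w ^ 6 *
      InvRing.var .q ^ 4 * InvRing.var .t ^ 2 * weight α₃ α₄ A := by
  have hE := numEdges_cut e
  have hn : (A.cut e).nullity = A.nullity := by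
    have h1 := hb.rank_eq
    rw [nullity, nullity]
    omega
  have hz : 9 * ((A.cut e).numComponents : ℚ) - (A.cut e).gamma α₃ α₄ =
      (15 + 4 * α₄) + (9 * (A.numComponents : ℚ) - A.gamma α₃ α₄) := by
    rw [gamma, gamma, hb.numComponents_cut, hb.numInternalFaces_cut o, hb.numBubbles_cut,
      hb.numBubbles_cut, (sum_powersetCard_mem _).1, (sum_powersetCard_mem _).2, numVertices_cut,
      ← hE]
    push_cast
    ring
  rw [weight, weight, hn, hz, ← InvRing.zpow_mul_zpow, hb.numBoundaryComponents_cut o,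
    hb.numBoundaryFaces_cut o, hb.numBoundaryEdges_cut o, numHalfEdges_cut]
  ring

theorem IsContraction.rank_of_isTrivialLoop (H : IsContraction A B e ι)
    (ht : A.IsTrivialLoop e) : A.rank = B.rank := by
  have h1 := H.numVertices_of_isTrivialLoop ht
  have h2 := H.numComponents_of_isTrivialLoop ht
  rw [rank, rank]
  omega

/-- Contracting a trivial loop adds three vertices and three components. Of the bubbles with the
colour of `e`, each is replaced by as many as it contains outer strands of `e`. -/
theorem IsContraction.weight_of_isTrivialLoop (H : IsContraction A B e ι)
    (ht : A.IsTrivialLoop e) (hE : A.numEdges = B.numEdges + 1) :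
    weight α₃ α₄ A = (InvRing.var .y - 1) *
      InvRing.zpow (-15 + 6 * (A.innerCount e : ℚ) + 3 * α₃ * (4 - (A.innerCount e : ℚ)) +
        α₄ * (3 * (A.innerCount e : ℚ) - 8)) * weight α₃ α₄ B := by
  have hn : A.nullity = B.nullity + 1 := by
    have h1 := B.rank_le_numEdges
    rw [nullity, nullity, H.rank_of_isTrivialLoop ht]
    omega
  have hi : A.color e.1 ∉ A.outerColors e := fun h => (mem_outerColors.1 h).1 rfl
  have h3 := H.numBubbles_of_isTrivialLoop ht 3
  have h4 := H.numBubbles_of_isTrivialLoop ht 4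
  rw [sum_powersetCard_inter_card (Or.inl rfl) _ _ hi, (sum_powersetCard_mem _).1] at h3
  rw [sum_powersetCard_inter_card (Or.inr rfl) _ _ hi, (sum_powersetCard_mem _).2] at h4
  have hp := card_outerColors e
  have hp' : ((A.outerColors e).card : ℚ) = 4 - (A.innerCount e : ℚ) := by
    rw [eq_sub_iff_add_eq]; exact_mod_cast hp
  have h3' : (B.numBubbles 3 : ℚ) = A.numBubbles 3 + 3 * (4 - (A.innerCount e : ℚ)) - 6 := by
    rw [← hp', eq_sub_iff_add_eq]; exact_mod_cast h3.symm
  have h4' : (B.numBubbles 4 : ℚ) = A.numBubbles 4 + 3 * (4 - (A.innerCount e : ℚ)) - 4 := by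
    rw [← hp', eq_sub_iff_add_eq]; exact_mod_cast h4.symm
  have hz : 9 * (A.numComponents : ℚ) - A.gamma α₃ α₄ =
      (-15 + 6 * (A.innerCount e : ℚ) + 3 * α₃ * (4 - (A.innerCount e : ℚ)) +
        α₄ * (3 * (A.innerCount e : ℚ) - 8)) +
      (9 * (B.numComponents : ℚ) - B.gamma α₃ α₄) := by
    rw [gamma, gamma, h3', h4', H.numComponents_of_isTrivialLoop ht,
      H.numVertices_of_isTrivialLoop ht, hE, H.numInternalFaces_eq]
    push_cast
    ring
  rw [weight, weight, hn, hz, ← InvRing.zpow_mul_zpow, H.numBoundaryComponents_eq,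
    H.numBoundaryFaces_eq, H.numBoundaryEdges_eq, H.numHalfEdges_eq]
  ring

end

/-! ### Sums over spanning c-subgraphs -/

section

open Classical

variable {G : StrandedGraph} (e : G.Edge)

/-- The part of the invariant due to the spanning c-subgraphs that contain `e`, written as a sum over
the spanning c-subgraphs of `G / e`. -/
noncomputable def invariantWith : InvRing :=
  ∑ S ∈ (G.contract e).edges.powerset,
    invTerm α₃ α₄ G (G.cSubgraph (insert s(e.1, G.opp e.1) (S.map (liftEdge e))))

/-- The spanning c-subgraphs of `G` are those that cut `e` and those that contain it. -/
theorem invariant_eq_add : G.invariant α₃ α₄ =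
    (∑ S ∈ (G.edges.erase s(e.1, G.opp e.1)).powerset, invTerm α₃ α₄ G (G.cSubgraph S)) +
      invariantWith α₃ α₄ e := by
  have h1 := Finset.sum_powerset_insert (Finset.notMem_erase s(e.1, G.opp e.1) G.edges)
    (fun S => invTerm α₃ α₄ G (G.cSubgraph S))
  rw [Finset.insert_erase (edge_mem_edges e), sum_powerset_erase e
    (fun S => invTerm α₃ α₄ G (G.cSubgraph (insert s(e.1, G.opp e.1) S)))] at h1
  exact h1

theorem invariant_cut_eq : (G.cut e).invariant α₃ α₄ =
    ∑ S ∈ (G.edges.erase s(e.1, G.opp e.1)).powerset,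
      invTerm α₃ α₄ (G.cut e) (G.cSubgraph S) := by
  refine Finset.sum_congr (congrArg Finset.powerset (edges_cut e)) fun S hS => ?_
  exact congrArg (invTerm α₃ α₄ (G.cut e)) (cSubgraph_of_cut e (Finset.mem_powerset.1 hS))

theorem invariant_of_not_isBridge (hb : ¬ G.IsBridge e) :
    G.invariant α₃ α₄ = (G.cut e).invariant α₃ α₄ + invariantWith α₃ α₄ e := by
  rw [invariant_eq_add α₃ α₄ e, invariant_cut_eq]
  refine congrArg (· + invariantWith α₃ α₄ e) (Finset.sum_congr rfl fun S _ => ?_)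
  rw [invTerm_eq, invTerm_eq, rank_cut_of_not_isBridge hb]

theorem invariant_of_isBridge {e : G.Edge} (hb : G.IsBridge e) :
    G.invariant α₃ α₄ =
      (InvRing.var .x - 1) * (G.cut e).invariant α₃ α₄ + invariantWith α₃ α₄ e := by
  rw [invariant_eq_add α₃ α₄ e, invariant_cut_eq, Finset.mul_sum]
  refine congrArg (· + invariantWith α₃ α₄ e) (Finset.sum_congr rfl fun S hS => ?_)
  have h1 := rank_cSubgraph_le (G := G.cut e) S
  have h2 := cSubgraph_of_cut e (Finset.mem_powerset.1 hS)
  rw [h2] at h1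
  rw [invTerm_eq, invTerm_eq, hb.rank_eq, Nat.sub_add_comm h1, pow_succ]
  ring

theorem numEdges_insert_map {S : Finset (Sym2 (G.contract e).Flag)}
    (hS : S ∈ (G.contract e).edges.powerset) :
    (G.cSubgraph (insert s(e.1, G.opp e.1) (S.map (liftEdge e)))).numEdges =
      ((G.contract e).cSubgraph S).numEdges + 1 := by
  rw [Finset.mem_powerset] at hS
  have h1 : S.map (liftEdge e) ⊆ G.edges.erase s(e.1, G.opp e.1) := by
    rw [← map_liftEdge_edges]
    exact Finset.map_subset_map.2 hS
  rw [numEdges_cSubgraph hS, numEdges_cSubgraph (Finset.insert_subset (edge_mem_edges e)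
    (h1.trans (Finset.erase_subset _ _))),
    Finset.card_insert_of_notMem fun h => Finset.notMem_erase _ _ (h1 h), Finset.card_map]

theorem invariantWith_of_not_isLoop (o : G.Orientation) {e : G.Edge} (hl : ¬ G.IsLoop e) :
    invariantWith α₃ α₄ e = (G.contract e).invariant α₃ α₄ := by
  refine Finset.sum_congr rfl fun S hS => ?_
  have H := isContraction_cSubgraph e S
  have hl' : ¬ (G.cSubgraph (insert s(e.1, G.opp e.1) (S.map (liftEdge e)))).IsLoop
    (edgeIn e _) := fun h => hl (isLoop_edgeIn.1 h)
  rw [invTerm_eq, invTerm_eq, (isContraction_contract e).rank_of_not_isLoop o hl,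
    H.rank_of_not_isLoop (o.cSubgraph _) hl', Nat.add_sub_add_right,
    H.weight_of_not_isLoop α₃ α₄ (o.cSubgraph _) hl' (numEdges_insert_map e hS)]

theorem invariantWith_of_isTrivialLoop {e : G.Edge} (ht : G.IsTrivialLoop e) :
    invariantWith α₃ α₄ e = (InvRing.var .y - 1) *
      InvRing.zpow (-15 + 6 * (G.innerCount e : ℚ) + 3 * α₃ * (4 - (G.innerCount e : ℚ)) +
        α₄ * (3 * (G.innerCount e : ℚ) - 8)) * (G.contract e).invariant α₃ α₄ := by
  rw [invariant, Finset.mul_sum]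
  refine Finset.sum_congr rfl fun S hS => ?_
  have H := isContraction_cSubgraph e S
  have ht' := IsTrivialLoop.edgeIn (S := S.map (liftEdge e)) ht
  rw [invTerm_eq, invTerm_eq, (isContraction_contract e).rank_of_isTrivialLoop ht,
    H.rank_of_isTrivialLoop ht',
    H.weight_of_isTrivialLoop α₃ α₄ ht' (numEdges_insert_map e hS), innerCount_edgeIn]
  ring

theorem invariant_cut_of_isBridge (o : G.Orientation) {e : G.Edge} (hb : G.IsBridge e) :
    (G.cut e).invariant α₃ α₄ = InvRing.zpow (15 + 4 * α₄) * InvRing.var .s *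
      InvRing.var .w ^ 6 * InvRing.var .q ^ 4 * InvRing.var .t ^ 2 *
        (G.contract e).invariant α₃ α₄ := by
  rw [invariant_cut_eq, sum_powerset_erase, ← invariantWith_of_not_isLoop α₃ α₄ o
    (not_isLoop_of_isBridge hb), invariantWith, Finset.mul_sum]
  refine Finset.sum_congr rfl fun S hS => ?_
  have hS' : S.map (liftEdge e) ⊆ G.edges.erase s(e.1, G.opp e.1) := by
    rw [← map_liftEdge_edges]
    exact Finset.map_subset_map.2 (Finset.mem_powerset.1 hS)
  have hb' := IsBridge.edgeIn (S := S.map (liftEdge e)) hb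
  have h1 := hb'.weight_cut α₃ α₄ (o.cSubgraph _)
  have h2 := hb'.rank_eq
  rw [cut_edgeIn hS'] at h1 h2
  rw [invTerm_eq, invTerm_eq, h1, h2, hb.rank_eq, Nat.add_sub_add_right]
  ring

end

end StrandedGraph

theorem theorem3p6 (α₃ α₄ : ℚ) (hα₃ : 0 < α₃) (hα₄ : 0 < α₄) (𝔊 : WColoredGraph)
    (G : StrandedGraph) (hG : 𝔊.IsRepresentative G) (e : G.Edge) :
    (G.IsRegular e →
      G.invariant α₃ α₄ = (G.cut e).invariant α₃ α₄ + (G.contract e).invariant α₃ α₄) ∧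
    (G.IsBridge e →
      (G.cut e).invariant α₃ α₄ =
          InvRing.zpow (15 + 4 * α₄) * InvRing.var .s * InvRing.var .w ^ 6 * InvRing.var .q ^ 4 *
            InvRing.var .t ^ 2 * (G.contract e).invariant α₃ α₄ ∧
      G.invariant α₃ α₄ =
          ((InvRing.var .x - 1) * InvRing.zpow (15 + 4 * α₄) * InvRing.var .s *
            InvRing.var .w ^ 6 * InvRing.var .q ^ 4 * InvRing.var .t ^ 2 + 1) *
            (G.contract e).invariant α₃ α₄) ∧
    (∀ p : ℕ, p ≤ 3 → G.IsTrivialLoop e → G.innerCount e = p →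
      G.invariant α₃ α₄ = (G.cut e).invariant α₃ α₄ +
        (InvRing.var .y - 1) *
          InvRing.zpow (-15 + 6 * (p : ℚ) + 3 * α₃ * (4 - (p : ℚ)) + α₄ * (3 * (p : ℚ) - 8)) *
          (G.contract e).invariant α₃ α₄) := by
  obtain ⟨o⟩ := hG.nonempty_orientation
  refine ⟨fun he => ?_, fun hb => ?_, ?_⟩
  · rw [StrandedGraph.invariant_of_not_isBridge α₃ α₄ e he.2,
      StrandedGraph.invariantWith_of_not_isLoop α₃ α₄ o he.1]
  · have h1 := StrandedGraph.invariant_cut_of_isBridge α₃ α₄ o hb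
    refine ⟨h1, ?_⟩
    rw [StrandedGraph.invariant_of_isBridge α₃ α₄ hb, h1,
      StrandedGraph.invariantWith_of_not_isLoop α₃ α₄ o (StrandedGraph.not_isLoop_of_isBridge hb)]
    ring
  · rintro p - ht rfl
    rw [StrandedGraph.invariant_of_not_isBridge α₃ α₄ e
        (fun hb => StrandedGraph.not_isLoop_of_isBridge hb ht.1),
      StrandedGraph.invariantWith_of_isTrivialLoop α₃ α₄ ht]
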